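/- Let $\mathbb T=\mathbb R/\mathbb Z$, write $\hat u(k)$ ($k\in\mathbb Z$) for the Fourier coefficients of a distribution $u$ on $\mathbb T$ with respect to $e^{2\pi i kx}$, and let $\xi$ be a spatial (real, Gaussian) white noise on $\mathbb T$, so that $E[\hat\xi(k)\hat\xi(k')]=1_{k=-k'}$. Put $Qu=u-\hat u(0)$, $P_t=e^{t\Delta}$, $\nabla=\frac{d}{dx}$. Fix a dyadic partition of unity with Littlewood–Paley blocks $\Delta_j$, $j\ge -1$; let $\|u\|_{C^\beta}=\sup_{j\ge-1}2^{j\beta}\|\Delta_ju\|_{L^\infty}$ be the norm of $C^\beta=B^\beta_{\infty,\infty}(\mathbb T)$ and $\Pi(f,g)=\sum_{|i-j|\le1}\Delta_if\,\Delta_jg$ the resonant product (the series, grouped by $i$, converging in the sense of distributions). (1) For every $t>0$ the product $\Pi(\nabla P_tQ\xi,\xi)$ is well defined, almost surely the integral $$\nabla X\diamond\xi=\int_0^\infty\Pi(\nabla P_tQ\xi,\xi)\,dt$$ exists as a (weak) integral of distributions, and $E\big[\|\nabla X\diamond\xi\|_{C^{2\alpha-3}}^p\big]<\infty$ for all $\alpha<\frac32$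 and $p\ge1$. Now let $\psi:\mathbb R\to\mathbb R$ be measurable and integrable with compact support and $\int_{\mathbb R}\psi\,dx=1$. For $\varepsilon>0$ set $\psi^\varepsilon(x)=\frac1\varepsilon\psi(\frac x\varepsilon)$, let $\xi^\varepsilon=\psi^\varepsilon*\xi$ be the convolution of $\xi$ with the periodization of $\psi^\varepsilon$, and let $\nabla X^\varepsilon=\int_0^\infty\nabla P_tQ\xi^\varepsilon\,dt=\nabla(-\Delta)^{-1}Q\xi^\varepsilon$ (both expressions exist and agree). Let $\hat\psi(y)=\int_{\mathbb R}e^{-2\pi iyx}\psi(x)\,dx$. (2) For every $\varepsilon>0$ the product $\Pi(\nabla X^\varepsilon,\xi^\varepsilon)$ almost surely exists, and for all $\alpha<\frac32$ and $p\ge1$ $$\lim_{\varepsilon\downarrow0}E\big[\|\nabla X\diamond\xi-\Pi(\nabla X^\varepsilon,\xi^\varepsilon)\|_{C^{2\alpha-3}}^p\big]=0 .$$ (3) The would-be renormalization constant vanishes for every $\varepsilon>0$: (a) if in addition $\psi\in L^2(\mathbb R)$, then for every $x\in\mathbb T$ the values $\nabla X^\varepsilon(x)$, $\xi^\varepsilon(x)$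 exist as square integrable random variables ($L^2(\Omega)$-limits of the Fourier partial sums), the series $\Pi(\nabla X^\varepsilon,\xi^\varepsilon)(x)$ converges almost surely to an integrable random variable, the random variables $\Pi(\nabla P_tQ\xi^\varepsilon,\xi^\varepsilon)(x)$ are integrable for all $t>0$, and $$c_\varepsilon:=E[\nabla X^\varepsilon(x)\,\xi^\varepsilon(x)]=E[\Pi(\nabla X^\varepsilon,\xi^\varepsilon)(x)]=\int_0^\infty E[\Pi(\nabla P_tQ\xi^\varepsilon,\xi^\varepsilon)(x)]\,dt=\sum_{k\in\mathbb Z\setminus\{0\}}\frac{|\hat\psi(\varepsilon k)|^2}{4\pi^2k^2}\,2\pi ik=0,$$ the last series being absolutely convergent; (b) for general $\psi$ as above the same holds in the following sense. With $S_N$ denoting the Fourier partial sum over $|k|\le N$, for all $N\in\mathbb N$ and $x\in\mathbb T$ the product $S_N\nabla X^\varepsilon(x)\,S_N\xi^\varepsilon(x)$ is integrable and $$E[S_N\nabla X^\varepsilon(x)\,S_N\xi^\varepsilon(x)]=\sum_{0<|k|\le N}\frac{|\hat\psi(\varepsilon k)|^2}{4\pi^2k^2}\,2\pi ik=0;$$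 for every smooth $\varphi$ on $\mathbb T$ the random variable $\langle\Pi(\nabla X^\varepsilon,\xi^\varepsilon),\varphi\rangle$ is integrable with mean $0$; and for every $x\in\mathbb T$ and $t>0$ the series $\Pi(\nabla P_tQ\xi^\varepsilon,\xi^\varepsilon)(x)$ converges to an integrable random variable of mean $0$, so that $\int_0^\infty E[\Pi(\nabla P_tQ\xi^\varepsilon,\xi^\varepsilon)(x)]\,dt=0$. -/

import Mathlib

open MeasureTheory ProbabilityTheory Filter Topology
open scoped ENNReal

noncomputable section

namespace TorusNoise

/-! ### Distributions on the torus `𝕋 = ℝ / ℤ` -/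

/-- A (complex-valued) distribution on the one-dimensional torus, given as its formal Fourier
series `∑ₖ û(k) e^{2πikx}`: the Fourier coefficients of the distributions on `𝕋` are exactly the
sequences of at most polynomial growth. -/
@[ext] structure PeriodicDistribution where
  /-- The Fourier coefficients `û(k)`. -/
  coeff : ℤ → ℂ
  tempered : ∃ (C : ℝ) (n : ℕ), ∀ k : ℤ, ‖coeff k‖ ≤ C * (1 + |(k : ℝ)|) ^ n

/-- The smooth functions on the torus. -/
def IsTestFunction (φ : UnitAddCircle → ℂ) : Prop :=
  ContDiff ℝ (⊤ : ℕ∞) (fun x : ℝ => φ (x : UnitAddCircle))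

namespace PeriodicDistribution

instance : Zero PeriodicDistribution := ⟨⟨fun _ => 0, 0, 0, by simp⟩⟩

instance : Nonempty PeriodicDistribution := ⟨0⟩

instance : Sub PeriodicDistribution where
  sub u v :=
    { coeff := fun k => u.coeff k - v.coeff k
      tempered := by
        obtain ⟨C, n, hu⟩ := u.tempered
        obtain ⟨D, m, hv⟩ := v.tempered
        refine ⟨|C| + |D|, n + m, fun k => ?_⟩
        have h1 : (1 : ℝ) ≤ 1 + |(k : ℝ)| := by linarith [abs_nonneg (k : ℝ)]
        have hn : (1 + |(k : ℝ)|) ^ n ≤ (1 + |(k : ℝ)|) ^ (n + m) :=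
          pow_le_pow_right₀ h1 (Nat.le_add_right n m)
        have hm : (1 + |(k : ℝ)|) ^ m ≤ (1 + |(k : ℝ)|) ^ (n + m) :=
          pow_le_pow_right₀ h1 (Nat.le_add_left m n)
        calc ‖u.coeff k - v.coeff k‖ ≤ ‖u.coeff k‖ + ‖v.coeff k‖ := norm_sub_le _ _
          _ ≤ C * (1 + |(k : ℝ)|) ^ n + D * (1 + |(k : ℝ)|) ^ m := add_le_add (hu k) (hv k)
          _ ≤ |C| * (1 + |(k : ℝ)|) ^ n + |D| * (1 + |(k : ℝ)|) ^ m := by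
              gcongr <;> exact le_abs_self _
          _ ≤ |C| * (1 + |(k : ℝ)|) ^ (n + m) + |D| * (1 + |(k : ℝ)|) ^ (n + m) := by gcongr
          _ = (|C| + |D|) * (1 + |(k : ℝ)|) ^ (n + m) := by ring }

/-- The pairing `⟨u, φ⟩` (the extension of `∫_𝕋 u φ`) with a smooth function `φ`; the series
converges absolutely because `φ̂` decays rapidly. -/
def pairing (u : PeriodicDistribution) (φ : UnitAddCircle → ℂ) : ℂ :=
  ∑' k : ℤ, u.coeff k * fourierCoeff φ (-k)

/-- The Fourier partial sum `∑_{|k| ≤ N} û(k) e^{2πikx}`. -/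
def partialSum (u : PeriodicDistribution) (N : ℕ) (x : UnitAddCircle) : ℂ :=
  ∑ k ∈ Finset.Icc (-(N : ℤ)) N, u.coeff k * fourier k x

/-- The Fourier multiplier with a symbol of at most polynomial growth. -/
def multiplier (m : ℤ → ℂ) (hm : ∃ (C : ℝ) (n : ℕ), ∀ k : ℤ, ‖m k‖ ≤ C * (1 + |(k : ℝ)|) ^ n)
    (u : PeriodicDistribution) : PeriodicDistribution where
  coeff k := m k * u.coeff k
  tempered := by
    obtain ⟨C, n, hC⟩ := hm
    obtain ⟨D, l, hD⟩ := u.tempered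
    refine ⟨C * D, n + l, fun k => ?_⟩
    rw [norm_mul]
    calc ‖m k‖ * ‖u.coeff k‖
        ≤ (C * (1 + |(k : ℝ)|) ^ n) * (D * (1 + |(k : ℝ)|) ^ l) :=
          mul_le_mul (hC k) (hD k) (norm_nonneg _) ((norm_nonneg _).trans (hC k))
      _ = C * D * (1 + |(k : ℝ)|) ^ (n + l) := by ring

/-- The derivative `∇ = d/dx`, with symbol `2πik`. -/
def grad : PeriodicDistribution → PeriodicDistribution :=
  multiplier (fun k => 2 * Real.pi * Complex.I * k) ⟨2 * Real.pi, 1, fun k => by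
    have h : ‖2 * (Real.pi : ℂ) * Complex.I * (k : ℂ)‖ = 2 * Real.pi * |(k : ℝ)| := by
      simp [abs_of_pos Real.pi_pos]
    rw [h, pow_one]
    have := Real.pi_pos
    gcongr
    linarith⟩

/-- `Q u = u - û(0)`, the projection onto mean-zero distributions. -/
def meanFree : PeriodicDistribution → PeriodicDistribution :=
  multiplier (fun k => if k = 0 then 0 else 1) ⟨1, 0, fun k => by split_ifs <;> simp⟩

/-- The heat semigroup `P_t = e^{tΔ}`, `t ≥ 0` (negative times are not used and are read as `0`),
with symbol `e^{-4π²k²t}`. -/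
def heat (t : ℝ) : PeriodicDistribution → PeriodicDistribution :=
  multiplier (fun k => (Real.exp (-4 * Real.pi ^ 2 * (k : ℝ) ^ 2 * max t 0) : ℝ)) ⟨1, 0, fun k => by
    rw [Complex.norm_real, Real.norm_eq_abs, abs_of_pos (Real.exp_pos _), pow_zero, mul_one,
      Real.exp_le_one_iff]
    have h : 0 ≤ 4 * Real.pi ^ 2 * (k : ℝ) ^ 2 * max t 0 :=
      mul_nonneg (by positivity) (le_max_right _ _)
    linarith⟩

/-- The inverse `(-Δ)⁻¹` of `-Δ` on mean-zero distributions, with symbol `1 / (4π²k²)`,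
`k ≠ 0`. -/
def invNegLaplacian : PeriodicDistribution → PeriodicDistribution :=
  multiplier (fun k => if k = 0 then 0 else ((1 / (4 * Real.pi ^ 2 * (k : ℝ) ^ 2) : ℝ) : ℂ))
    ⟨1, 0, fun k => by
      split_ifs with hk
      · simp
      · have h1 : (1 : ℝ) ≤ (k : ℝ) ^ 2 := by
          rw [← sq_abs]
          exact one_le_pow₀ (by exact_mod_cast Int.one_le_abs hk)
        have h2 : (1 : ℝ) ≤ Real.pi ^ 2 := one_le_pow₀ (by linarith [Real.pi_gt_three])
        have h3 : (1 : ℝ) ≤ 4 * Real.pi ^ 2 * (k : ℝ) ^ 2 := by nlinarith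
        rw [Complex.norm_real, Real.norm_eq_abs, abs_of_nonneg (by positivity), pow_zero, mul_one]
        exact (div_le_one (by linarith)).2 h3⟩

/-- `∇X` for the mean-zero solution `X = (-Δ)⁻¹ Q u` of `-ΔX = Q u`. -/
def gradPotential (u : PeriodicDistribution) : PeriodicDistribution :=
  grad (invNegLaplacian (meanFree u))

end PeriodicDistribution

open PeriodicDistribution

/-- `w = ∫₀^∞ F(t) dt` as a distribution-valued (weak) integral. -/
def IsWeakIntegral (F : ℝ → PeriodicDistribution) (w : PeriodicDistribution) : Prop :=
  ∀ φ : UnitAddCircle → ℂ, IsTestFunction φ →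
    IntegrableOn (fun t => (F t).pairing φ) (Set.Ioi 0) volume ∧
      ∫ t in Set.Ioi (0 : ℝ), (F t).pairing φ = w.pairing φ

/-! ### Mollifiers -/

/-- The mollifiers: measurable, integrable, compactly supported, of integral one. -/
structure IsMollifier (ψ : ℝ → ℝ) : Prop where
  measurable : Measurable ψ
  integrable : Integrable ψ volume
  hasCompactSupport : HasCompactSupport ψ
  integral_eq_one : ∫ x, ψ x = 1

/-- The Fourier transform `f̂(y) = ∫_ℝ e^{-2πiyx} f(x) dx` on the real line. -/
def lineFourier (f : ℝ → ℝ) (y : ℝ) : ℂ :=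
  ∫ x : ℝ, Complex.exp ((-2 * Real.pi * y * x : ℝ) * Complex.I) * (f x : ℂ)

/-- `ψ^ε(x) = ε⁻¹ ψ(x / ε)`. -/
def rescale (ψ : ℝ → ℝ) (ε : ℝ) (x : ℝ) : ℝ := (1 / ε) * ψ (x / ε)

/-- The convolution `f * u` on the torus of a distribution `u` with (the periodization of) a
function `f` on the line. The `k`-th Fourier coefficient of the periodization is
`∫_ℝ e^{-2πikx} f(x) dx`. -/
def convolve (f : ℝ → ℝ) : PeriodicDistribution → PeriodicDistribution :=
  multiplier (fun k => lineFourier f k) ⟨∫ x, ‖f x‖, 0, fun k => by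
    rw [pow_zero, mul_one]
    refine (norm_integral_le_integral_norm _).trans (le_of_eq ?_)
    refine integral_congr_ae (Eventually.of_forall fun x => ?_)
    simp only [norm_mul, Complex.norm_exp_ofReal_mul_I, one_mul, Complex.norm_real]⟩

/-! ### Littlewood-Paley theory -/

/-- A dyadic partition of unity `(χ, ρ)` on the line. -/
structure DyadicPartition where
  χ : ℝ → ℝ
  ρ : ℝ → ℝ
  χ_smooth : ContDiff ℝ (⊤ : ℕ∞) χ
  ρ_smooth : ContDiff ℝ (⊤ : ℕ∞) ρ
  χ_nonneg : ∀ x, 0 ≤ χ x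
  ρ_nonneg : ∀ x, 0 ≤ ρ x
  χ_radial : ∀ x, χ (-x) = χ x
  ρ_radial : ∀ x, ρ (-x) = ρ x
  /-- The support of `χ` is contained in a ball. -/
  χ_support : HasCompactSupport χ
  /-- The support of `ρ` is contained in an annulus. -/
  ρ_support : HasCompactSupport ρ ∧ (0 : ℝ) ∉ tsupport ρ
  sum_eq_one : ∀ x, HasSum (fun j : ℕ => ρ (x / 2 ^ j)) (1 - χ x)
  χ_disjoint : ∀ j : ℕ, 1 ≤ j → Disjoint (tsupport χ) (tsupport fun x => ρ (x / 2 ^ j))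
  ρ_disjoint : ∀ i j : ℕ, i + 1 < j →
    Disjoint (tsupport fun x => ρ (x / 2 ^ i)) (tsupport fun x => ρ (x / 2 ^ j))

namespace DyadicPartition

/-- The functions `ρ_{-1} = χ`, `ρ_j = ρ(2^{-j} ·)`, `j ≥ 0`. The index is shifted by one:
`P.window j` is `ρ_{j-1}`. -/
def window (P : DyadicPartition) : ℕ → ℝ → ℝ
  | 0, x => P.χ x
  | j + 1, x => P.ρ (x / 2 ^ j)

/-- The Littlewood-Paley block `P.block j u = Δ_{j-1} u`, with `j = 0, 1, 2, …`; the sum has only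
finitely many nonzero terms. -/
def block (P : DyadicPartition) (j : ℕ) (u : PeriodicDistribution) (x : UnitAddCircle) : ℂ :=
  ∑' k : ℤ, (P.window j k : ℂ) * u.coeff k * fourier k x

/-- The norm `sup_{j ≥ -1} 2^{jα} ‖Δ_j u‖_{L^∞}` of `C^α = B^α_{∞,∞}(𝕋)`; it is `∞` if `u` is not
in `C^α`. -/
def holderNorm (P : DyadicPartition) (α : ℝ) (u : PeriodicDistribution) : ℝ≥0∞ :=
  ⨆ j : ℕ, ENNReal.ofReal ((2 : ℝ) ^ (((j : ℝ) - 1) * α)) * ⨆ x : UnitAddCircle, ‖P.block j u x‖ₑ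

/-- The term `∑_{j : |i - j| ≤ 1} Δ_i f Δ_j g` of the resonant product (both indices are shifted
by one; `i - 1` is read as `0` for `i = 0`). -/
def resonantTerm (P : DyadicPartition) (f g : PeriodicDistribution) (i : ℕ) (x : UnitAddCircle) :
    ℂ :=
  ∑ j ∈ Finset.Icc (i - 1) (i + 1), P.block i f x * P.block j g x

/-- The series `Π(f, g) = ∑_{|i - j| ≤ 1} Δ_i f Δ_j g` converges to `w` in the sense of
distributions. -/
def IsResonantProduct (P : DyadicPartition) (f g w : PeriodicDistribution) : Prop :=
  ∀ φ : UnitAddCircle → ℂ, IsTestFunction φ →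
    Tendsto (fun N : ℕ => ∫ x : UnitAddCircle, (∑ i ∈ Finset.range N, P.resonantTerm f g i x) * φ x)
      atTop (𝓝 (w.pairing φ))

/-- The resonant product `Π(f, g)` (an arbitrary distribution if the series diverges). -/
def resonant (P : DyadicPartition) (f g : PeriodicDistribution) : PeriodicDistribution :=
  Classical.epsilon (P.IsResonantProduct f g)

/-- The value `Π(f, g)(x) = ∑_{|i - j| ≤ 1} Δ_i f(x) Δ_j g(x)` at a point. -/
def resonantAt (P : DyadicPartition) (f g : PeriodicDistribution) (x : UnitAddCircle) : ℂ :=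
  ∑' i : ℕ, P.resonantTerm f g i x

/-- The family `t ↦ Π(∇P_t Q u, u)`. -/
def resonantFlow (P : DyadicPartition) (u : PeriodicDistribution) (t : ℝ) : PeriodicDistribution :=
  P.resonant (grad (heat t (meanFree u))) u

/-- `∇X ⋄ u = ∫₀^∞ Π(∇P_t Q u, u) dt` (an arbitrary distribution if the integral diverges). -/
def diamond (P : DyadicPartition) (u : PeriodicDistribution) : PeriodicDistribution :=
  Classical.epsilon (IsWeakIntegral (P.resonantFlow u))

end DyadicPartition

/-! ### Random distributions -/

/-- `ξ` is a spatial white noise on the torus: a random real distribution such that `⟨ξ, φ⟩` is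
a centred Gaussian variable of variance `‖φ‖²_{L²}` for all real smooth `φ`. -/
structure IsWhiteNoise {Ω : Type*} [MeasurableSpace Ω] (ξ : Ω → PeriodicDistribution)
    (μ : Measure Ω) : Prop where
  real : ∀ ω k, (ξ ω).coeff (-k) = starRingEnd ℂ ((ξ ω).coeff k)
  law : ∀ φ : UnitAddCircle → ℝ, IsTestFunction (fun x => (φ x : ℂ)) →
    HasLaw (fun ω => ((ξ ω).pairing fun x => (φ x : ℂ)).re)
      (gaussianReal 0 (Real.toNNReal (∫ x : UnitAddCircle, φ x ^ 2))) μ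

/-- The random variable `Y` is the value `η(x)` of the random distribution `η` at the point `x`:
the Fourier partial sums of `η` at `x` converge to `Y` in `L²(Ω)`. -/
def IsPointValue {Ω : Type*} [MeasurableSpace Ω] (μ : Measure Ω) (η : Ω → PeriodicDistribution)
    (x : UnitAddCircle) (Y : Ω → ℂ) : Prop :=
  MemLp Y 2 μ ∧
    Tendsto (fun N : ℕ => eLpNorm (fun ω => (η ω).partialSum N x - Y ω) 2 μ) atTop (𝓝 0)

end TorusNoise

end

open TorusNoise TorusNoise.PeriodicDistribution

/-! On mean-zero parts ξ = -ΔX, so formally ∇X·ξ = -½∇(|∇X|²). In one dimension the product is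
therefore a total derivative of a square of ∇X, a function of regularity 1/2-. That square is
classically defined with regularity 1-, its derivative has regularity 0-, and nothing has to be
renormalized.

In Fourier variables this is a symmetrization. The coefficients of ∇X are i û(k)/(2πk), and the
total Littlewood-Paley weight w(k,l) = `weight k l` is symmetric (`weight_comm`). Hence û(k)û(l)
enters with the averaged factor (i/4π) w(k,l)(1/k + 1/l), and 1/k + 1/l = (k+l)/(kl). The gain
|k+l|/(⟨k⟩⟨l⟩) makes all sums absolutely convergent as soon as û(k)/⟨k⟩ is square summable
(`IsRough`), which holds almost surely for white noise. The sum is `symProduct`. It is both the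
resonant product (`isResonantProduct_gradPotential`) and the heat-flow integral
(`isWeakIntegral_resonantFlow`). The first identification needs the bound uniformly in the
truncation, although truncated weights are not symmetric (`abs_partialWeight_symm_le`). The second
needs it after integrating absolute values in time (`integral_abs_heatMode_add_le`).

The Hölder bound is pathwise. By `symProduct_coeff`, `symProduct` is the derivative of the resonant
product of `reduced u` (which is ∇X up to a constant and the zero mode) with `reduced v`, plus a
correction with finitely many frequencies. If the blocks of these factors have size q^i, the i-th
resonant term has size q^{2i} and only meets blocks j ≤ i + c, while ∇Δ_j costs 2^j. Summation gives
every negative exponent (`exists_holderNorm_symProduct_le`), and bilinearity gives a Lipschitz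
estimate for differences.

Probability enters through moments of the first chaos: block sup-norms are controlled by L^{2n}
norms with Nikolskii's inequality, and Gaussian moments are controlled by variances
(`lintegral_blockMoment_le`). The difference ξ - ξ^ε has the bounded symbol 1 - ψ̂(εk), which tends
to 0, so convergence follows by dominated convergence over the blocks.

The renormalization constant only sees frequencies k + l = 0, where the symmetrized kernel vanishes;
equivalently the symbol of ∇(-Δ)⁻¹ is odd (`integral_tsum_coeff_mul`). -/

noncomputable section

namespace TorusNoise

/-! ### The bracket `⟨k⟩ = max 1 |k|` -/

/-- `⟨k⟩ = max 1 |k|`. -/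
def bracket (k : ℤ) : ℝ := max 1 |(k : ℝ)|

lemma one_le_bracket (k : ℤ) : 1 ≤ bracket k := le_max_left _ _

lemma bracket_pos (k : ℤ) : 0 < bracket k := zero_lt_one.trans_le (one_le_bracket k)

lemma abs_le_bracket (k : ℤ) : |(k : ℝ)| ≤ bracket k := le_max_right _ _

lemma bracket_eq_abs {k : ℤ} (hk : k ≠ 0) : bracket k = |(k : ℝ)| :=
  max_eq_right (by exact_mod_cast Int.one_le_abs hk)

@[simp] lemma bracket_zero : bracket 0 = 1 := by simp [bracket]

@[simp] lemma bracket_neg (k : ℤ) : bracket (-k) = bracket k := by simp [bracket]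

lemma bracket_add_le (k l : ℤ) : bracket (k + l) ≤ bracket k + bracket l := by
  refine max_le ?_ ?_
  · linarith [one_le_bracket k, one_le_bracket l]
  · push_cast
    exact (abs_add_le _ _).trans (add_le_add (abs_le_bracket k) (abs_le_bracket l))

lemma bracket_add_le_mul (k l : ℤ) : bracket (k + l) ≤ 2 * (bracket k * bracket l) := by
  have := bracket_add_le k l
  nlinarith [one_le_bracket k, one_le_bracket l]

lemma bracket_sub_le_mul (k l : ℤ) : bracket (k - l) ≤ 2 * (bracket k * bracket l) := by
  simpa [sub_eq_add_neg] using bracket_add_le_mul k (-l)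

lemma one_add_abs_le_bracket (k : ℤ) : 1 + |(k : ℝ)| ≤ 2 * bracket k := by
  linarith [one_le_bracket k, abs_le_bracket k]

lemma bracket_le_one_add_abs (k : ℤ) : bracket k ≤ 1 + |(k : ℝ)| :=
  max_le (by linarith [abs_nonneg (k : ℝ)]) (by linarith)

lemma inv_abs_le_bracket_inv {k : ℤ} : |((k : ℝ))⁻¹| ≤ (bracket k)⁻¹ := by
  rcases eq_or_ne k 0 with rfl | hk
  · simp
  · rw [bracket_eq_abs hk, abs_inv]

lemma summable_bracket_inv_sq : Summable fun k : ℤ => (bracket k ^ 2)⁻¹ := by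
  have h : Summable fun k : ℤ => ((k : ℝ) ^ 2)⁻¹ := by
    simpa using (Real.summable_one_div_int_pow (p := 2)).2 (by norm_num)
  refine (h.add (summable_of_hasFiniteSupport (f := fun k : ℤ => if k = 0 then (1 : ℝ) else 0)
    (Set.Finite.subset (Set.finite_singleton 0) ?_))).of_nonneg_of_le
    (fun k => by have := bracket_pos k; positivity) fun k => ?_
  · intro k hk
    by_contra h
    simp_all
  · rcases eq_or_ne k 0 with rfl | hk
    · simp
    · simp [hk, bracket_eq_abs hk]

lemma PeriodicDistribution.exists_bound (u : PeriodicDistribution) :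
    ∃ (C : ℝ) (n : ℕ), 0 ≤ C ∧ ∀ k, ‖u.coeff k‖ ≤ C * bracket k ^ n := by
  obtain ⟨C, n, h⟩ := u.tempered
  refine ⟨|C| * 2 ^ n, n, by positivity, fun k => (h k).trans ?_⟩
  rw [mul_assoc, ← mul_pow]
  gcongr
  · exact le_abs_self C
  · exact one_add_abs_le_bracket k

/-! ### Fourier coefficients of test functions -/

lemma volume_unitAddCircle : (volume : Measure UnitAddCircle) = AddCircle.haarAddCircle := by
  rw [AddCircle.volume_eq_smul_haarAddCircle]; simp

lemma IsTestFunction.continuous {φ : UnitAddCircle → ℂ} (hφ : IsTestFunction φ) :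
    Continuous φ :=
  (QuotientAddGroup.isOpenQuotientMap_mk
    (N := AddSubgroup.zmultiples (1 : ℝ))).isQuotientMap.continuous_iff.2 (ContDiff.continuous hφ)

lemma fourierCoeff_eq_integral (φ : UnitAddCircle → ℂ) (k : ℤ) :
    fourierCoeff φ k = ∫ x : UnitAddCircle, fourier (-k) x * φ x := by
  rw [volume_unitAddCircle]; rfl

/-- Each integration by parts gains a factor 1/(2πk); periodicity cancels the boundary terms. -/
lemma fourierCoeff_deriv_decay (m : ℕ) (g : ℝ → ℂ) (hg : ContDiff ℝ (⊤ : ℕ∞) g)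
    (hp : Function.Periodic g 1) :
    ∃ C : ℝ, ∀ k : ℤ, |(k : ℝ)| ^ m * ‖fourierCoeffOn zero_lt_one g k‖ ≤ C := by
  induction m generalizing g with
  | zero =>
    refine ⟨∫ x in (0 : ℝ)..1, ‖g x‖, fun k => ?_⟩
    rw [fourierCoeffOn_eq_integral, pow_zero, one_mul, norm_smul]
    norm_num
    refine (intervalIntegral.norm_integral_le_integral_norm zero_le_one).trans (le_of_eq ?_)
    refine intervalIntegral.integral_congr fun x _ => ?_
    simp [Complex.norm_exp]
  | succ m ih =>
    have hd : ContDiff ℝ (⊤ : ℕ∞) (deriv g) := ((contDiff_succ_iff_deriv (n := (⊤ : ℕ∞))).1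
      (by simpa using hg)).2.2
    obtain ⟨C, hC⟩ := ih (deriv g) hd fun x => by
      have := hp.funext
      conv_rhs => rw [← this]
      rw [deriv_comp_add_const]
    refine ⟨C, fun k => ?_⟩
    rcases eq_or_ne k 0 with rfl | hk
    · simpa using le_trans (by positivity) (hC 0)
    · have h1 := fourierCoeffOn_of_hasDerivAt zero_lt_one hk (f := g) (f' := deriv g)
        (fun x _ => ((hg.differentiable (by simp)) x).hasDerivAt)
        (hd.continuous.intervalIntegrable _ _)
      have h2 : g 1 = g 0 := by simpa using hp 0
      rw [h1, h2, sub_self, mul_zero, zero_sub, norm_mul, norm_neg]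
      refine le_trans ?_ (hC k)
      have hk' : 0 < |(k : ℝ)| := by positivity
      have h3 : ‖(1 : ℂ) / (-2 * Real.pi * Complex.I * k)‖ = (2 * Real.pi * |(k : ℝ)|)⁻¹ := by
        simp [abs_of_pos Real.pi_pos]
      rw [h3, Complex.ofReal_one, Complex.ofReal_zero, sub_zero, one_mul, pow_succ]
      have h4 : |(k : ℝ)| ^ m * |(k : ℝ)| * ((2 * Real.pi * |(k : ℝ)|)⁻¹ *
          ‖fourierCoeffOn zero_lt_one (deriv g) k‖) =
          (Real.pi⁻¹ * 2⁻¹) * (|(k : ℝ)| ^ m * ‖fourierCoeffOn zero_lt_one (deriv g) k‖) := by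
        field_simp
      rw [h4]
      have h5 : Real.pi⁻¹ * 2⁻¹ ≤ 1 := by
        rw [← mul_inv]; exact inv_le_one_of_one_le₀ (by linarith [Real.pi_gt_three])
      exact mul_le_of_le_one_left (by positivity) h5

lemma fourierCoeff_eq_fourierCoeffOn (φ : UnitAddCircle → ℂ) (k : ℤ) :
    fourierCoeff φ k = fourierCoeffOn zero_lt_one (fun x : ℝ => φ x) k := by
  rw [fourierCoeffOn_eq_integral, fourierCoeff_eq_intervalIntegral φ k 0]
  simp only [fourier_coe_apply]
  norm_num

lemma IsTestFunction.fourierCoeff_decay {φ : UnitAddCircle → ℂ} (hφ : IsTestFunction φ) (m : ℕ) :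
    ∃ C : ℝ, 0 ≤ C ∧ ∀ k : ℤ, ‖fourierCoeff φ k‖ * bracket k ^ m ≤ C := by
  obtain ⟨C, hC⟩ := fourierCoeff_deriv_decay m (fun x : ℝ => φ x) hφ fun x => by simp
  obtain ⟨D, hD⟩ := fourierCoeff_deriv_decay 0 (fun x : ℝ => φ x) hφ fun x => by simp
  refine ⟨|C| + |D|, by positivity, fun k => ?_⟩
  rw [fourierCoeff_eq_fourierCoeffOn, mul_comm]
  rcases eq_or_ne k 0 with rfl | hk
  · have := hD 0
    simp only [bracket_zero, one_pow, one_mul, pow_zero] at this ⊢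
    linarith [abs_nonneg C, le_abs_self D]
  · rw [bracket_eq_abs hk]
    linarith [hC k, le_abs_self C, abs_nonneg D]

lemma IsTestFunction.summable_fourierCoeff {φ : UnitAddCircle → ℂ} (hφ : IsTestFunction φ)
    (m : ℕ) : Summable fun k : ℤ => bracket k ^ m * ‖fourierCoeff φ (-k)‖ := by
  obtain ⟨C, -, hC⟩ := hφ.fourierCoeff_decay (m + 2)
  refine (summable_bracket_inv_sq.mul_left C).of_nonneg_of_le
    (fun k => mul_nonneg (pow_nonneg (bracket_pos k).le _) (norm_nonneg _)) fun k => ?_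
  have h := hC (-k)
  have := bracket_pos k
  rw [bracket_neg, pow_add] at h
  rw [← div_eq_mul_inv, le_div_iff₀ (by positivity)]
  linarith

lemma PeriodicDistribution.summable_pairing (u : PeriodicDistribution) {φ : UnitAddCircle → ℂ}
    (hφ : IsTestFunction φ) : Summable fun k : ℤ => ‖u.coeff k‖ * ‖fourierCoeff φ (-k)‖ := by
  obtain ⟨C, n, hC, h⟩ := u.exists_bound
  refine ((hφ.summable_fourierCoeff n).mul_left C).of_nonneg_of_le (fun k => by positivity)
    fun k => ?_
  rw [← mul_assoc]
  gcongr
  exact h k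

/-! ### Trigonometric polynomials -/

lemma integral_fourier (n : ℤ) :
    ∫ x : UnitAddCircle, fourier n x = if n = 0 then 1 else 0 := by
  have h := congrFun (fourierCoeff_fourier (T := 1) n) 0
  rw [fourierCoeff_eq_integral] at h
  simpa [Pi.single_apply, eq_comm] using h

lemma norm_fourier_apply (n : ℤ) (x : UnitAddCircle) : ‖fourier n x‖ = 1 := by
  rw [fourier_apply, Circle.norm_coe]

lemma isTestFunction_fourier (n : ℤ) : IsTestFunction fun x => fourier n x := by
  unfold IsTestFunction
  simp only [fourier_coe_apply]
  exact ((contDiff_const.mul Complex.ofRealCLM.contDiff).div_const _).cexp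

/-- The trigonometric polynomial `∑_{k ∈ F} cₖ e^{2πikx}`. -/
def trigPoly (F : Finset ℤ) (c : ℤ → ℂ) : C(UnitAddCircle, ℂ) := ∑ k ∈ F, c k • fourier k

lemma trigPoly_apply (F : Finset ℤ) (c : ℤ → ℂ) (x : UnitAddCircle) :
    trigPoly F c x = ∑ k ∈ F, c k * fourier k x := by
  simp [trigPoly]

lemma trigPoly_mul {F G H : Finset ℤ} (hH : ∀ k ∈ F, ∀ l ∈ G, k + l ∈ H) (c d : ℤ → ℂ) :
    trigPoly F c * trigPoly G d = trigPoly H fun m =>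
      ∑ p ∈ (F ×ˢ G).filter (fun p => p.1 + p.2 = m), c p.1 * d p.2 := by
  ext x
  rw [ContinuousMap.mul_apply, trigPoly_apply, trigPoly_apply, trigPoly_apply, Finset.sum_mul_sum,
    ← Finset.sum_product', ← Finset.sum_fiberwise_of_maps_to (t := H) (g := fun p => p.1 + p.2)
      (fun p hp => hH _ (Finset.mem_product.1 hp).1 _ (Finset.mem_product.1 hp).2)]
  refine Finset.sum_congr rfl fun m _ => ?_
  rw [Finset.sum_mul]
  refine Finset.sum_congr rfl fun p hp => ?_
  rw [← (Finset.mem_filter.1 hp).2, fourier_add]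
  ring

/-- Raising to the n-th power only enlarges the degree to nM, so the passage from L² to L^∞ for
polynomials upgrades to one from L^{2n} to L^∞. -/
lemma exists_trigPoly_pow (M : ℕ) (c : ℤ → ℂ) (n : ℕ) :
    ∃ d, trigPoly (Finset.Icc (-(M : ℤ)) M) c ^ n =
      trigPoly (Finset.Icc (-((n * M : ℕ) : ℤ)) (n * M : ℕ)) d := by
  induction n with
  | zero => exact ⟨1, by ext x; simp [trigPoly_apply]⟩
  | succ n ih =>
    obtain ⟨d, hd⟩ := ih
    rw [pow_succ, hd]
    refine ⟨_, trigPoly_mul (fun k hk l hl => ?_) _ _⟩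
    rw [Finset.mem_Icc] at *
    push_cast at *
    constructor <;> linarith

lemma integral_trigPoly_mul_fourier (F : Finset ℤ) (c : ℤ → ℂ) (n : ℤ) :
    ∫ x : UnitAddCircle, trigPoly F c x * fourier (-n) x = if n ∈ F then c n else 0 := by
  simp only [trigPoly_apply, Finset.sum_mul, mul_assoc, ← fourier_add]
  rw [integral_finsetSum]
  · simp only [integral_const_mul, integral_fourier]
    simp [add_neg_eq_zero]
  · intro k _
    exact ((fourier _).continuous.integrable_of_hasCompactSupport
      (HasCompactSupport.of_compactSpace _)).const_mul _

lemma integrable_of_continuous_unitAddCircle {E : Type*} [NormedAddCommGroup E]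
    {f : UnitAddCircle → E} (hf : Continuous f) : Integrable f volume :=
  hf.integrable_of_hasCompactSupport (HasCompactSupport.of_compactSpace _)

/-- Parseval's identity for trigonometric polynomials. -/
lemma integral_norm_sq_trigPoly (F : Finset ℤ) (c : ℤ → ℂ) :
    ∫ x : UnitAddCircle, ‖trigPoly F c x‖ ^ 2 = ∑ k ∈ F, ‖c k‖ ^ 2 := by
  have h : ∀ x, ((‖trigPoly F c x‖ ^ 2 : ℝ) : ℂ) =
      ∑ k ∈ F, starRingEnd ℂ (c k) * (trigPoly F c x * fourier (-k) x) := by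
    intro x
    push_cast
    rw [← Complex.mul_conj']
    conv_lhs => rw [trigPoly_apply F c x, map_sum, Finset.mul_sum, ← trigPoly_apply]
    refine Finset.sum_congr rfl fun k _ => ?_
    rw [map_mul, fourier_neg]
    ring
  have h2 : ((∫ x : UnitAddCircle, ‖trigPoly F c x‖ ^ 2 : ℝ) : ℂ) =
      ((∑ k ∈ F, ‖c k‖ ^ 2 : ℝ) : ℂ) := by
    rw [← integral_complex_ofReal]
    simp only [h]
    rw [integral_finsetSum]
    · simp only [integral_const_mul, integral_trigPoly_mul_fourier]
      push_cast
      refine Finset.sum_congr rfl fun k hk => ?_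
      rw [if_pos hk, mul_comm, Complex.mul_conj']
    · intro k _
      exact integrable_of_continuous_unitAddCircle (by fun_prop)
  exact_mod_cast h2

/-- Cauchy-Schwarz over the frequencies, followed by Parseval's identity. -/
lemma norm_sq_trigPoly_le (F : Finset ℤ) (c : ℤ → ℂ) (x : UnitAddCircle) :
    ‖trigPoly F c x‖ ^ 2 ≤ F.card * ∫ y : UnitAddCircle, ‖trigPoly F c y‖ ^ 2 := by
  rw [integral_norm_sq_trigPoly, trigPoly_apply]
  calc ‖∑ k ∈ F, c k * fourier k x‖ ^ 2 ≤ (∑ k ∈ F, ‖c k‖) ^ 2 := by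
        gcongr
        refine (norm_sum_le _ _).trans (le_of_eq ?_)
        simp only [norm_mul, norm_fourier_apply, mul_one]
    _ ≤ F.card * ∑ k ∈ F, ‖c k‖ ^ 2 := sq_sum_le_card_mul_sum_sq

/-- Nikolskii's inequality for even exponents. -/
lemma norm_pow_trigPoly_le (M : ℕ) (c : ℤ → ℂ) (n : ℕ) (x : UnitAddCircle) :
    ‖trigPoly (Finset.Icc (-(M : ℤ)) M) c x‖ ^ (2 * n) ≤
      (2 * (n * M : ℕ) + 1) *
        ∫ y : UnitAddCircle, ‖trigPoly (Finset.Icc (-(M : ℤ)) M) c y‖ ^ (2 * n) := by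
  -- The L² case is applied to the n-th power of the polynomial; its number of frequencies 2nM + 1
  -- is the constant.
  obtain ⟨d, hd⟩ := exists_trigPoly_pow M c n
  have h := norm_sq_trigPoly_le (Finset.Icc (-((n * M : ℕ) : ℤ)) (n * M : ℕ)) d x
  rw [← hd] at h
  simp only [ContinuousMap.pow_apply, norm_pow, ← pow_mul, mul_comm n 2] at h
  refine h.trans (le_of_eq ?_)
  congr 1
  rw [Int.card_Icc]
  have : ((n * M : ℕ) : ℤ) + 1 - -((n * M : ℕ) : ℤ) = ((2 * (n * M) + 1 : ℕ) : ℤ) := by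
    push_cast; ring
  rw [this, Int.toNat_natCast]
  push_cast; ring

end TorusNoise
end

noncomputable section

namespace TorusNoise

/-! ### An `L¹` bound for convolution kernels -/

lemma trigPoly_eq_of_subset {F G : Finset ℤ} (h : F ⊆ G) {c : ℤ → ℂ}
    (hc : ∀ k ∈ G, k ∉ F → c k = 0) : trigPoly F c = trigPoly G c := by
  ext x
  rw [trigPoly_apply, trigPoly_apply]
  exact Finset.sum_subset h fun k hk hk' => by rw [hc k hk hk', zero_mul]

/-- Multiplication by e^{2πix} - 1 takes differences of the coefficients, so regularity of `c` in
frequency becomes decay of the kernel away from 0. The shift adds the single frequency M + 1. -/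
lemma fourier_one_sub_one_mul_trigPoly {M : ℕ} {c : ℤ → ℂ}
    (hsupp : ∀ k : ℤ, (M : ℤ) < |k| → c k = 0) (x : UnitAddCircle) :
    (fourier 1 x - 1) * trigPoly (Finset.Icc (-(M : ℤ)) M) c x =
      trigPoly (Finset.Icc (-(M : ℤ)) (M + 1)) (fun k => c (k - 1) - c k) x := by
  have h1 : trigPoly (Finset.Icc (-(M : ℤ)) M) c = trigPoly (Finset.Icc (-(M : ℤ)) (M + 1)) c :=
    trigPoly_eq_of_subset (Finset.Icc_subset_Icc_right (by linarith)) fun k hk hk' => by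
      rw [Finset.mem_Icc] at hk hk'
      exact hsupp k (lt_abs.2 (Or.inl (by omega)))
  have h2 : fourier 1 x * trigPoly (Finset.Icc (-(M : ℤ)) M) c x =
      trigPoly (Finset.Icc (-(M : ℤ)) (M + 1)) (fun k => c (k - 1)) x := by
    have h3 : trigPoly (Finset.Icc (-(M : ℤ) + 1) (M + 1)) (fun k => c (k - 1)) =
        trigPoly (Finset.Icc (-(M : ℤ)) (M + 1)) (fun k => c (k - 1)) :=
      trigPoly_eq_of_subset (Finset.Icc_subset_Icc_left (by linarith)) fun k hk hk' => by
        rw [Finset.mem_Icc] at hk hk'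
        exact hsupp _ (lt_abs.2 (Or.inr (by omega)))
    rw [← h3, trigPoly_apply, trigPoly_apply, Finset.mul_sum]
    refine Finset.sum_nbij' (fun k => k + 1) (fun k => k - 1) ?_ ?_ ?_ ?_ ?_
    · intro k hk; rw [Finset.mem_Icc] at *; omega
    · intro k hk; rw [Finset.mem_Icc] at *; omega
    · intro k _; ring
    · intro k _; ring
    · intro k _
      rw [add_sub_cancel_right, fourier_add]
      ring
  rw [sub_mul, h2, one_mul, h1]
  simp only [trigPoly_apply, ← Finset.sum_sub_distrib, sub_mul]

lemma four_mul_abs_le_norm_fourier_one_sub_one {x : ℝ} (hx : |x| ≤ 1 / 2) :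
    4 * |x| ≤ ‖fourier 1 (x : UnitAddCircle) - 1‖ := by
  have h1 : fourier 1 (x : UnitAddCircle) = Complex.exp (Complex.I * ((2 * Real.pi * x : ℝ) : ℂ)) := by
    rw [fourier_coe_apply]
    congr 1
    push_cast
    ring
  rw [h1, Complex.norm_exp_I_mul_ofReal_sub_one]
  have h2 := Real.mul_abs_le_abs_sin (x := Real.pi * x) (by
    rw [abs_mul, abs_of_pos Real.pi_pos]
    nlinarith [Real.pi_pos])
  rw [abs_mul, abs_of_pos Real.pi_pos] at h2
  have h3 : 2 / Real.pi * (Real.pi * |x|) = 2 * |x| := by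
    field_simp
  rw [h3] at h2
  rw [norm_mul, Real.norm_eq_abs, Real.norm_eq_abs, abs_two,
    show 2 * Real.pi * x / 2 = Real.pi * x by ring]
  linarith

lemma integral_one_div_one_add_sq_le {M : ℝ} (hM : 0 < M) (a b : ℝ) :
    ∫ x in a..b, 1 / (1 + (M * x) ^ 2) ≤ Real.pi / M := by
  have h := intervalIntegral.integral_comp_mul_left (a := a) (b := b)
    (fun y : ℝ => 1 / (1 + y ^ 2)) hM.ne'
  rw [h, integral_one_div_one_add_sq, smul_eq_mul, div_eq_inv_mul]
  gcongr
  linarith [Real.arctan_lt_pi_div_two (M * b), Real.neg_pi_div_two_lt_arctan (M * a)]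

/-- Such a kernel is concentrated at scale 1/M. Its L² norm and that of its product with x are
controlled by Parseval, and Cauchy-Schwarz against the weight 1 + (Mx)² turns them into an L¹ bound
that does not depend on M. -/
lemma integral_norm_trigPoly_le {M : ℕ} (hM : 1 ≤ M) {c : ℤ → ℂ} {B : ℝ} (hB : 0 < B)
    (hc : ∀ k, ‖c k‖ ≤ B) (hsupp : ∀ k : ℤ, (M : ℤ) < |k| → c k = 0)
    (hd : ∀ k, ‖c (k + 1) - c k‖ ≤ B / M) :
    ∫ x : UnitAddCircle, ‖trigPoly (Finset.Icc (-(M : ℤ)) M) c x‖ ≤ 4 * B := by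
  have hM' : (1 : ℝ) ≤ M := by exact_mod_cast hM
  have hM0 : (0 : ℝ) < M := by linarith
  set K := trigPoly (Finset.Icc (-(M : ℤ)) M) c with hK
  set K' := trigPoly (Finset.Icc (-(M : ℤ)) (M + 1)) (fun k => c (k - 1) - c k) with hK'
  have hI1 : ∫ x : UnitAddCircle, ‖K x‖ ^ 2 ≤ 3 * M * B ^ 2 := by
    rw [hK, integral_norm_sq_trigPoly]
    calc ∑ k ∈ Finset.Icc (-(M : ℤ)) M, ‖c k‖ ^ 2 ≤ ∑ k ∈ Finset.Icc (-(M : ℤ)) M, B ^ 2 :=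
          Finset.sum_le_sum fun k _ => by gcongr; exact hc k
      _ = (2 * M + 1) * B ^ 2 := by
          rw [Finset.sum_const, Int.card_Icc, nsmul_eq_mul]
          rw [show (M : ℤ) + 1 - -(M : ℤ) = ((2 * M + 1 : ℕ) : ℤ) by push_cast; ring,
            Int.toNat_natCast]
          push_cast; ring
      _ ≤ 3 * M * B ^ 2 := by gcongr; linarith
  have hI2 : ∫ x : UnitAddCircle, ‖K' x‖ ^ 2 ≤ 4 * B ^ 2 / M := by
    rw [hK', integral_norm_sq_trigPoly]
    calc ∑ k ∈ Finset.Icc (-(M : ℤ)) (M + 1), ‖c (k - 1) - c k‖ ^ 2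
        ≤ ∑ k ∈ Finset.Icc (-(M : ℤ)) (M + 1), (B / M) ^ 2 :=
          Finset.sum_le_sum fun k _ => by
            gcongr
            have := hd (k - 1)
            rwa [sub_add_cancel, norm_sub_rev] at this
      _ = (2 * M + 2) * (B / M) ^ 2 := by
          rw [Finset.sum_const, Int.card_Icc, nsmul_eq_mul]
          rw [show (M : ℤ) + 1 + 1 - -(M : ℤ) = ((2 * M + 2 : ℕ) : ℤ) by push_cast; ring,
            Int.toNat_natCast]
          push_cast; ring
      _ ≤ (4 * M) * (B / M) ^ 2 := by gcongr; linarith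
      _ = 4 * B ^ 2 / M := by field_simp
  -- Cauchy-Schwarz in pointwise form: 2|K| ≤ |K|² q/(BM) + BM/q with q = 1 + (Mx)². The factor BM
  -- balances the three resulting integrals. On this fundamental domain |x| is dominated by
  -- |e^{2πix} - 1|.
  have hle : ∀ x ∈ Set.Icc (-(1 / 2) : ℝ) (-(1 / 2) + 1), ‖K x‖ ≤
      1 / 2 * (‖K x‖ ^ 2 / (B * M) + M / (16 * B) * ‖K' x‖ ^ 2 +
        B * M * (1 / (1 + (M * x) ^ 2))) := by
    intro x hx
    have hx' : |x| ≤ 1 / 2 := abs_le.2 ⟨by linarith [hx.1], by linarith [hx.2]⟩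
    have h1 : (4 * |x|) * ‖K x‖ ≤ ‖K' x‖ := by
      rw [hK', ← fourier_one_sub_one_mul_trigPoly hsupp, norm_mul]
      gcongr
      exact four_mul_abs_le_norm_fourier_one_sub_one hx'
    have h2 : 16 * x ^ 2 * ‖K x‖ ^ 2 ≤ ‖K' x‖ ^ 2 := by
      have := pow_le_pow_left₀ (by positivity) h1 2
      rw [mul_pow, mul_pow, sq_abs] at this
      linarith
    set q : ℝ := 1 + (M * x) ^ 2 with hq
    have hq0 : 0 < q := by positivity
    have h3 : 2 * ‖K x‖ ≤ ‖K x‖ ^ 2 * q / (B * M) + B * M / q := by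
      have := two_mul_le_add_sq (‖K x‖ * q) (B * M)
      rw [div_add_div _ _ (by positivity) (by positivity), le_div_iff₀ (by positivity)]
      nlinarith
    have h4 : ‖K x‖ ^ 2 * q / (B * M) ≤ ‖K x‖ ^ 2 / (B * M) + M / (16 * B) * ‖K' x‖ ^ 2 := by
      have h5 : ‖K x‖ ^ 2 * q / (B * M) =
          ‖K x‖ ^ 2 / (B * M) + M / (16 * B) * (16 * x ^ 2 * ‖K x‖ ^ 2) := by
        rw [hq]; field_simp
      rw [h5]
      gcongr
    rw [mul_one_div]
    linarith
  have hc1 : Continuous fun x : ℝ => ‖K (x : UnitAddCircle)‖ := by fun_prop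
  have hc2 : Continuous fun x : ℝ => ‖K' (x : UnitAddCircle)‖ := by fun_prop
  have hc3 : Continuous fun x : ℝ => B * M * (1 / (1 + (M * x) ^ 2)) := by
    refine continuous_const.mul (continuous_const.div (by fun_prop) fun x => ?_)
    positivity
  rw [← UnitAddCircle.intervalIntegral_preimage (-(1 / 2))]
  refine (intervalIntegral.integral_mono_on (by norm_num) (hc1.intervalIntegrable _ _)
    (Continuous.intervalIntegrable (by fun_prop) _ _) hle).trans ?_
  rw [intervalIntegral.integral_const_mul, intervalIntegral.integral_add
    (Continuous.intervalIntegrable (by fun_prop) _ _) (hc3.intervalIntegrable _ _),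
    intervalIntegral.integral_add (Continuous.intervalIntegrable (by fun_prop) _ _)
    (Continuous.intervalIntegrable (by fun_prop) _ _), intervalIntegral.integral_div,
    intervalIntegral.integral_const_mul, intervalIntegral.integral_const_mul,
    UnitAddCircle.intervalIntegral_preimage (-(1 / 2)) (fun x => ‖K x‖ ^ 2),
    UnitAddCircle.intervalIntegral_preimage (-(1 / 2)) (fun x => ‖K' x‖ ^ 2)]
  -- The three contributions 3B, B/4 and 4B are halved in the end, which stays below 4B.
  have h1 : (∫ x : UnitAddCircle, ‖K x‖ ^ 2) / (B * M) ≤ 3 * B := by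
    rw [div_le_iff₀ (by positivity)]
    linarith
  have h2 : M / (16 * B) * (∫ x : UnitAddCircle, ‖K' x‖ ^ 2) ≤ B / 4 := by
    calc M / (16 * B) * (∫ x : UnitAddCircle, ‖K' x‖ ^ 2) ≤ M / (16 * B) * (4 * B ^ 2 / M) := by
          gcongr
      _ = B / 4 := by field_simp; norm_num
  have h3 : B * M * ∫ x in (-(1 / 2) : ℝ)..(-(1 / 2) + 1), 1 / (1 + (M * x) ^ 2) ≤ 4 * B := by
    calc _ ≤ B * M * (Real.pi / M) := by
          gcongr
          exact integral_one_div_one_add_sq_le hM0 _ _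
      _ = B * Real.pi := by field_simp
      _ ≤ 4 * B := by nlinarith [Real.pi_le_four]
  linarith

end TorusNoise
end

noncomputable section

namespace TorusNoise

namespace DyadicPartition

variable (P : DyadicPartition)

/-! ### The windows of a dyadic partition of unity -/

lemma window_nonneg (j : ℕ) (x : ℝ) : 0 ≤ P.window j x := by
  cases j
  · exact P.χ_nonneg x
  · exact P.ρ_nonneg _

lemma window_neg (j : ℕ) (x : ℝ) : P.window j (-x) = P.window j x := by
  cases j
  · exact P.χ_radial x
  · simp only [window, neg_div, P.ρ_radial]

lemma hasSum_window (x : ℝ) : HasSum (fun j => P.window j x) 1 := by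
  rw [← hasSum_nat_add_iff' 1]
  simpa [window] using P.sum_eq_one x

lemma sum_window_le_one (s : Finset ℕ) (x : ℝ) : ∑ j ∈ s, P.window j x ≤ 1 :=
  sum_le_hasSum s (fun j _ => P.window_nonneg j x) (P.hasSum_window x)

lemma window_le_one (j : ℕ) (x : ℝ) : P.window j x ≤ 1 := by
  simpa using P.sum_window_le_one {j} x

/-- The support of the `j`-th window is of size `2^j`. -/
lemma exists_window_support : ∃ R : ℕ, 1 ≤ R ∧ ∀ (j : ℕ) (k : ℤ), P.window j k ≠ 0 →
    bracket k ≤ R * 2 ^ j ∧ 2 ^ j ≤ R * bracket k := by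
  obtain ⟨a, ha⟩ := P.χ_support.isCompact.isBounded.exists_norm_le
  obtain ⟨b, hb⟩ := P.ρ_support.1.isCompact.isBounded.exists_norm_le
  obtain ⟨r, hr, hr'⟩ := Metric.isOpen_iff.1 (isClosed_tsupport P.ρ).isOpen_compl 0 P.ρ_support.2
  obtain ⟨R, hR⟩ := exists_nat_ge (max 1 (max |a| (max |b| (2 / r))))
  simp only [max_le_iff] at hR
  obtain ⟨h1, hRa, hRb, hRr⟩ := hR
  refine ⟨R, by exact_mod_cast h1, fun j k hk => ?_⟩
  rcases j with _ | j
  · have h := ha _ (subset_tsupport _ hk)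
    rw [pow_zero, mul_one]
    refine ⟨max_le h1 (h.trans ((le_abs_self a).trans hRa)), ?_⟩
    nlinarith [one_le_bracket k]
  · have h := subset_tsupport _ (Function.mem_support.2 (show P.ρ (k / 2 ^ j) ≠ 0 from hk))
    have h2 := hb _ h
    have h3 : r ≤ |(k : ℝ)| / 2 ^ j := by
      by_contra hlt
      refine hr' ?_ h
      rw [mem_ball_zero_iff, Real.norm_eq_abs, abs_div, abs_of_pos (by positivity : (0 : ℝ) < 2 ^ j)]
      exact not_le.1 hlt
    rw [Real.norm_eq_abs, abs_div, abs_of_pos (by positivity : (0 : ℝ) < 2 ^ j),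
      div_le_iff₀ (by positivity)] at h2
    rw [le_div_iff₀ (by positivity)] at h3
    have h4 : (1 : ℝ) ≤ 2 ^ j := one_le_pow₀ (by norm_num)
    constructor
    · refine max_le ?_ ?_
      · rw [pow_succ]; nlinarith
      · refine h2.trans ?_
        have : b ≤ R := (le_abs_self b).trans hRb
        rw [pow_succ]
        nlinarith
    · rw [div_le_iff₀ hr] at hRr
      rw [pow_succ]
      have h5 := abs_le_bracket k
      have hR0 : (0 : ℝ) ≤ R := by linarith
      calc (2 : ℝ) ^ j * 2 ≤ 2 ^ j * (R * r) := by gcongr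
        _ = R * (r * 2 ^ j) := by ring
        _ ≤ R * bracket k := by gcongr; linarith

/-- A constant comparing the support of the `j`-th window with `2^j`. -/
def radius : ℕ := P.exists_window_support.choose

lemma one_le_radius : 1 ≤ P.radius := P.exists_window_support.choose_spec.1

lemma one_le_radius' : (1 : ℝ) ≤ P.radius := by exact_mod_cast P.one_le_radius

lemma bracket_le_of_window_ne_zero {j : ℕ} {k : ℤ} (h : P.window j k ≠ 0) :
    bracket k ≤ P.radius * 2 ^ j :=
  (P.exists_window_support.choose_spec.2 j k h).1

lemma two_pow_le_of_window_ne_zero {j : ℕ} {k : ℤ} (h : P.window j k ≠ 0) :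
    2 ^ j ≤ P.radius * bracket k :=
  (P.exists_window_support.choose_spec.2 j k h).2

/-- The windows are dilations of two compactly supported smooth functions. The constant carries a
factor 2 for `ρ` because the window with index j + 1 lives at scale 2^j. -/
lemma exists_window_lipschitz : ∃ L : ℝ, 0 ≤ L ∧ ∀ (j : ℕ) (x y : ℝ),
    |P.window j x - P.window j y| ≤ L / 2 ^ j * |x - y| := by
  obtain ⟨a, ha⟩ := ContDiff.lipschitzWith_of_hasCompactSupport P.χ_support P.χ_smooth (by simp)
  obtain ⟨b, hb⟩ := ContDiff.lipschitzWith_of_hasCompactSupport P.ρ_support.1 P.ρ_smooth (by simp)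
  refine ⟨a + 2 * b, by positivity, fun j x y => ?_⟩
  rcases j with _ | j
  · have h := ha.dist_le_mul x y
    rw [Real.dist_eq, Real.dist_eq] at h
    refine h.trans ?_
    gcongr
    rw [pow_zero, div_one]
    linarith [b.coe_nonneg]
  · have h := hb.dist_le_mul (x / 2 ^ j) (y / 2 ^ j)
    rw [Real.dist_eq, Real.dist_eq, ← sub_div, abs_div,
      abs_of_pos (by positivity : (0 : ℝ) < 2 ^ j)] at h
    refine h.trans ?_
    rw [mul_div_assoc', div_mul_eq_mul_div, pow_succ]
    rw [div_le_div_iff₀ (by positivity) (by positivity)]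
    have : (0 : ℝ) ≤ a * |x - y| * 2 ^ j := by positivity
    nlinarith

/-- A Lipschitz constant for the rescaled windows. -/
def lipConst : ℝ := P.exists_window_lipschitz.choose

lemma lipConst_nonneg : 0 ≤ P.lipConst := P.exists_window_lipschitz.choose_spec.1

lemma abs_window_sub_le (j : ℕ) (x y : ℝ) :
    |P.window j x - P.window j y| ≤ P.lipConst / 2 ^ j * |x - y| :=
  P.exists_window_lipschitz.choose_spec.2 j x y

/-- Since the windows are even, two frequencies with small sum see almost the same window. This is
the source of the factor |k + l|. -/
lemma abs_window_sub_le_add (j : ℕ) (x y : ℝ) :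
    |P.window j x - P.window j y| ≤ P.lipConst / 2 ^ j * |x + y| := by
  simpa [P.window_neg] using P.abs_window_sub_le j x (-y)

/-! ### The weights of the resonant product -/

/-- The weight `∑_{|i - j| ≤ 1} w_i(k) w_j(l)` of `û(k) v̂(l)` in the `i`-th resonant term. -/
def resWeight (i : ℕ) (k l : ℤ) : ℝ :=
  P.window i k * ∑ j ∈ Finset.Icc (i - 1) (i + 1), P.window j l

/-- The weight of `û(k) v̂(l)` in the `N`-th partial sum of the resonant product. -/
def partialWeight (N : ℕ) (k l : ℤ) : ℝ := ∑ i ∈ Finset.range N, P.resWeight i k l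

/-- The weight of `û(k) v̂(l)` in the resonant product. -/
def weight (k l : ℤ) : ℝ := ∑' i, P.resWeight i k l

lemma resWeight_nonneg (i : ℕ) (k l : ℤ) : 0 ≤ P.resWeight i k l :=
  mul_nonneg (P.window_nonneg _ _) (Finset.sum_nonneg fun _ _ => P.window_nonneg _ _)

lemma resWeight_le (i : ℕ) (k l : ℤ) : P.resWeight i k l ≤ P.window i k :=
  mul_le_of_le_one_right (P.window_nonneg _ _) (P.sum_window_le_one _ _)

lemma hasSum_resWeight (k l : ℤ) : HasSum (fun i => P.resWeight i k l) (P.weight k l) :=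
  ((P.hasSum_window k).summable.of_nonneg_of_le (fun i => P.resWeight_nonneg i k l)
    fun i => P.resWeight_le i k l).hasSum

lemma tendsto_partialWeight (k l : ℤ) :
    Tendsto (fun N => P.partialWeight N k l) atTop (𝓝 (P.weight k l)) :=
  (P.hasSum_resWeight k l).tendsto_sum_nat

lemma partialWeight_nonneg (N : ℕ) (k l : ℤ) : 0 ≤ P.partialWeight N k l :=
  Finset.sum_nonneg fun i _ => P.resWeight_nonneg i k l

lemma partialWeight_le_one (N : ℕ) (k l : ℤ) : P.partialWeight N k l ≤ 1 :=
  (Finset.sum_le_sum fun i _ => P.resWeight_le i k l).trans (P.sum_window_le_one _ _)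

lemma weight_nonneg (k l : ℤ) : 0 ≤ P.weight k l := tsum_nonneg fun i => P.resWeight_nonneg i k l

lemma weight_le_one (k l : ℤ) : P.weight k l ≤ 1 :=
  le_of_tendsto' (P.tendsto_partialWeight k l) fun N => P.partialWeight_le_one N k l

lemma resWeight_ne_zero {i : ℕ} {k l : ℤ} (h : P.resWeight i k l ≠ 0) :
    P.window i k ≠ 0 ∧ bracket l ≤ 2 * P.radius * 2 ^ i ∧ 2 ^ i ≤ 2 * P.radius * bracket l := by
  obtain ⟨h1, h2⟩ := mul_ne_zero_iff.1 h
  obtain ⟨j, hj, h3⟩ := Finset.exists_ne_zero_of_sum_ne_zero h2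
  rw [Finset.mem_Icc] at hj
  have hR := P.one_le_radius'
  refine ⟨h1, (P.bracket_le_of_window_ne_zero h3).trans ?_, ?_⟩
  · have : (2 : ℝ) ^ j ≤ 2 ^ (i + 1) := pow_le_pow_right₀ (by norm_num) hj.2
    rw [pow_succ] at this
    nlinarith
  · have h4 := P.two_pow_le_of_window_ne_zero h3
    have : (2 : ℝ) ^ i ≤ 2 ^ (j + 1) := pow_le_pow_right₀ (by norm_num) (by omega)
    rw [pow_succ] at this
    linarith

lemma bracket_le_of_weight_ne_zero {k l : ℤ} (h : P.weight k l ≠ 0) :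
    bracket l ≤ 2 * P.radius ^ 2 * bracket k ∧ bracket k ≤ 2 * P.radius ^ 2 * bracket l := by
  obtain ⟨i, hi⟩ : ∃ i, P.resWeight i k l ≠ 0 := by
    by_contra! hn
    simp [weight, hn] at h
  obtain ⟨h1, h2, h3⟩ := P.resWeight_ne_zero hi
  have h4 := P.bracket_le_of_window_ne_zero h1
  have h5 := P.two_pow_le_of_window_ne_zero h1
  have hR := P.one_le_radius'
  constructor
  · calc bracket l ≤ 2 * P.radius * 2 ^ i := h2
      _ ≤ 2 * P.radius * (P.radius * bracket k) := by gcongr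
      _ = _ := by ring
  · calc bracket k ≤ P.radius * 2 ^ i := h4
      _ ≤ P.radius * (2 * P.radius * bracket l) := by gcongr
      _ = _ := by ring

/-- The pairs (i, j) with |i - j| ≤ 1 and i ≤ N form a symmetric set except for (N, N+1), so only
this boundary pair survives the antisymmetrization. -/
lemma partialWeight_succ_sub_swap (N : ℕ) (k l : ℤ) :
    P.partialWeight (N + 1) k l - P.partialWeight (N + 1) l k =
      P.window N k * P.window (N + 1) l - P.window N l * P.window (N + 1) k := by
  induction N with
  | zero =>
    simp [partialWeight, resWeight, show Finset.Icc 0 1 = ({0, 1} : Finset ℕ) by rfl]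
    ring
  | succ N ih =>
    have h : ∀ a b : ℤ, P.partialWeight (N + 2) a b = P.partialWeight (N + 1) a b +
        P.window (N + 1) a * (P.window N b + P.window (N + 1) b + P.window (N + 2) b) := by
      intro a b
      rw [partialWeight, Finset.sum_range_succ, ← partialWeight, resWeight, Nat.add_sub_cancel,
        show Finset.Icc N (N + 1 + 1) = ({N, N + 1, N + 2} : Finset ℕ) by
          ext; simp only [Finset.mem_Icc, Finset.mem_insert, Finset.mem_singleton]; omega]
      rw [Finset.sum_insert (by simp), Finset.sum_insert (by simp), Finset.sum_singleton]
      ring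
    rw [h, h]
    linear_combination ih

lemma tendsto_window (x : ℝ) : Tendsto (fun j => P.window j x) atTop (𝓝 0) :=
  (P.hasSum_window x).summable.tendsto_atTop_zero

/-- The boundary term of the truncated weights vanishes in the limit, since a fixed frequency leaves
the support of the windows. -/
lemma weight_comm (k l : ℤ) : P.weight k l = P.weight l k := by
  have h1 := ((P.tendsto_partialWeight k l).comp (tendsto_add_atTop_nat 1)).sub
    ((P.tendsto_partialWeight l k).comp (tendsto_add_atTop_nat 1))
  have h2 : Tendsto (fun N => P.window N k * P.window (N + 1) l - P.window N l * P.window (N + 1) k)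
      atTop (𝓝 (0 * 0 - 0 * 0)) :=
    ((P.tendsto_window k).mul ((P.tendsto_window l).comp (tendsto_add_atTop_nat 1))).sub
      ((P.tendsto_window l).mul ((P.tendsto_window k).comp (tendsto_add_atTop_nat 1)))
  have h3 := tendsto_nhds_unique (h1.congr fun N => P.partialWeight_succ_sub_swap N k l) h2
  linarith

lemma abs_mul_window_le (j : ℕ) (k : ℤ) : |(k : ℝ)| * P.window j k ≤ P.radius * 2 ^ j := by
  have hR := P.one_le_radius'
  by_cases h : P.window j k = 0
  · rw [h, mul_zero]; positivity
  · exact (mul_le_of_le_one_right (abs_nonneg _) (P.window_le_one _ _)).trans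
      ((abs_le_bracket k).trans (P.bracket_le_of_window_ne_zero h))

/-- The asymmetry of the truncated weights is a difference of windows at k and l, of size 2^{-N}|k +
l|. It lives only where |k| is at most of order 2^N, so the factor |k| is compensated. -/
lemma abs_mul_partialWeight_sub_swap_le (N : ℕ) (k l : ℤ) :
    |(k : ℝ)| * |P.partialWeight N k l - P.partialWeight N l k| ≤
      3 * P.lipConst * P.radius * |(k : ℝ) + l| := by
  have hL := P.lipConst_nonneg
  have hR := P.one_le_radius'
  rcases N with _ | N
  · simp [partialWeight]
    positivity
  rw [partialWeight_succ_sub_swap]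
  set y := |(k : ℝ) + l|
  have hy : 0 ≤ y := abs_nonneg _
  have h1 : |P.window (N + 1) l - P.window (N + 1) k| ≤ P.lipConst / 2 ^ (N + 1) * y := by
    simpa [y, add_comm] using P.abs_window_sub_le_add (N + 1) l k
  have h2 : |P.window N k - P.window N l| ≤ P.lipConst / 2 ^ N * y :=
    P.abs_window_sub_le_add N k l
  have h3 : |P.window N k * P.window (N + 1) l - P.window N l * P.window (N + 1) k| ≤
      P.window N k * (P.lipConst / 2 ^ (N + 1) * y) +
        P.window (N + 1) k * (P.lipConst / 2 ^ N * y) := by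
    rw [show P.window N k * P.window (N + 1) l - P.window N l * P.window (N + 1) k =
      P.window N k * (P.window (N + 1) l - P.window (N + 1) k) +
        P.window (N + 1) k * (P.window N k - P.window N l) by ring]
    refine (abs_add_le _ _).trans (add_le_add ?_ ?_)
    · rw [abs_mul, abs_of_nonneg (P.window_nonneg _ _)]
      exact mul_le_mul_of_nonneg_left h1 (P.window_nonneg _ _)
    · rw [abs_mul, abs_of_nonneg (P.window_nonneg _ _)]
      exact mul_le_mul_of_nonneg_left h2 (P.window_nonneg _ _)
  calc _ ≤ |(k : ℝ)| * (P.window N k * (P.lipConst / 2 ^ (N + 1) * y) +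
        P.window (N + 1) k * (P.lipConst / 2 ^ N * y)) := by gcongr
    _ = (|(k : ℝ)| * P.window N k) * (P.lipConst / 2 ^ (N + 1) * y) +
        (|(k : ℝ)| * P.window (N + 1) k) * (P.lipConst / 2 ^ N * y) := by ring
    _ ≤ (P.radius * 2 ^ N) * (P.lipConst / 2 ^ (N + 1) * y) +
        (P.radius * 2 ^ (N + 1)) * (P.lipConst / 2 ^ N * y) := by
        exact add_le_add
          (mul_le_mul_of_nonneg_right (P.abs_mul_window_le _ _) (by positivity))
          (mul_le_mul_of_nonneg_right (P.abs_mul_window_le _ _) (by positivity))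
    -- The two products of powers of two are 1/2 and 2.
    _ = 5 / 2 * (P.lipConst * P.radius * y) := by
        rw [pow_succ]; field_simp; norm_num
    _ ≤ 3 * P.lipConst * P.radius * y := by
        have : 0 ≤ P.lipConst * P.radius * y := by positivity
        linarith

/-- The constant in the bound for the symmetrized weights. -/
def symConst : ℝ := 1 + 3 * P.lipConst * P.radius

lemma symConst_nonneg : 0 ≤ P.symConst := by
  have hL := P.lipConst_nonneg
  have hR := P.one_le_radius'
  unfold symConst
  positivity

/-- For nonzero frequencies this is the identity 1/k + 1/l = (k + l)/(kl). The convention 0⁻¹ = 0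
encodes the projection `Q`, and the bound persists when a frequency vanishes. -/
lemma abs_inv_add_inv_le (k l : ℤ) :
    |((k : ℝ))⁻¹ + ((l : ℝ))⁻¹| ≤ |(k : ℝ) + l| / (bracket k * bracket l) := by
  have aux : ∀ k : ℤ, |((k : ℝ))⁻¹| ≤ |(k : ℝ)| / bracket k := by
    intro k
    rcases eq_or_ne k 0 with rfl | hk
    · simp
    · have : (1 : ℝ) ≤ |(k : ℝ)| := by exact_mod_cast Int.one_le_abs hk
      rw [bracket_eq_abs hk, div_self (by positivity), abs_inv]
      exact inv_le_one_of_one_le₀ this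
  rcases eq_or_ne k 0 with rfl | hk
  · simpa using aux l
  rcases eq_or_ne l 0 with rfl | hl
  · simpa using aux k
  have hk' : (k : ℝ) ≠ 0 := by exact_mod_cast hk
  have hl' : (l : ℝ) ≠ 0 := by exact_mod_cast hl
  rw [bracket_eq_abs hk, bracket_eq_abs hl, inv_add_inv hk' hl', abs_div, abs_mul]

/-- The symmetrized weights of `∇X ξ` decay like `|k + l| / (⟨k⟩ ⟨l⟩)`, uniformly in the
truncation. -/
lemma abs_partialWeight_symm_le (N : ℕ) (k l : ℤ) :
    |P.partialWeight N k l * ((k : ℝ))⁻¹ + P.partialWeight N l k * ((l : ℝ))⁻¹| ≤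
      P.symConst * (|(k : ℝ) + l| / (bracket k * bracket l)) := by
  have h1 := P.abs_mul_partialWeight_sub_swap_le N k l
  have hb := mul_pos (bracket_pos k) (bracket_pos l)
  have h2 : |((l : ℝ))⁻¹| * |P.partialWeight N k l - P.partialWeight N l k| ≤
      3 * P.lipConst * P.radius * (|(k : ℝ) + l| / (bracket k * bracket l)) := by
    -- For k = 0 the bound `h1` is void, and the same estimate with the roles of the frequencies
    -- exchanged is used.
    rcases eq_or_ne k 0 with rfl | hk
    · rcases eq_or_ne l 0 with rfl | hl
      · simp
      · have h3 := P.abs_mul_partialWeight_sub_swap_le N l 0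
        have hl1 : (1 : ℝ) ≤ |(l : ℝ)| := by exact_mod_cast Int.one_le_abs hl
        rw [abs_sub_comm] at h3
        simp only [Int.cast_zero, add_zero, zero_add, bracket_zero, one_mul] at h3 ⊢
        rw [abs_inv, bracket_eq_abs hl, div_self (by positivity), mul_one]
        have h4 : |P.partialWeight N 0 l - P.partialWeight N l 0| ≤
            3 * P.lipConst * P.radius := by
          by_contra! hlt
          nlinarith
        refine le_trans (mul_le_of_le_one_left (abs_nonneg _) (inv_le_one_of_one_le₀ hl1)) h4
    · calc |((l : ℝ))⁻¹| * |P.partialWeight N k l - P.partialWeight N l k|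
          = |((l : ℝ))⁻¹| * |(k : ℝ)|⁻¹ *
            (|(k : ℝ)| * |P.partialWeight N k l - P.partialWeight N l k|) := by
            have : (k : ℝ) ≠ 0 := by exact_mod_cast hk
            have : |(k : ℝ)| ≠ 0 := by positivity
            field_simp
        _ ≤ (bracket l)⁻¹ * (bracket k)⁻¹ * (3 * P.lipConst * P.radius * |(k : ℝ) + l|) := by
            rw [← bracket_eq_abs hk]
            have h3 := inv_abs_le_bracket_inv (k := l)
            have h4 := bracket_pos k
            have h5 := bracket_pos l
            rw [← bracket_eq_abs hk] at h1
            gcongr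
        _ = _ := by field_simp
  -- A symmetric weight would produce only the factor 1/k + 1/l; the remainder is the asymmetry
  -- estimated in `h2`.
  have h3 : P.partialWeight N k l * ((k : ℝ))⁻¹ + P.partialWeight N l k * ((l : ℝ))⁻¹ =
      P.partialWeight N k l * (((k : ℝ))⁻¹ + ((l : ℝ))⁻¹) -
        ((l : ℝ))⁻¹ * (P.partialWeight N k l - P.partialWeight N l k) := by ring
  rw [h3]
  refine (abs_sub _ _).trans ?_
  rw [abs_mul, abs_mul, abs_of_nonneg (P.partialWeight_nonneg _ _ _), symConst, add_mul, one_mul]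
  exact add_le_add ((mul_le_of_le_one_left (abs_nonneg _) (P.partialWeight_le_one _ _ _)).trans
    (abs_inv_add_inv_le k l)) h2

end DyadicPartition
end TorusNoise
end

noncomputable section

namespace TorusNoise

/-! ### Uniqueness of distributions -/

lemma fourierCoeff_fourier_apply (n m : ℤ) :
    fourierCoeff (fun x : UnitAddCircle => fourier n x) m = if m = n then 1 else 0 := by
  have h := congrFun (fourierCoeff_fourier (T := 1) n) m
  rwa [Pi.single_apply] at h

lemma PeriodicDistribution.pairing_fourier (u : PeriodicDistribution) (n : ℤ) :
    u.pairing (fun x => fourier n x) = u.coeff (-n) := by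
  unfold pairing
  rw [tsum_eq_single (-n)]
  · rw [fourierCoeff_fourier_apply, if_pos (neg_neg n), mul_one]
  · intro k hk
    rw [fourierCoeff_fourier_apply, if_neg (by omega), mul_zero]

lemma PeriodicDistribution.ext_of_pairing {u v : PeriodicDistribution}
    (h : ∀ φ, IsTestFunction φ → u.pairing φ = v.pairing φ) : u = v := by
  ext k
  have := h _ (isTestFunction_fourier (-k))
  rwa [pairing_fourier, pairing_fourier, neg_neg] at this

/-- Distributional limits are unique, so the choice made by `Classical.epsilon` is determined as
soon as one limit exists. -/
lemma DyadicPartition.IsResonantProduct.resonant_eq {P : DyadicPartition}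
    {f g w : PeriodicDistribution} (h : P.IsResonantProduct f g w) : P.resonant f g = w :=
  ext_of_pairing fun φ hφ => tendsto_nhds_unique
    (Classical.epsilon_spec (p := P.IsResonantProduct f g) ⟨w, h⟩ φ hφ) (h φ hφ)

lemma DyadicPartition.diamond_eq {P : DyadicPartition} {u w : PeriodicDistribution}
    (h : IsWeakIntegral (P.resonantFlow u) w) : P.diamond u = w :=
  ext_of_pairing fun φ hφ => ((Classical.epsilon_spec
    (p := IsWeakIntegral (P.resonantFlow u)) ⟨w, h⟩ φ hφ).2.symm).trans (h φ hφ).2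

/-! ### Distributions given by bilinear kernels -/

/-- The sums of `κ` over the antidiagonals `k + l = m` are of at most polynomial growth. -/
def DiagBounded (κ : ℤ → ℤ → ℂ) : Prop :=
  ∃ (C : ℝ) (n : ℕ), ∀ m, Summable (fun k => ‖κ k (m - k)‖) ∧
    ∑' k, ‖κ k (m - k)‖ ≤ C * bracket m ^ n

lemma DiagBounded.mono {κ κ' : ℤ → ℤ → ℂ} (h : DiagBounded κ') {C : ℝ}
    (hle : ∀ k l, ‖κ k l‖ ≤ C * ‖κ' k l‖) : DiagBounded κ := by
  obtain ⟨D, n, hD⟩ := h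
  refine ⟨|C| * D, n, fun m => ?_⟩
  have hs : Summable (fun k => ‖κ k (m - k)‖) :=
    ((hD m).1.mul_left C).of_nonneg_of_le (fun k => norm_nonneg _) fun k => hle _ _
  refine ⟨hs, ?_⟩
  calc ∑' k, ‖κ k (m - k)‖ ≤ ∑' k, |C| * ‖κ' k (m - k)‖ :=
        hs.tsum_le_tsum (fun k => (hle _ _).trans (by gcongr; exact le_abs_self C))
          ((hD m).1.mul_left _)
    _ = |C| * ∑' k, ‖κ' k (m - k)‖ := tsum_mul_left
    _ ≤ |C| * (D * bracket m ^ n) := by gcongr; exact (hD m).2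
    _ = _ := by ring

/-- The distribution with coefficients `∑_{k + l = m} κ(k, l)`. -/
def ofKernel (κ : ℤ → ℤ → ℂ) (h : DiagBounded κ) : PeriodicDistribution where
  coeff m := ∑' k, κ k (m - k)
  tempered := by
    obtain ⟨C, n, h⟩ := h
    refine ⟨|C|, n, fun m => ?_⟩
    refine (norm_tsum_le_tsum_norm (h m).1).trans ((h m).2.trans ?_)
    have := bracket_pos m
    gcongr
    · exact le_abs_self C
    · exact bracket_le_one_add_abs m

/-- The bijection `(m, k) ↦ (k, m - k)` of `ℤ × ℤ`. -/
def antidiagonalEquiv : ℤ × ℤ ≃ ℤ × ℤ where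
  toFun p := (p.2, p.1 - p.2)
  invFun p := (p.1 + p.2, p.1)
  left_inv p := by simp
  right_inv p := by simp

/-- Summation along the antidiagonals first leaves polynomial growth in m = k + l, which the decay
of `G` absorbs. -/
lemma DiagBounded.summable_mul {κ : ℤ → ℤ → ℂ} (h : DiagBounded κ) {G : ℤ → ℝ}
    (hG : ∀ m, 0 ≤ G m) (hs : ∀ n : ℕ, Summable fun m => bracket m ^ n * G m) :
    Summable fun p : ℤ × ℤ => ‖κ p.1 p.2‖ * G (p.1 + p.2) := by
  obtain ⟨C, n, h⟩ := h
  have key : Summable fun p : ℤ × ℤ => ‖κ p.2 (p.1 - p.2)‖ * G p.1 := by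
    refine (summable_prod_of_nonneg
      fun p => mul_nonneg (norm_nonneg _) (hG _)).2 ⟨fun m => ?_, ?_⟩
    · exact (h m).1.mul_right (G m)
    · refine ((hs n).mul_left C).of_nonneg_of_le
        (fun m => tsum_nonneg fun _ => mul_nonneg (norm_nonneg _) (hG _)) fun m => ?_
      show ∑' k, ‖κ k (m - k)‖ * G m ≤ _
      rw [tsum_mul_right, ← mul_assoc]
      exact mul_le_mul_of_nonneg_right (h m).2 (hG _)
  refine antidiagonalEquiv.summable_iff.1 (key.congr fun p => ?_)
  simp only [Function.comp_apply, antidiagonalEquiv, Equiv.coe_fn_mk, add_sub_cancel]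

lemma DiagBounded.summable {κ : ℤ → ℤ → ℂ} (h : DiagBounded κ) {φ : UnitAddCircle → ℂ}
    (hφ : IsTestFunction φ) :
    Summable fun p : ℤ × ℤ => ‖κ p.1 p.2‖ * ‖fourierCoeff φ (-(p.1 + p.2))‖ :=
  h.summable_mul (G := fun m => ‖fourierCoeff φ (-m)‖) (fun _ => norm_nonneg _)
    hφ.summable_fourierCoeff

lemma ofKernel_pairing {κ : ℤ → ℤ → ℂ} (h : DiagBounded κ) {φ : UnitAddCircle → ℂ}
    (hφ : IsTestFunction φ) : (ofKernel κ h).pairing φ =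
      ∑' p : ℤ × ℤ, κ p.1 p.2 * fourierCoeff φ (-(p.1 + p.2)) := by
  have hs : Summable fun p : ℤ × ℤ => κ p.1 p.2 * fourierCoeff φ (-(p.1 + p.2)) :=
    Summable.of_norm (by simpa only [norm_mul] using h.summable hφ)
  rw [← antidiagonalEquiv.tsum_eq]
  rw [← antidiagonalEquiv.summable_iff] at hs
  simp only [Function.comp_def, antidiagonalEquiv, Equiv.coe_fn_mk, add_sub_cancel] at hs ⊢
  rw [hs.tsum_prod]
  simp only [tsum_mul_right]
  rfl

/-! ### Littlewood-Paley blocks -/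

/-- The frequencies `|k| ≤ R 2^N`, containing the supports of the first windows. -/
def DyadicPartition.box (P : DyadicPartition) (N : ℕ) : Finset ℤ :=
  Finset.Icc (-((P.radius * 2 ^ N : ℕ) : ℤ)) (P.radius * 2 ^ N : ℕ)

namespace DyadicPartition

variable (P : DyadicPartition)

lemma mem_box_of_bracket_le {N : ℕ} {k : ℤ} (h : bracket k ≤ P.radius * 2 ^ N) : k ∈ P.box N := by
  have h1 : |(k : ℝ)| ≤ ((P.radius * 2 ^ N : ℕ) : ℝ) := by
    push_cast
    exact (abs_le_bracket k).trans h
  rw [box, Finset.mem_Icc, ← abs_le]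
  exact_mod_cast h1

lemma mem_box_of_window_ne_zero {j N : ℕ} (hj : j ≤ N) {k : ℤ} (h : P.window j k ≠ 0) :
    k ∈ P.box N := by
  refine P.mem_box_of_bracket_le ((P.bracket_le_of_window_ne_zero h).trans ?_)
  gcongr
  norm_num

/-- The `j`-th Littlewood-Paley block of a sequence of Fourier coefficients. -/
def blockPoly (j : ℕ) (a : ℤ → ℂ) : C(UnitAddCircle, ℂ) :=
  trigPoly (P.box j) fun k => P.window j k * a k

lemma blockPoly_eq {j N : ℕ} (hj : j ≤ N) (a : ℤ → ℂ) :
    P.blockPoly j a = trigPoly (P.box N) fun k => P.window j k * a k := by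
  refine trigPoly_eq_of_subset (fun k hk => ?_) fun k _ hk => ?_
  · rw [box, Finset.mem_Icc] at *
    have : ((P.radius * 2 ^ j : ℕ) : ℤ) ≤ (P.radius * 2 ^ N : ℕ) := by
      exact_mod_cast Nat.mul_le_mul_left _ (Nat.pow_le_pow_right (by norm_num) hj)
    omega
  · by_contra h
    refine hk (P.mem_box_of_window_ne_zero le_rfl (j := j) fun h0 => h ?_)
    rw [h0, Complex.ofReal_zero, zero_mul]

lemma block_eq_blockPoly (j : ℕ) (u : PeriodicDistribution) (x : UnitAddCircle) :
    P.block j u x = P.blockPoly j u.coeff x := by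
  rw [blockPoly, trigPoly_apply, block, tsum_eq_sum (s := P.box j)]
  intro k hk
  by_contra h
  refine hk (P.mem_box_of_window_ne_zero le_rfl (j := j) fun h0 => h ?_)
  rw [h0, Complex.ofReal_zero, zero_mul, zero_mul]

/-- The strict inequality `i < N` leaves room for the neighbouring block i + 1, so that both factors
have frequencies in the same box. -/
lemma resonantTerm_eq_sum {i N : ℕ} (hi : i < N) (f g : PeriodicDistribution) (x : UnitAddCircle) :
    P.resonantTerm f g i x = ∑ p ∈ P.box N ×ˢ P.box N,
      (P.resWeight i p.1 p.2 : ℂ) * (f.coeff p.1 * g.coeff p.2) * fourier (p.1 + p.2) x := by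
  rw [Finset.sum_product, resonantTerm]
  have h : ∀ j ∈ Finset.Icc (i - 1) (i + 1), P.block i f x * P.block j g x =
      ∑ k ∈ P.box N, ∑ l ∈ P.box N, (P.window i k : ℂ) * P.window j l *
        (f.coeff k * g.coeff l) * fourier (k + l) x := by
    intro j hj
    rw [Finset.mem_Icc] at hj
    rw [block_eq_blockPoly, block_eq_blockPoly, P.blockPoly_eq hi.le,
      P.blockPoly_eq (show j ≤ N by omega), trigPoly_apply, trigPoly_apply, Finset.sum_mul_sum]
    refine Finset.sum_congr rfl fun k _ => Finset.sum_congr rfl fun l _ => ?_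
    rw [fourier_add]
    ring
  rw [Finset.sum_congr rfl h, Finset.sum_comm]
  refine Finset.sum_congr rfl fun k _ => ?_
  rw [Finset.sum_comm]
  refine Finset.sum_congr rfl fun l _ => ?_
  rw [← Finset.sum_mul, ← Finset.sum_mul, ← Finset.mul_sum, resWeight]
  push_cast
  ring

lemma resWeight_eq_zero {i N : ℕ} (hi : i < N) {p : ℤ × ℤ} (hp : p ∉ P.box N ×ˢ P.box N) :
    P.resWeight i p.1 p.2 = 0 := by
  by_contra h
  refine hp (Finset.mem_product.2 ⟨P.mem_box_of_window_ne_zero hi.le (P.resWeight_ne_zero h).1, ?_⟩)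
  obtain ⟨j, hj, h3⟩ := Finset.exists_ne_zero_of_sum_ne_zero (mul_ne_zero_iff.1 h).2
  rw [Finset.mem_Icc] at hj
  exact P.mem_box_of_window_ne_zero (by omega) h3

lemma partialWeight_eq_zero {N : ℕ} {p : ℤ × ℤ} (hp : p ∉ P.box N ×ˢ P.box N) :
    P.partialWeight N p.1 p.2 = 0 :=
  Finset.sum_eq_zero fun _ hi => P.resWeight_eq_zero (Finset.mem_range.1 hi) hp

lemma integral_sum_resonantTerm (N : ℕ) (f g : PeriodicDistribution) {φ : UnitAddCircle → ℂ}
    (hφ : IsTestFunction φ) :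
    ∫ x : UnitAddCircle, (∑ i ∈ Finset.range N, P.resonantTerm f g i x) * φ x =
      ∑ p ∈ P.box N ×ˢ P.box N, (P.partialWeight N p.1 p.2 : ℂ) * (f.coeff p.1 * g.coeff p.2) *
        fourierCoeff φ (-(p.1 + p.2)) := by
  have h : ∀ x, (∑ i ∈ Finset.range N, P.resonantTerm f g i x) * φ x =
      ∑ p ∈ P.box N ×ˢ P.box N, (P.partialWeight N p.1 p.2 : ℂ) * (f.coeff p.1 * g.coeff p.2) *
        (fourier (p.1 + p.2) x * φ x) := by
    intro x
    rw [Finset.sum_congr rfl fun i hi => P.resonantTerm_eq_sum (Finset.mem_range.1 hi) f g x,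
      Finset.sum_comm, Finset.sum_mul]
    refine Finset.sum_congr rfl fun p _ => ?_
    rw [← Finset.sum_mul, ← Finset.sum_mul, partialWeight]
    push_cast
    ring
  simp only [h]
  rw [integral_finsetSum]
  · refine Finset.sum_congr rfl fun p _ => ?_
    rw [integral_const_mul, fourierCoeff_eq_integral, neg_neg]
  · intro p _
    have := hφ.continuous
    exact integrable_of_continuous_unitAddCircle (by fun_prop)

/-- If the frequency sums converge absolutely, the resonant product exists. -/
lemma diagBounded_weight {f g : ℤ → ℂ} (h : DiagBounded fun k l => f k * g l) :
    DiagBounded fun k l => (P.weight k l : ℂ) * (f k * g l) :=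
  h.mono (C := 1) fun k l => by
    rw [one_mul, norm_mul]
    refine mul_le_of_le_one_left (norm_nonneg _) ?_
    rw [Complex.norm_real, Real.norm_eq_abs, abs_of_nonneg (P.weight_nonneg _ _)]
    exact P.weight_le_one _ _

/-- Dominated convergence: the truncated weights lie in [0, 1] and converge pointwise. -/
lemma isResonantProduct_of_diagBounded {f g : PeriodicDistribution}
    (h : DiagBounded fun k l => f.coeff k * g.coeff l) :
    P.IsResonantProduct f g (ofKernel _ (P.diagBounded_weight h)) := by
  intro φ hφ
  rw [ofKernel_pairing _ hφ]
  simp only [P.integral_sum_resonantTerm _ f g hφ]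
  have h1 : ∀ N, ∑ p ∈ P.box N ×ˢ P.box N, (P.partialWeight N p.1 p.2 : ℂ) *
      (f.coeff p.1 * g.coeff p.2) * fourierCoeff φ (-(p.1 + p.2)) =
      ∑' p : ℤ × ℤ, (P.partialWeight N p.1 p.2 : ℂ) * (f.coeff p.1 * g.coeff p.2) *
        fourierCoeff φ (-(p.1 + p.2)) := by
    intro N
    rw [tsum_eq_sum]
    intro p hp
    rw [P.partialWeight_eq_zero hp]
    simp
  simp only [h1]
  refine tendsto_tsum_of_dominated_convergence (h.summable hφ) (fun p => ?_)
    (Eventually.of_forall fun N p => ?_)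
  · exact (((Complex.continuous_ofReal.tendsto _).comp
      (P.tendsto_partialWeight p.1 p.2)).mul_const _).mul_const _
  · rw [norm_mul, norm_mul]
    gcongr
    refine mul_le_of_le_one_left (norm_nonneg _) ?_
    rw [Complex.norm_real, Real.norm_eq_abs, abs_of_nonneg (P.partialWeight_nonneg _ _ _)]
    exact P.partialWeight_le_one _ _ _

end DyadicPartition

/-! ### The renormalized product -/

/-- The square summability of `b_k / ⟨k⟩`, satisfied by almost every sample of white noise. -/
def IsRough (b : ℤ → ℂ) : Prop := Summable fun k => (‖b k‖ / bracket k) ^ 2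

/-- On the antidiagonal k + l = m the factor |k + l| is constant, and the rest is a convolution of
two square summable sequences. The growth is therefore linear in m. -/
lemma IsRough.diagBounded {b d : ℤ → ℂ} (hb : IsRough b) (hd : IsRough d) :
    DiagBounded fun k l =>
      ((|(k : ℝ) + l| * (‖b k‖ / bracket k) * (‖d l‖ / bracket l) : ℝ) : ℂ) := by
  refine ⟨(∑' k, (‖b k‖ / bracket k) ^ 2) + ∑' k, (‖d k‖ / bracket k) ^ 2, 1, fun m => ?_⟩
  have hd' : Summable fun k => (‖d (m - k)‖ / bracket (m - k)) ^ 2 :=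
    (Equiv.subLeft m).summable_iff.2 hd
  have hle : ∀ k : ℤ, ‖((|(k : ℝ) + ((m - k : ℤ) : ℝ)| * (‖b k‖ / bracket k) *
      (‖d (m - k)‖ / bracket (m - k)) : ℝ) : ℂ)‖ ≤
      bracket m * ((‖b k‖ / bracket k) ^ 2 + (‖d (m - k)‖ / bracket (m - k)) ^ 2) := by
    intro k
    have h1 := bracket_pos k
    have h2 := bracket_pos (m - k)
    rw [Complex.norm_real, Real.norm_eq_abs, abs_of_nonneg (by positivity), mul_assoc]
    push_cast
    rw [add_sub_cancel]
    gcongr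
    · exact (bracket_pos m).le
    · exact abs_le_bracket m
    · nlinarith [sq_nonneg (‖b k‖ / bracket k - ‖d (m - k)‖ / bracket (m - k)),
        sq_nonneg (‖b k‖ / bracket k + ‖d (m - k)‖ / bracket (m - k))]
  have hs := (hb.add hd').mul_left (bracket m)
  have hs' := hs.of_nonneg_of_le (fun k => norm_nonneg _) hle
  refine ⟨hs', (hs'.tsum_le_tsum hle hs).trans (le_of_eq ?_)⟩
  rw [tsum_mul_left, hb.tsum_add hd', pow_one, mul_comm]
  congr 2
  exact (Equiv.subLeft m).tsum_eq fun k => (‖d k‖ / bracket k) ^ 2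

/-- The symmetrized kernel of the product `∇(-Δ)⁻¹b · d`. -/
def symKernel (P : DyadicPartition) (b d : ℤ → ℂ) (k l : ℤ) : ℂ :=
  Complex.I / (4 * Real.pi) * ((P.weight k l * (((k : ℝ))⁻¹ + ((l : ℝ))⁻¹) : ℝ) : ℂ) * (b k * d l)

lemma norm_I_div_four_pi_le : ‖Complex.I / (4 * (Real.pi : ℂ))‖ ≤ 1 := by
  have := Real.pi_gt_three
  simp [abs_of_pos Real.pi_pos]
  rw [← mul_inv]
  exact inv_le_one_of_one_le₀ (by linarith)

lemma diagBounded_symKernel (P : DyadicPartition) {b d : ℤ → ℂ} (hb : IsRough b)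
    (hd : IsRough d) : DiagBounded (symKernel P b d) := by
  refine (hb.diagBounded hd).mono (C := 1) fun k l => ?_
  have h1 := bracket_pos k
  have h2 := bracket_pos l
  rw [symKernel, norm_mul, norm_mul, Complex.norm_real, Complex.norm_real, Real.norm_eq_abs,
    Real.norm_eq_abs, abs_mul, abs_of_nonneg (P.weight_nonneg _ _),
    abs_of_nonneg (show 0 ≤ |(k : ℝ) + l| * (‖b k‖ / bracket k) * (‖d l‖ / bracket l) by positivity)]
  calc _ ≤ 1 * (1 * (|(k : ℝ) + l| / (bracket k * bracket l))) * ‖b k * d l‖ := by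
        gcongr
        · exact mul_nonneg (P.weight_nonneg _ _) (abs_nonneg _)
        · exact norm_I_div_four_pi_le
        · exact P.weight_le_one _ _
        · exact DyadicPartition.abs_inv_add_inv_le k l
    _ = _ := by rw [norm_mul]; field_simp

/-- The distribution `½ ∑_{|i - j| ≤ 1} (Δ_i ∇(-Δ)⁻¹b Δ_j d + Δ_j b Δ_i ∇(-Δ)⁻¹d)`. -/
def symProduct (P : DyadicPartition) {b d : ℤ → ℂ} (hb : IsRough b) (hd : IsRough d) :
    PeriodicDistribution :=
  ofKernel (symKernel P b d) (diagBounded_symKernel P hb hd)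

lemma gradPotential_coeff (u : PeriodicDistribution) (k : ℤ) :
    (gradPotential u).coeff k = Complex.I / (2 * Real.pi) * (((k : ℝ)⁻¹ : ℝ) : ℂ) * u.coeff k := by
  simp only [gradPotential, grad, invNegLaplacian, meanFree, multiplier]
  have hpi : (Real.pi : ℂ) ≠ 0 := by exact_mod_cast Real.pi_ne_zero
  rcases eq_or_ne k 0 with rfl | hk
  · simp
  · have : (k : ℂ) ≠ 0 := by exact_mod_cast hk
    simp only [hk, if_false]
    push_cast
    field_simp
    norm_num

/-- The series is not dominated as it stands, because one factor 1/k does not compensate two rough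
factors. Exchanging k and l in half of each finite partial sum produces the symmetrized weights,
which are dominated uniformly in the truncation. -/
lemma isResonantProduct_gradPotential (P : DyadicPartition) {u : PeriodicDistribution}
    (hu : IsRough u.coeff) :
    P.IsResonantProduct (gradPotential u) u (symProduct P hu hu) := by
  intro φ hφ
  rw [symProduct, ofKernel_pairing _ hφ]
  simp only [P.integral_sum_resonantTerm _ _ _ hφ]
  -- The symmetrization takes place in the finite sum over a box that is invariant under the swap.
  have h1 : ∀ N, ∑ p ∈ P.box N ×ˢ P.box N, (P.partialWeight N p.1 p.2 : ℂ) *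
      ((gradPotential u).coeff p.1 * u.coeff p.2) * fourierCoeff φ (-(p.1 + p.2)) =
      ∑' p : ℤ × ℤ, Complex.I / (4 * Real.pi) * ((P.partialWeight N p.1 p.2 * ((p.1 : ℝ))⁻¹ +
        P.partialWeight N p.2 p.1 * ((p.2 : ℝ))⁻¹ : ℝ) : ℂ) * (u.coeff p.1 * u.coeff p.2) *
        fourierCoeff φ (-(p.1 + p.2)) := by
    intro N
    rw [tsum_eq_sum (s := P.box N ×ˢ P.box N)]
    · set T : ℤ → ℤ → ℂ := fun k l => Complex.I / (4 * Real.pi) *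
        ((P.partialWeight N k l * ((k : ℝ))⁻¹ : ℝ) : ℂ) * (u.coeff k * u.coeff l) *
        fourierCoeff φ (-(k + l)) with hT
      have hl : ∀ k l : ℤ, (P.partialWeight N k l : ℂ) * ((gradPotential u).coeff k * u.coeff l) *
          fourierCoeff φ (-(k + l)) = T k l + T k l := by
        intro k l
        rw [gradPotential_coeff, hT]
        push_cast
        ring
      have hr : ∀ k l : ℤ, Complex.I / (4 * Real.pi) * ((P.partialWeight N k l * ((k : ℝ))⁻¹ +
        P.partialWeight N l k * ((l : ℝ))⁻¹ : ℝ) : ℂ) * (u.coeff k * u.coeff l) *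
        fourierCoeff φ (-(k + l)) = T k l + T l k := by
        intro k l
        simp only [hT]
        rw [add_comm l k]
        push_cast
        ring
      simp only [hl, hr, Finset.sum_add_distrib]
      congr 1
      rw [Finset.sum_product, Finset.sum_product, Finset.sum_comm]
    · intro p hp
      rw [P.partialWeight_eq_zero hp, P.partialWeight_eq_zero (p := (p.2, p.1)) (by
        simpa [Finset.mem_product, and_comm] using hp)]
      simp
  simp only [h1]
  -- The dominating function is the kernel of `IsRough.diagBounded`, by `abs_partialWeight_symm_le`.
  -- The limit of the weights is symmetric by `weight_comm`.
  refine tendsto_tsum_of_dominated_convergence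
    (((hu.diagBounded hu).summable hφ).mul_left P.symConst) (fun p => ?_)
    (Eventually.of_forall fun N p => ?_)
  · refine Tendsto.mul_const _ (Tendsto.mul_const _ (Tendsto.const_mul _ ?_))
    refine (Complex.continuous_ofReal.tendsto _).comp ?_
    rw [mul_add]
    nth_rw 2 [P.weight_comm]
    exact ((P.tendsto_partialWeight p.1 p.2).mul_const _).add
      ((P.tendsto_partialWeight p.2 p.1).mul_const _)
  · have h2 := bracket_pos p.1
    have h3 := bracket_pos p.2
    have := P.symConst_nonneg
    rw [norm_mul, ← mul_assoc P.symConst]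
    refine mul_le_mul_of_nonneg_right ?_ (norm_nonneg (fourierCoeff φ (-(p.1 + p.2))))
    rw [norm_mul, norm_mul, Complex.norm_real, Complex.norm_real, Real.norm_eq_abs,
      Real.norm_eq_abs, abs_of_nonneg (show 0 ≤ |(p.1 : ℝ) + p.2| * (‖u.coeff p.1‖ / bracket p.1) *
        (‖u.coeff p.2‖ / bracket p.2) by positivity)]
    calc _ ≤ 1 * (P.symConst * (|(p.1 : ℝ) + p.2| / (bracket p.1 * bracket p.2))) *
          ‖u.coeff p.1 * u.coeff p.2‖ := by
          gcongr
          · exact norm_I_div_four_pi_le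
          · exact P.abs_partialWeight_symm_le _ _ _
      _ = _ := by rw [norm_mul]; field_simp

end TorusNoise
end

noncomputable section

namespace TorusNoise

/-! ### Integrals of series -/

/-- Tonelli for the sum of the norms, which is then finite almost everywhere and dominates the
series. -/
lemma integrable_tsum_of_summable_integral_norm {X ι : Type*} [MeasurableSpace X] [Countable ι]
    {μ : Measure X} {F : ι → X → ℂ} (hF : ∀ i, Integrable (F i) μ)
    (hs : Summable fun i => ∫ a, ‖F i a‖ ∂μ) :
    (∀ᵐ a ∂μ, Summable fun i => ‖F i a‖) ∧ Integrable (fun a => ∑' i, F i a) μ := by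
  have h1 : ∀ i, ∫⁻ a, ‖F i a‖ₑ ∂μ = ENNReal.ofReal (∫ a, ‖F i a‖ ∂μ) := fun i =>
    (ofReal_integral_norm_eq_lintegral_enorm (hF i)).symm
  have h2 : ∫⁻ a, ∑' i, ‖F i a‖ₑ ∂μ < ∞ := by
    rw [lintegral_tsum fun i => (hF i).aestronglyMeasurable.enorm]
    simp only [h1]
    rw [← ENNReal.ofReal_tsum_of_nonneg (fun i => integral_nonneg fun _ => norm_nonneg _) hs]
    exact ENNReal.ofReal_lt_top
  have h3 : ∀ᵐ a ∂μ, Summable fun i => ‖F i a‖ := by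
    filter_upwards [ae_lt_top' (AEMeasurable.tsum
      fun i => (hF i).aestronglyMeasurable.enorm) h2.ne] with a ha
    have := ENNReal.summable_toReal ha.ne
    simpa using this
  refine ⟨h3, ⟨?_, ?_⟩⟩
  · refine aestronglyMeasurable_of_tendsto_ae atTop
      (f := fun (s : Finset ι) a => ∑ i ∈ s, F i a)
      (fun s => Finset.aestronglyMeasurable_fun_sum s fun i _ => (hF i).aestronglyMeasurable) ?_
    filter_upwards [h3] with a ha
    exact ha.of_norm.hasSum
  · refine lt_of_le_of_lt (lintegral_mono_ae ?_) h2
    filter_upwards [h3] with a ha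
    exact enorm_tsum_le_tsum_enorm

/-! ### The heat flow -/

/-- The symbol `k e^{-4π²k²t}` of `∇ P_t / (2πi)`. -/
def heatMode (t : ℝ) (k : ℤ) : ℝ := k * Real.exp (-(4 * Real.pi ^ 2 * (k : ℝ) ^ 2) * t)

lemma grad_heat_coeff (u : PeriodicDistribution) {t : ℝ} (ht : 0 < t) (k : ℤ) :
    (grad (heat t (meanFree u))).coeff k =
      2 * Real.pi * Complex.I * (heatMode t k : ℂ) * u.coeff k := by
  simp only [grad, heat, meanFree, multiplier, heatMode, max_eq_left ht.le]
  rcases eq_or_ne k 0 with rfl | hk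
  · simp
  · simp only [hk, if_false]
    rw [show -4 * Real.pi ^ 2 * (k : ℝ) ^ 2 * t = -(4 * Real.pi ^ 2 * (k : ℝ) ^ 2) * t by ring]
    push_cast
    ring

/-- One term of the exponential series, y^{n+2}/(n+2)! ≤ e^y, beats the polynomial factor. The
summand 1 in the constant covers k = 0. -/
lemma summable_bracket_pow_mul_exp {c : ℝ} (hc : 0 < c) (n : ℕ) :
    Summable fun k : ℤ => bracket k ^ n * Real.exp (-(c * (k : ℝ) ^ 2)) := by
  refine (summable_bracket_inv_sq.mul_left (1 + (n + 2).factorial / c ^ (n + 2))).of_nonneg_of_le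
    (fun k => by have := bracket_pos k; positivity) fun k => ?_
  have hb := bracket_pos k
  rw [← div_eq_mul_inv, le_div_iff₀ (by positivity)]
  rcases eq_or_ne k 0 with rfl | hk
  · simp
    positivity
  · have h1 := Real.pow_div_factorial_le_exp (c * (k : ℝ) ^ 2) (by positivity) (n + 2)
    have h2 : bracket k ^ (n + 2) ≤ ((k : ℝ) ^ 2) ^ (n + 2) := by
      refine pow_le_pow_left₀ hb.le ?_ _
      have : (1 : ℝ) ≤ |(k : ℝ)| := by exact_mod_cast Int.one_le_abs hk
      rw [bracket_eq_abs hk, ← sq_abs]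
      nlinarith
    rw [Real.exp_neg]
    have h3 := Real.exp_pos (c * (k : ℝ) ^ 2)
    rw [mul_pow, div_le_iff₀ (by positivity)] at h1
    calc bracket k ^ n * (Real.exp (c * (k : ℝ) ^ 2))⁻¹ * bracket k ^ 2
        = bracket k ^ (n + 2) * (Real.exp (c * (k : ℝ) ^ 2))⁻¹ := by ring
      _ ≤ ((n + 2).factorial / c ^ (n + 2) * Real.exp (c * (k : ℝ) ^ 2)) *
          (Real.exp (c * (k : ℝ) ^ 2))⁻¹ := by
          gcongr
          rw [div_mul_eq_mul_div, le_div_iff₀ (by positivity)]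
          calc _ ≤ ((k : ℝ) ^ 2) ^ (n + 2) * c ^ (n + 2) := by gcongr
            _ ≤ _ := by linarith
      _ = (n + 2).factorial / c ^ (n + 2) := by field_simp
      _ ≤ _ := by linarith

lemma summable_bracket_pow_mul_grad_heat (u : PeriodicDistribution) {t : ℝ} (ht : 0 < t) (n : ℕ) :
    Summable fun k : ℤ => bracket k ^ n * ‖(grad (heat t (meanFree u))).coeff k‖ := by
  obtain ⟨C, m, hC, h⟩ := u.exists_bound
  have hs := (summable_bracket_pow_mul_exp (c := 4 * Real.pi ^ 2 * t) (by positivity)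
    (n + 1 + m)).mul_left (2 * Real.pi * C)
  refine hs.of_nonneg_of_le
    (fun k => by have := bracket_pos k; positivity) fun k => ?_
  have hb := bracket_pos k
  have h1 : ‖(grad (heat t (meanFree u))).coeff k‖ ≤ 2 * Real.pi *
      (bracket k * Real.exp (-(4 * Real.pi ^ 2 * t * (k : ℝ) ^ 2))) * (C * bracket k ^ m) := by
    rw [grad_heat_coeff u ht, norm_mul, norm_mul, Complex.norm_real, heatMode, Real.norm_eq_abs,
      abs_mul, abs_of_pos (Real.exp_pos _)]
    rw [show -(4 * Real.pi ^ 2 * (k : ℝ) ^ 2) * t = -(4 * Real.pi ^ 2 * t * (k : ℝ) ^ 2) by ring]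
    gcongr
    · simp [abs_of_pos Real.pi_pos]
    · exact abs_le_bracket k
    · exact h k
  calc _ ≤ bracket k ^ n * (2 * Real.pi *
      (bracket k * Real.exp (-(4 * Real.pi ^ 2 * t * (k : ℝ) ^ 2))) * (C * bracket k ^ m)) := by
        gcongr
    _ = _ := by ring

/-- The inequality ⟨m - k⟩ ≤ 2⟨m⟩⟨k⟩ distributes the polynomial growth of `g` over the output
frequency and the rapidly decaying `f`. -/
lemma diagBounded_of_summable {f g : ℤ → ℂ} (hf : ∀ n : ℕ, Summable fun k => bracket k ^ n * ‖f k‖)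
    (hg : ∃ (C : ℝ) (n : ℕ), 0 ≤ C ∧ ∀ k, ‖g k‖ ≤ C * bracket k ^ n) :
    DiagBounded fun k l => f k * g l := by
  obtain ⟨C, n, hC, h⟩ := hg
  refine ⟨C * 2 ^ n * ∑' k, bracket k ^ n * ‖f k‖, n, fun m => ?_⟩
  have hle : ∀ k, ‖f k * g (m - k)‖ ≤ C * 2 ^ n * bracket m ^ n * (bracket k ^ n * ‖f k‖) := by
    intro k
    have hb := bracket_pos (m - k)
    rw [norm_mul]
    calc ‖f k‖ * ‖g (m - k)‖ ≤ ‖f k‖ * (C * bracket (m - k) ^ n) := by gcongr; exact h _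
      _ ≤ ‖f k‖ * (C * (2 * (bracket m * bracket k)) ^ n) := by
          gcongr
          exact bracket_sub_le_mul m k
      _ = _ := by rw [mul_pow, mul_pow]; ring
  have hs := (hf n).mul_left (C * 2 ^ n * bracket m ^ n)
  have hs' := hs.of_nonneg_of_le (fun k => norm_nonneg _) hle
  refine ⟨hs', (hs'.tsum_le_tsum hle hs).trans (le_of_eq ?_)⟩
  rw [tsum_mul_left]
  ring

lemma diagBounded_grad_heat (u v : PeriodicDistribution) {t : ℝ} (ht : 0 < t) :
    DiagBounded fun k l => (grad (heat t (meanFree u))).coeff k * v.coeff l :=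
  diagBounded_of_summable (summable_bracket_pow_mul_grad_heat u ht) v.exists_bound

lemma resonantFlow_eq (P : DyadicPartition) (u : PeriodicDistribution) {t : ℝ} (ht : 0 < t) :
    P.resonantFlow u t = ofKernel _ (P.diagBounded_weight (diagBounded_grad_heat u u ht)) :=
  (P.isResonantProduct_of_diagBounded (diagBounded_grad_heat u u ht)).resonant_eq

lemma isResonantProduct_resonantFlow (P : DyadicPartition) (u : PeriodicDistribution) {t : ℝ}
    (ht : 0 < t) : P.IsResonantProduct (grad (heat t (meanFree u))) u (P.resonantFlow u t) := by
  rw [resonantFlow_eq P u ht]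
  exact P.isResonantProduct_of_diagBounded (diagBounded_grad_heat u u ht)

/-- For t > 0 the series converges absolutely and may be averaged with its swapped version. The
symmetric form is needed because only it stays integrable down to t = 0 for rough `u`. -/
lemma resonantFlow_pairing (P : DyadicPartition) (u : PeriodicDistribution) {t : ℝ} (ht : 0 < t)
    {φ : UnitAddCircle → ℂ} (hφ : IsTestFunction φ) :
    (P.resonantFlow u t).pairing φ = ∑' p : ℤ × ℤ,
      (Real.pi * Complex.I * P.weight p.1 p.2 * (u.coeff p.1 * u.coeff p.2) *
        fourierCoeff φ (-(p.1 + p.2))) * ((heatMode t p.1 + heatMode t p.2 : ℝ) : ℂ) := by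
  have h := P.diagBounded_weight (diagBounded_grad_heat u u ht)
  rw [resonantFlow_eq P u ht, ofKernel_pairing h hφ]
  have hs : Summable fun p : ℤ × ℤ => (P.weight p.1 p.2 : ℂ) *
      ((grad (heat t (meanFree u))).coeff p.1 * u.coeff p.2) * fourierCoeff φ (-(p.1 + p.2)) :=
    Summable.of_norm (by simpa only [norm_mul] using h.summable hφ)
  have hs' := (Equiv.prodComm ℤ ℤ).summable_iff.2 hs
  have h2 := (Equiv.prodComm ℤ ℤ).tsum_eq (fun p : ℤ × ℤ => (P.weight p.1 p.2 : ℂ) *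
      ((grad (heat t (meanFree u))).coeff p.1 * u.coeff p.2) * fourierCoeff φ (-(p.1 + p.2)))
  have h3 := hs.tsum_add hs'
  simp only [Function.comp_def] at h3
  rw [h2, ← two_mul] at h3
  rw [eq_comm, ← mul_right_inj' (two_ne_zero (α := ℂ)), ← h3, ← tsum_mul_left]
  refine tsum_congr fun p => ?_
  simp only [Equiv.prodComm_apply, Prod.fst_swap, Prod.snd_swap]
  rw [grad_heat_coeff u ht, grad_heat_coeff u ht, P.weight_comm p.2 p.1, add_comm p.2 p.1]
  push_cast
  ring

lemma integrableOn_exp_neg_mul {a : ℝ} (ha : 0 < a) :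
    IntegrableOn (fun t => Real.exp (-a * t)) (Set.Ioi 0) :=
  integrableOn_exp_mul_Ioi (by linarith) 0

lemma integral_exp_neg_mul_Ioi_zero {a : ℝ} (ha : 0 < a) :
    ∫ t in Set.Ioi (0 : ℝ), Real.exp (-a * t) = a⁻¹ := by
  rw [integral_exp_mul_Ioi (by linarith)]
  simp
  
lemma integrableOn_heatMode (k : ℤ) : IntegrableOn (fun t => heatMode t k) (Set.Ioi 0) := by
  unfold heatMode
  rcases eq_or_ne k 0 with rfl | hk
  · simp
  · exact (integrableOn_exp_neg_mul (by positivity)).const_mul _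

lemma integral_heatMode (k : ℤ) :
    ∫ t in Set.Ioi (0 : ℝ), heatMode t k = (4 * Real.pi ^ 2)⁻¹ * (k : ℝ)⁻¹ := by
  unfold heatMode
  rcases eq_or_ne k 0 with rfl | hk
  · simp
  · have : (k : ℝ) ≠ 0 := by exact_mod_cast hk
    rw [integral_const_mul, integral_exp_neg_mul_Ioi_zero (by positivity)]
    field_simp

lemma heatMode_neg (t : ℝ) (k : ℤ) : heatMode t (-k) = -heatMode t k := by
  simp [heatMode]

lemma heatMode_nonneg (t : ℝ) {k : ℤ} (hk : 0 ≤ k) : 0 ≤ heatMode t k :=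
  mul_nonneg (by exact_mod_cast hk) (Real.exp_pos _).le

/-- With e_k = e^{-4π²k²t} one has k e_k - l e_l = k(e_k - e_l) - (l - k)e_l with both parts
nonnegative, so the absolute value costs only a sign and the integrals are explicit. -/
lemma integral_abs_heatMode_sub_le {k l : ℤ} (hk : 0 < k) (hkl : k ≤ l) :
    ∫ t in Set.Ioi (0 : ℝ), |heatMode t k - heatMode t l| ≤ ((l : ℝ) - k) / (k * l) := by
  have hk' : (0 : ℝ) < k := by exact_mod_cast hk
  have hkl' : (k : ℝ) ≤ l := by exact_mod_cast hkl
  have hl' : (0 : ℝ) < l := by linarith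
  have h0 : IntegrableOn (fun t : ℝ => Real.exp (-(4 * Real.pi ^ 2 * (k : ℝ) ^ 2) * t) -
      Real.exp (-(4 * Real.pi ^ 2 * (l : ℝ) ^ 2) * t)) (Set.Ioi 0) :=
    (integrableOn_exp_neg_mul (by positivity)).sub (integrableOn_exp_neg_mul (by positivity))
  have h1 : IntegrableOn (fun t : ℝ => (k : ℝ) * (Real.exp (-(4 * Real.pi ^ 2 * (k : ℝ) ^ 2) * t) -
      Real.exp (-(4 * Real.pi ^ 2 * (l : ℝ) ^ 2) * t)) +
      (l - k) * Real.exp (-(4 * Real.pi ^ 2 * (l : ℝ) ^ 2) * t)) (Set.Ioi 0) :=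
    (h0.const_mul _).add ((integrableOn_exp_neg_mul (by positivity)).const_mul _)
  refine (setIntegral_mono_on ((integrableOn_heatMode k).sub (integrableOn_heatMode l)).abs h1
    measurableSet_Ioi fun t ht => ?_).trans ?_
  · have h2 : Real.exp (-(4 * Real.pi ^ 2 * (l : ℝ) ^ 2) * t) ≤
        Real.exp (-(4 * Real.pi ^ 2 * (k : ℝ) ^ 2) * t) := by
      have : (0 : ℝ) < t := ht
      rw [Real.exp_le_exp]
      gcongr
    have h3 : heatMode t k - heatMode t l =
        (k : ℝ) * (Real.exp (-(4 * Real.pi ^ 2 * (k : ℝ) ^ 2) * t) -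
          Real.exp (-(4 * Real.pi ^ 2 * (l : ℝ) ^ 2) * t)) -
        (l - k) * Real.exp (-(4 * Real.pi ^ 2 * (l : ℝ) ^ 2) * t) := by
      unfold heatMode; ring
    show |heatMode t k - heatMode t l| ≤ _
    rw [h3]
    refine (abs_sub _ _).trans (le_of_eq ?_)
    rw [abs_of_nonneg (mul_nonneg hk'.le (sub_nonneg.2 h2)),
      abs_of_nonneg (mul_nonneg (sub_nonneg.2 hkl') (Real.exp_pos _).le)]
  · rw [integral_add (h0.const_mul _)
      ((integrableOn_exp_neg_mul (by positivity)).const_mul _), integral_const_mul,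
      integral_const_mul, integral_sub (integrableOn_exp_neg_mul (by positivity))
      (integrableOn_exp_neg_mul (by positivity)), integral_exp_neg_mul_Ioi_zero (by positivity),
      integral_exp_neg_mul_Ioi_zero (by positivity)]
    have h4 : (k : ℝ) * ((4 * Real.pi ^ 2 * (k : ℝ) ^ 2)⁻¹ - (4 * Real.pi ^ 2 * (l : ℝ) ^ 2)⁻¹) +
        (l - k) * (4 * Real.pi ^ 2 * (l : ℝ) ^ 2)⁻¹ =
        ((l : ℝ) - k) / (k * l) * ((l + 2 * k) / (4 * Real.pi ^ 2 * l)) := by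
      field_simp
      ring
    rw [h4]
    -- The remaining factor (l + 2k)/(4π²l) is below 1 since k ≤ l and 4π² ≥ 3.
    refine mul_le_of_le_one_right (div_nonneg (by linarith) (by positivity)) ?_
    rw [div_le_one (by positivity)]
    nlinarith [Real.pi_gt_three, mul_pos hl' (by positivity : (0 : ℝ) < Real.pi ^ 2),
      mul_nonneg hl'.le (by nlinarith [Real.pi_gt_three] : (0 : ℝ) ≤ 4 * Real.pi ^ 2 - 3)]

/-- The modes are odd in the frequency, so symmetry allows |k| ≤ |l| and l ≥ 0. Opposite signs lead
to a difference of two positive modes; equal signs make the absolute value superfluous. The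
cancellation therefore survives the time integral of absolute values, and it does so with the same
factor as for the stationary kernel. -/
lemma integral_abs_heatMode_add_le (k l : ℤ) :
    ∫ t in Set.Ioi (0 : ℝ), |heatMode t k + heatMode t l| ≤
      |(k : ℝ) + l| / (bracket k * bracket l) := by
  wlog hkl : |k| ≤ |l| generalizing k l
  · have := this l k (le_of_not_ge hkl)
    simpa only [add_comm, mul_comm] using this
  wlog hl : 0 ≤ l generalizing k l
  · have := this (-k) (-l) (by simpa using hkl) (by omega)
    simp only [heatMode_neg, bracket_neg, ← neg_add, abs_neg] at this
    push_cast at this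
    rwa [← neg_add, abs_neg] at this
  rcases lt_or_ge k 0 with hk | hk
  · have h := integral_abs_heatMode_sub_le (k := -k) (l := l) (by omega) (by
      rw [abs_of_neg hk, abs_of_nonneg hl] at hkl; exact hkl)
    simp only [heatMode_neg, ← neg_add', abs_neg] at h
    refine h.trans (le_of_eq ?_)
    have hk' : (k : ℝ) < 0 := by exact_mod_cast hk
    have hl0 : l ≠ 0 := by rintro rfl; rw [abs_zero] at hkl; have := abs_pos.2 hk.ne; omega
    have hl' : (0 : ℝ) ≤ l := by exact_mod_cast hl
    have hkl' : (0 : ℝ) ≤ k + l := by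
      rw [abs_of_neg hk, abs_of_nonneg hl] at hkl
      exact_mod_cast (by omega : 0 ≤ k + l)
    rw [bracket_eq_abs hk.ne, bracket_eq_abs hl0, abs_of_neg hk', abs_of_nonneg hl',
      abs_of_nonneg hkl']
    push_cast
    rw [sub_neg_eq_add, add_comm]
  · have h1 : ∀ t, |heatMode t k + heatMode t l| = heatMode t k + heatMode t l := fun t =>
      abs_of_nonneg (add_nonneg (heatMode_nonneg t hk) (heatMode_nonneg t hl))
    simp only [h1]
    rw [integral_add (integrableOn_heatMode k) (integrableOn_heatMode l), integral_heatMode,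
      integral_heatMode, ← mul_add]
    have hk' : (0 : ℝ) ≤ k := by exact_mod_cast hk
    have hl' : (0 : ℝ) ≤ l := by exact_mod_cast hl
    have h2 := DyadicPartition.abs_inv_add_inv_le k l
    refine le_trans ?_ ((le_abs_self _).trans h2)
    refine mul_le_of_le_one_left (by positivity) (inv_le_one_of_one_le₀ ?_)
    nlinarith [Real.pi_gt_three]

/-- The integral of the resonant products along the heat flow. -/
lemma isWeakIntegral_resonantFlow (P : DyadicPartition) {u : PeriodicDistribution}
    (hu : IsRough u.coeff) : IsWeakIntegral (P.resonantFlow u) (symProduct P hu hu) := by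
  intro φ hφ
  set c : ℤ × ℤ → ℂ := fun p => Real.pi * Complex.I * P.weight p.1 p.2 *
    (u.coeff p.1 * u.coeff p.2) * fourierCoeff φ (-(p.1 + p.2)) with hc
  set F : ℤ × ℤ → ℝ → ℂ := fun p t => c p * ((heatMode t p.1 + heatMode t p.2 : ℝ) : ℂ) with hF
  have hEq : Set.EqOn (fun t => (P.resonantFlow u t).pairing φ) (fun t => ∑' p, F p t)
      (Set.Ioi 0) := fun t ht => resonantFlow_pairing P u ht hφ
  have hint : ∀ p, Integrable (F p) (volume.restrict (Set.Ioi 0)) := fun p =>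
    (((integrableOn_heatMode p.1).add (integrableOn_heatMode p.2)).ofReal).const_mul _
  -- This summable bound justifies exchanging the time integral with the sum over pairs of
  -- frequencies.
  have hnorm : ∀ p : ℤ × ℤ, ∫ t in Set.Ioi (0 : ℝ), ‖F p t‖ ≤
      Real.pi * (‖((|(p.1 : ℝ) + p.2| * (‖u.coeff p.1‖ / bracket p.1) *
        (‖u.coeff p.2‖ / bracket p.2) : ℝ) : ℂ)‖ * ‖fourierCoeff φ (-(p.1 + p.2))‖) := by
    intro p
    have h2 := bracket_pos p.1
    have h3 := bracket_pos p.2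
    have hL : ∫ t in Set.Ioi (0 : ℝ), ‖F p t‖ =
        ‖c p‖ * ∫ t in Set.Ioi (0 : ℝ), |heatMode t p.1 + heatMode t p.2| := by
      simp only [hF, norm_mul, Complex.norm_real, Real.norm_eq_abs]
      rw [integral_const_mul]
    rw [hL]
    have h4 : ‖c p‖ ≤ Real.pi * (‖u.coeff p.1‖ * ‖u.coeff p.2‖) *
        ‖fourierCoeff φ (-(p.1 + p.2))‖ := by
      rw [hc]
      simp only [norm_mul, Complex.norm_real, Complex.norm_I, mul_one, Real.norm_eq_abs,
        abs_of_pos Real.pi_pos, abs_of_nonneg (P.weight_nonneg _ _)]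
      refine mul_le_mul_of_nonneg_right (mul_le_mul_of_nonneg_right ?_ (by positivity))
        (norm_nonneg _)
      exact mul_le_of_le_one_right Real.pi_pos.le (P.weight_le_one _ _)
    calc _ ≤ (Real.pi * (‖u.coeff p.1‖ * ‖u.coeff p.2‖) *
        ‖fourierCoeff φ (-(p.1 + p.2))‖) * (|(p.1 : ℝ) + p.2| / (bracket p.1 * bracket p.2)) :=
          mul_le_mul h4 (integral_abs_heatMode_add_le _ _)
            (integral_nonneg fun _ => abs_nonneg _) (by positivity)
      _ = _ := by
          rw [Complex.norm_real, Real.norm_eq_abs, abs_of_nonneg (show 0 ≤ |(p.1 : ℝ) + p.2| *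
            (‖u.coeff p.1‖ / bracket p.1) * (‖u.coeff p.2‖ / bracket p.2) by positivity)]
          field_simp
  have hsum : Summable fun p => ∫ t in Set.Ioi (0 : ℝ), ‖F p t‖ :=
    (((hu.diagBounded hu).summable hφ).mul_left Real.pi).of_nonneg_of_le
      (fun p => integral_nonneg fun _ => norm_nonneg _) hnorm
  refine ⟨(integrableOn_congr_fun hEq measurableSet_Ioi).2
    (integrable_tsum_of_summable_integral_norm hint hsum).2, ?_⟩
  rw [setIntegral_congr_fun measurableSet_Ioi hEq,
    ← integral_tsum_of_summable_integral_norm hint hsum, symProduct, ofKernel_pairing _ hφ]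
  refine tsum_congr fun p => ?_
  simp only [hF, hc, symKernel]
  rw [integral_const_mul, integral_complex_ofReal, integral_add (integrableOn_heatMode _)
    (integrableOn_heatMode _), integral_heatMode, integral_heatMode]
  have hpi : (Real.pi : ℂ) ≠ 0 := by exact_mod_cast Real.pi_ne_zero
  push_cast
  field_simp

lemma isWeakIntegral_grad_heat (u : PeriodicDistribution) :
    IsWeakIntegral (fun t => grad (heat t (meanFree u))) (gradPotential u) := by
  intro φ hφ
  set c : ℤ → ℂ := fun k => 2 * Real.pi * Complex.I * (u.coeff k * fourierCoeff φ (-k)) with hc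
  set F : ℤ → ℝ → ℂ := fun k t => c k * (heatMode t k : ℂ) with hF
  have hEq : Set.EqOn (fun t => (grad (heat t (meanFree u))).pairing φ) (fun t => ∑' p, F p t)
      (Set.Ioi 0) := fun t ht => by
    refine tsum_congr fun k => ?_
    rw [grad_heat_coeff u ht, hF, hc]
    ring
  have hint : ∀ k, Integrable (F k) (volume.restrict (Set.Ioi 0)) := fun k =>
    ((integrableOn_heatMode k).ofReal).const_mul _
  have hnorm : ∀ k, ∫ t in Set.Ioi (0 : ℝ), ‖F k t‖ ≤
      2 * Real.pi * (‖u.coeff k‖ * ‖fourierCoeff φ (-k)‖) := by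
    intro k
    -- The mode at frequency 0 vanishes, so the two-frequency bound contains the one for a single
    -- frequency.
    have h1 := integral_abs_heatMode_add_le k 0
    have h0 : ∀ t, heatMode t 0 = 0 := fun t => by simp [heatMode]
    simp only [h0, add_zero, Int.cast_zero, bracket_zero, mul_one] at h1
    have h2 : ∫ t in Set.Ioi (0 : ℝ), |heatMode t k| ≤ 1 :=
      h1.trans ((div_le_one (bracket_pos k)).2 (abs_le_bracket k))
    simp only [hF, norm_mul, Complex.norm_real, Real.norm_eq_abs (heatMode _ _)]
    rw [integral_const_mul]
    refine (mul_le_of_le_one_right (norm_nonneg _) h2).trans (le_of_eq ?_)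
    simp [hc, abs_of_pos Real.pi_pos]
  have hsum : Summable fun k => ∫ t in Set.Ioi (0 : ℝ), ‖F k t‖ :=
    ((u.summable_pairing hφ).mul_left _).of_nonneg_of_le
      (fun p => integral_nonneg fun _ => norm_nonneg _) hnorm
  refine ⟨(integrableOn_congr_fun hEq measurableSet_Ioi).2
    (integrable_tsum_of_summable_integral_norm hint hsum).2, ?_⟩
  rw [setIntegral_congr_fun measurableSet_Ioi hEq,
    ← integral_tsum_of_summable_integral_norm hint hsum, pairing]
  refine tsum_congr fun k => ?_
  simp only [hF, hc]
  rw [integral_const_mul, integral_complex_ofReal, integral_heatMode, gradPotential_coeff]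
  have hpi : (Real.pi : ℂ) ≠ 0 := by exact_mod_cast Real.pi_ne_zero
  push_cast
  field_simp
  norm_num
  ring

end TorusNoise
end

noncomputable section

namespace TorusNoise

/-! ### Hölder bounds for the renormalized product -/

/-- The frequency `k`, with `0` replaced by `1`. -/
def freq (k : ℤ) : ℝ := if k = 0 then 1 else k

lemma abs_freq (k : ℤ) : |freq k| = bracket k := by
  unfold freq
  split_ifs with h
  · simp [h]
  · rw [bracket_eq_abs h]

lemma freq_ne_zero (k : ℤ) : freq k ≠ 0 := by
  have := bracket_pos k
  rw [← abs_freq] at this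
  exact abs_pos.1 this

/-- The distribution with coefficients `û(k) / k`, `k ≠ 0`, and `û(0)`. -/
def reduced : PeriodicDistribution → PeriodicDistribution :=
  multiplier (fun k => (((freq k)⁻¹ : ℝ) : ℂ)) ⟨1, 0, fun k => by
    rw [Complex.norm_real, norm_inv, Real.norm_eq_abs, abs_freq, pow_zero, mul_one]
    exact inv_le_one_of_one_le₀ (one_le_bracket k)⟩

lemma reduced_coeff (u : PeriodicDistribution) (k : ℤ) :
    (reduced u).coeff k = (((freq k)⁻¹ : ℝ) : ℂ) * u.coeff k := rfl

lemma norm_reduced_coeff (u : PeriodicDistribution) (k : ℤ) :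
    ‖(reduced u).coeff k‖ = ‖u.coeff k‖ / bracket k := by
  rw [reduced_coeff, norm_mul, Complex.norm_real, norm_inv, Real.norm_eq_abs, abs_freq,
    div_eq_inv_mul]

lemma IsRough.summable_reduced {u : PeriodicDistribution} (hu : IsRough u.coeff) :
    Summable fun k => ‖(reduced u).coeff k‖ ^ 2 := by
  simp only [norm_reduced_coeff]
  exact hu

lemma diagBounded_of_summable_sq {f g : ℤ → ℂ} (hf : Summable fun k => ‖f k‖ ^ 2)
    (hg : Summable fun k => ‖g k‖ ^ 2) : DiagBounded fun k l => f k * g l := by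
  refine ⟨(∑' k, ‖f k‖ ^ 2) + ∑' k, ‖g k‖ ^ 2, 0, fun m => ?_⟩
  have hg' : Summable fun k => ‖g (m - k)‖ ^ 2 := (Equiv.subLeft m).summable_iff.2 hg
  have hle : ∀ k, ‖f k * g (m - k)‖ ≤ ‖f k‖ ^ 2 + ‖g (m - k)‖ ^ 2 := fun k => by
    rw [norm_mul]
    nlinarith [sq_nonneg (‖f k‖ - ‖g (m - k)‖), sq_nonneg (‖f k‖ + ‖g (m - k)‖)]
  have hs := hf.add hg'
  have hs' := hs.of_nonneg_of_le (fun k => norm_nonneg _) hle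
  refine ⟨hs', (hs'.tsum_le_tsum hle hs).trans (le_of_eq ?_)⟩
  rw [hf.tsum_add hg', pow_zero, mul_one]
  congr 1
  exact (Equiv.subLeft m).tsum_eq fun k => ‖g k‖ ^ 2

namespace DyadicPartition

variable (P : DyadicPartition)

lemma window_eq_zero_of_lt {j : ℕ} {k : ℤ} (h : ((P.radius * 2 ^ j : ℕ) : ℤ) < |k|) :
    P.window j k = 0 := by
  by_contra h0
  have h1 := (abs_le_bracket k).trans (P.bracket_le_of_window_ne_zero h0)
  have h2 : |k| ≤ ((P.radius * 2 ^ j : ℕ) : ℤ) := by exact_mod_cast h1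
  omega

/-- The operator `∇Δ_j` is bounded by `2^j` on `L^∞`, up to a constant. -/
def kernelConst : ℝ := 4 * (P.radius * (2 * P.radius * P.lipConst + 1))

lemma kernelConst_nonneg : 0 ≤ P.kernelConst := by
  have := P.lipConst_nonneg
  unfold kernelConst
  positivity

/-- The multiplier m·w_j(m) is of size 2^j, has bounded increments, and is supported at scale 2^j.
This is the situation of `integral_norm_trigPoly_le`, with `B` chosen so that B/M is the bound for
the increments. -/
lemma integral_norm_kernel_le (j : ℕ) :
    ∫ x : UnitAddCircle, ‖trigPoly (P.box j) (fun m => (P.window j m : ℂ) * m) x‖ ≤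
      P.kernelConst * 2 ^ j := by
  have hL := P.lipConst_nonneg
  have hR := P.one_le_radius'
  have hR0 := P.one_le_radius
  have h2 : (0 : ℝ) < 2 ^ j := by positivity
  have h21 : (1 : ℝ) ≤ 2 ^ j := one_le_pow₀ (by norm_num)
  have hnorm : ∀ k : ℤ, ‖(P.window j k : ℂ) * k‖ = |(k : ℝ)| * P.window j k := fun k => by
    rw [norm_mul, Complex.norm_real, Real.norm_eq_abs, abs_of_nonneg (P.window_nonneg _ _),
      Complex.norm_intCast, mul_comm]
  have h := integral_norm_trigPoly_le (M := P.radius * 2 ^ j)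
    (c := fun m => (P.window j m : ℂ) * m)
    (B := P.radius * (2 * P.radius * P.lipConst + 1) * 2 ^ j)
    (Nat.one_le_iff_ne_zero.2 (by positivity)) (by positivity) (fun k => ?_) (fun k hk => ?_)
    (fun k => ?_)
  · refine h.trans (le_of_eq ?_)
    rw [kernelConst]; ring
  · rw [hnorm]
    refine (P.abs_mul_window_le j k).trans ?_
    have : 0 ≤ (P.radius : ℝ) * (2 * P.radius * P.lipConst) * 2 ^ j := by positivity
    nlinarith
  · rw [P.window_eq_zero_of_lt hk, Complex.ofReal_zero, zero_mul]
  -- Discrete Leibniz rule for the product of the window with the frequency.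
  · have h3 : (P.window j ((k + 1 : ℤ) : ℝ) : ℂ) * ((k + 1 : ℤ) : ℂ) - (P.window j k : ℂ) * k =
        ((P.window j ((k + 1 : ℤ) : ℝ) + k * (P.window j ((k + 1 : ℤ) : ℝ) - P.window j k) : ℝ) : ℂ) := by
      push_cast; ring
    rw [h3, Complex.norm_real, Real.norm_eq_abs]
    have h4 : |(k : ℝ)| * |P.window j ((k + 1 : ℤ) : ℝ) - P.window j k| ≤
        2 * P.radius * P.lipConst := by
      have h5 := P.abs_window_sub_le j ((k + 1 : ℤ) : ℝ) k
      push_cast at h5 ⊢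
      rw [add_sub_cancel_left, abs_one, mul_one] at h5
      -- Beyond twice the radius of the support both neighbouring frequencies lie outside it.
      by_cases hk : |(k : ℝ)| ≤ 2 * P.radius * 2 ^ j
      · calc _ ≤ (2 * P.radius * 2 ^ j) * (P.lipConst / 2 ^ j) := by gcongr
          _ = _ := by field_simp
      · have h6 : P.window j k = 0 := by
          by_contra h0
          have := (abs_le_bracket k).trans (P.bracket_le_of_window_ne_zero h0)
          nlinarith
        have h7 : P.window j ((k + 1 : ℤ) : ℝ) = 0 := by
          by_contra h0
          have h8 := (abs_le_bracket (k + 1)).trans (P.bracket_le_of_window_ne_zero h0)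
          have h9 : |(k : ℝ)| ≤ |((k + 1 : ℤ) : ℝ)| + 1 := by
            have := abs_sub ((k + 1 : ℤ) : ℝ) 1
            push_cast at this ⊢
            rwa [add_sub_cancel_right, abs_one] at this
          nlinarith
        push_cast at h7
        rw [h6, h7]
        simp
        positivity
    have h5 : (P.radius : ℝ) * (2 * P.radius * P.lipConst + 1) * 2 ^ j / (P.radius * 2 ^ j : ℕ) =
        1 + 2 * P.radius * P.lipConst := by
      push_cast; field_simp; ring
    rw [h5]
    refine (abs_add_le _ _).trans (add_le_add ?_ ?_)
    · rw [abs_of_nonneg (P.window_nonneg _ _)]; exact P.window_le_one _ _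
    · rw [abs_mul]; exact h4

/-- The test function `y ↦ K_j(x - y)`, where `K_j` is the kernel of `∇Δ_j / (2πi)`. -/
def kernelTest (j : ℕ) (x y : UnitAddCircle) : ℂ :=
  trigPoly (P.box j) (fun m => (P.window j m : ℂ) * m) (x - y)

lemma kernelTest_eq (j : ℕ) (x y : UnitAddCircle) : P.kernelTest j x y =
    ∑ m ∈ P.box j, (P.window j m : ℂ) * m * fourier m x * fourier (-m) y := by
  rw [kernelTest, trigPoly_apply]
  refine Finset.sum_congr rfl fun m _ => ?_
  rw [mul_assoc (_ * _)]
  congr 1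
  rw [fourier_apply, fourier_apply, fourier_apply, smul_sub, sub_eq_add_neg, ← neg_smul,
    AddCircle.toCircle_add, Circle.coe_mul]

lemma isTestFunction_kernelTest (j : ℕ) (x : UnitAddCircle) :
    IsTestFunction (P.kernelTest j x) := by
  unfold IsTestFunction
  simp only [P.kernelTest_eq]
  exact ContDiff.sum fun m _ => contDiff_const.mul (isTestFunction_fourier (-m))

lemma fourierCoeff_kernelTest (j : ℕ) (x : UnitAddCircle) (m : ℤ) :
    fourierCoeff (P.kernelTest j x) (-m) = (P.window j m : ℂ) * m * fourier m x := by
  rw [fourierCoeff_eq_integral, neg_neg]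
  simp only [P.kernelTest_eq, Finset.mul_sum]
  rw [integral_finsetSum _ fun k _ => integrable_of_continuous_unitAddCircle (by fun_prop)]
  have h : ∀ k : ℤ, ∫ y : UnitAddCircle, fourier m y *
      ((P.window j k : ℂ) * k * fourier k x * fourier (-k) y) =
      (P.window j k : ℂ) * k * fourier k x * if m = k then 1 else 0 := by
    intro k
    have h1 : ∀ y : UnitAddCircle, fourier m y * ((P.window j k : ℂ) * k * fourier k x *
        fourier (-k) y) = (P.window j k : ℂ) * k * fourier k x * fourier (m + -k) y := fun y => by
      rw [fourier_add]; ring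
    simp only [h1]
    rw [integral_const_mul, integral_fourier]
    simp only [add_neg_eq_zero]
  simp only [h]
  by_cases hm : m ∈ P.box j
  · rw [Finset.sum_eq_single m]
    · simp
    · intro k _ hk
      rw [if_neg (Ne.symm hk), mul_zero]
    · exact fun h => absurd hm h
  · rw [Finset.sum_eq_zero]
    · by_contra h
      refine hm (P.mem_box_of_window_ne_zero le_rfl (j := j) fun h0 => h ?_)
      rw [h0, Complex.ofReal_zero, zero_mul, zero_mul]
    · intro k hk
      rw [if_neg (fun h : m = k => hm (h ▸ hk)), mul_zero]

lemma integral_norm_kernelTest_le (j : ℕ) (x : UnitAddCircle) :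
    ∫ y : UnitAddCircle, ‖P.kernelTest j x y‖ ≤ P.kernelConst * 2 ^ j := by
  refine le_trans (le_of_eq ?_) (P.integral_norm_kernel_le j)
  exact integral_sub_left_eq_self
    (fun y => ‖trigPoly (P.box j) (fun m => (P.window j m : ℂ) * m) y‖) _ x

lemma integral_resonantTerm (i : ℕ) (f g : PeriodicDistribution) {φ : UnitAddCircle → ℂ}
    (hφ : IsTestFunction φ) :
    ∫ x : UnitAddCircle, P.resonantTerm f g i x * φ x =
      ∑ p ∈ P.box (i + 1) ×ˢ P.box (i + 1), (P.resWeight i p.1 p.2 : ℂ) *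
        (f.coeff p.1 * g.coeff p.2) * fourierCoeff φ (-(p.1 + p.2)) := by
  simp only [P.resonantTerm_eq_sum (Nat.lt_succ_self i) f g, Finset.sum_mul, mul_assoc _ _ (φ _)]
  have := hφ.continuous
  rw [integral_finsetSum _ fun p _ => integrable_of_continuous_unitAddCircle (by fun_prop)]
  refine Finset.sum_congr rfl fun p _ => ?_
  rw [integral_const_mul, fourierCoeff_eq_integral, neg_neg]

lemma continuous_resonantTerm (f g : PeriodicDistribution) (i : ℕ) :
    Continuous fun x => P.resonantTerm f g i x := by
  unfold resonantTerm
  simp only [block_eq_blockPoly]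
  fun_prop

/-- If the blocks of `f` and `g` are of size `A q^i` and `B q^i`, then the `i`-th resonant term is
of size `A B q^{2i}`. -/
lemma norm_resonantTerm_le {f g : PeriodicDistribution} {q A B : ℝ} (hq : 0 < q) (hq1 : q ≤ 1)
    (hA : 0 ≤ A) (hB : 0 ≤ B) (hf : ∀ i x, ‖P.block i f x‖ ≤ A * q ^ i)
    (hg : ∀ i x, ‖P.block i g x‖ ≤ B * q ^ i) (i : ℕ) (x : UnitAddCircle) :
    ‖P.resonantTerm f g i x‖ ≤ 3 / q * A * B * (q ^ 2) ^ i := by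
  have hj : ∀ j ∈ Finset.Icc (i - 1) (i + 1), ‖P.block i f x * P.block j g x‖ ≤
      A * q ^ i * (B * q ^ i / q) := by
    intro j hj
    rw [Finset.mem_Icc] at hj
    rw [norm_mul]
    refine mul_le_mul (hf i x) ((hg j x).trans ?_) (norm_nonneg _) (by positivity)
    rw [le_div_iff₀ hq, mul_assoc, ← pow_succ]
    exact mul_le_mul_of_nonneg_left (pow_le_pow_of_le_one hq.le hq1 (by omega)) hB
  refine (norm_sum_le_of_le _ hj).trans ?_
  rw [Finset.sum_const, nsmul_eq_mul]
  have hcard : ((Finset.Icc (i - 1) (i + 1)).card : ℝ) ≤ 3 := by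
    rw [Nat.card_Icc]
    exact_mod_cast (by omega : i + 1 + 1 - (i - 1) ≤ 3)
  calc _ ≤ 3 * (A * q ^ i * (B * q ^ i / q)) := by gcongr
    _ = _ := by ring

lemma norm_integral_resonantTerm_mul_kernelTest_le {f g : PeriodicDistribution} {q A B : ℝ}
    (hq : 0 < q) (hq1 : q ≤ 1) (hA : 0 ≤ A) (hB : 0 ≤ B)
    (hf : ∀ i x, ‖P.block i f x‖ ≤ A * q ^ i) (hg : ∀ i x, ‖P.block i g x‖ ≤ B * q ^ i)
    (i j : ℕ) (x : UnitAddCircle) :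
    ‖∫ y : UnitAddCircle, P.resonantTerm f g i y * P.kernelTest j x y‖ ≤
      3 / q * A * B * (q ^ 2) ^ i * (P.kernelConst * 2 ^ j) := by
  have hc := (P.isTestFunction_kernelTest j x).continuous
  have hc' := P.continuous_resonantTerm f g i
  refine (norm_integral_le_integral_norm _).trans ?_
  calc ∫ y : UnitAddCircle, ‖P.resonantTerm f g i y * P.kernelTest j x y‖
      ≤ ∫ y : UnitAddCircle, 3 / q * A * B * (q ^ 2) ^ i * ‖P.kernelTest j x y‖ := by
        refine integral_mono (integrable_of_continuous_unitAddCircle (by fun_prop))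
          (integrable_of_continuous_unitAddCircle (by fun_prop)) fun y => ?_
        show ‖_ * _‖ ≤ _
        rw [norm_mul]
        gcongr
        exact P.norm_resonantTerm_le hq hq1 hA hB hf hg i y
    _ = 3 / q * A * B * (q ^ 2) ^ i * ∫ y : UnitAddCircle, ‖P.kernelTest j x y‖ :=
        integral_const_mul _ _
    _ ≤ _ := by
        gcongr
        exact P.integral_norm_kernelTest_le j x

/-- The `i`-th resonant term only contributes to the blocks `j ≤ i + c`. -/
lemma integral_resonantTerm_mul_kernelTest_eq_zero (f g : PeriodicDistribution) {i j c : ℕ}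
    (hc : 3 * (P.radius : ℝ) ^ 2 ≤ 2 ^ c) (hij : i + c < j) (x : UnitAddCircle) :
    ∫ y : UnitAddCircle, P.resonantTerm f g i y * P.kernelTest j x y = 0 := by
  rw [P.integral_resonantTerm i f g (P.isTestFunction_kernelTest j x)]
  refine Finset.sum_eq_zero fun p _ => ?_
  rw [P.fourierCoeff_kernelTest]
  by_contra h
  have h1 : P.resWeight i p.1 p.2 ≠ 0 := fun h0 => h (by simp [h0])
  have h2 : P.window j ((p.1 + p.2 : ℤ) : ℝ) ≠ 0 := fun h0 => h (by rw [h0]; simp)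
  obtain ⟨h3, h4, -⟩ := P.resWeight_ne_zero h1
  have h5 := P.bracket_le_of_window_ne_zero h3
  have h6 := P.two_pow_le_of_window_ne_zero h2
  have h7 := bracket_add_le p.1 p.2
  have hR := P.one_le_radius'
  have h8 : (2 : ℝ) ^ j ≤ 2 ^ (i + c) := by
    calc (2 : ℝ) ^ j ≤ P.radius * bracket (p.1 + p.2) := h6
      _ ≤ P.radius * (P.radius * 2 ^ i + 2 * P.radius * 2 ^ i) := by gcongr; linarith
      _ = (3 * P.radius ^ 2) * 2 ^ i := by ring
      _ ≤ 2 ^ c * 2 ^ i := by gcongr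
      _ = _ := by rw [pow_add]; ring
  exact absurd h8 (not_le.2 (pow_lt_pow_right₀ (by norm_num) hij))

/-- The Hölder estimate for the derivative of a resonant product. -/
lemma exists_norm_pairing_kernelTest_le {q σ : ℝ} (hq : 0 < q) (hq1 : q ≤ 1) (hσ : 1 ≤ σ)
    (hqσ : q ^ 2 * σ < 1) : ∃ C : ℝ, 0 ≤ C ∧ ∀ (f g w : PeriodicDistribution) (A B : ℝ),
      0 ≤ A → 0 ≤ B → (∀ i x, ‖P.block i f x‖ ≤ A * q ^ i) →
      (∀ i x, ‖P.block i g x‖ ≤ B * q ^ i) → P.IsResonantProduct f g w →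
      ∀ j x, ‖w.pairing (P.kernelTest j x)‖ ≤ C * (A * B) * (2 / σ) ^ j := by
  obtain ⟨c, hc⟩ := pow_unbounded_of_one_lt (3 * (P.radius : ℝ) ^ 2) (one_lt_two (α := ℝ))
  have hK := P.kernelConst_nonneg
  have hσ0 : 0 < σ := by linarith
  have hr : 0 < 1 - q ^ 2 * σ := by linarith
  refine ⟨3 / q * P.kernelConst * σ ^ c * (1 - q ^ 2 * σ)⁻¹, by positivity,
    fun f g w A B hA hB hf hg hw j x => ?_⟩
  refine le_of_tendsto' (hw _ (P.isTestFunction_kernelTest j x)).norm fun N => ?_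
  simp only [Finset.sum_mul]
  have hcont := (P.isTestFunction_kernelTest j x).continuous
  rw [integral_finsetSum _ fun i _ => integrable_of_continuous_unitAddCircle
    (by have := P.continuous_resonantTerm f g i; fun_prop)]
  have hle : ∀ i ∈ Finset.range N,
      ‖∫ y : UnitAddCircle, P.resonantTerm f g i y * P.kernelTest j x y‖ ≤
        3 / q * P.kernelConst * σ ^ c * (A * B) * (2 / σ) ^ j * (q ^ 2 * σ) ^ i := by
    intro i _
    by_cases hij : i + c < j
    · rw [P.integral_resonantTerm_mul_kernelTest_eq_zero f g hc.le hij, norm_zero]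
      positivity
    · refine (P.norm_integral_resonantTerm_mul_kernelTest_le hq hq1 hA hB hf hg i j x).trans ?_
      -- Only i ≥ j - c remains, so σ^{i+c-j} ≥ 1 may be inserted. It converts the tail of the
      -- geometric series into the factor σ^{-j}, and the rest sums because q²σ < 1.
      have h1 : σ ^ j ≤ σ ^ (i + c) := pow_le_pow_right₀ hσ (by omega)
      have h2 : (1 : ℝ) ≤ σ ^ i * σ ^ c / σ ^ j := by
        rw [le_div_iff₀ (by positivity), one_mul, ← pow_add]
        exact h1
      calc _ ≤ 3 / q * A * B * (q ^ 2) ^ i * (P.kernelConst * 2 ^ j) *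
            (σ ^ i * σ ^ c / σ ^ j) := le_mul_of_one_le_right (by positivity) h2
        _ = _ := by rw [mul_pow, div_pow]; ring
  refine (norm_sum_le_of_le _ hle).trans ?_
  rw [← Finset.mul_sum]
  have hgeo : ∑ i ∈ Finset.range N, (q ^ 2 * σ) ^ i ≤ (1 - q ^ 2 * σ)⁻¹ := by
    rw [← tsum_geometric_of_lt_one (by positivity) hqσ]
    exact (summable_geometric_of_lt_one (by positivity) hqσ).sum_le_tsum _
      fun i _ => by positivity
  calc _ ≤ 3 / q * P.kernelConst * σ ^ c * (A * B) * (2 / σ) ^ j * (1 - q ^ 2 * σ)⁻¹ := by gcongr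
    _ = _ := by ring

/-- The m-th coefficient of each block is at most its sup norm, and the windows add up to 1, so a
geometric series bounds the coefficient of `f`. -/
lemma norm_coeff_le_of_block_le {f : PeriodicDistribution} {q A : ℝ} (hq : 0 ≤ q) (hq1 : q < 1)
    (hf : ∀ i x, ‖P.block i f x‖ ≤ A * q ^ i) (m : ℤ) : ‖f.coeff m‖ ≤ A * (1 - q)⁻¹ := by
  have h1 : ∀ i, ‖(P.window i m : ℂ) * f.coeff m‖ ≤ A * q ^ i := by
    intro i
    have h2 := integral_trigPoly_mul_fourier (P.box i) (fun k => P.window i k * f.coeff k) m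
    have h3 : (if m ∈ P.box i then (P.window i m : ℂ) * f.coeff m else 0) =
        P.window i m * f.coeff m := by
      split_ifs with h
      · rfl
      · by_contra h4
        refine h (P.mem_box_of_window_ne_zero le_rfl (j := i) fun h0 => h4 ?_)
        rw [h0, Complex.ofReal_zero, zero_mul]
    rw [h3] at h2
    rw [← h2]
    have h4 : ∀ x : UnitAddCircle, ‖trigPoly (P.box i) (fun k => P.window i k * f.coeff k) x *
        fourier (-m) x‖ ≤ A * q ^ i := fun x => ?_
    · refine (norm_integral_le_of_norm_le_const (Eventually.of_forall h4)).trans (le_of_eq ?_)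
      rw [measureReal_def, UnitAddCircle.measure_univ, ENNReal.toReal_one, mul_one]
    rw [norm_mul, norm_fourier_apply, mul_one]
    have h5 := hf i x
    rwa [block_eq_blockPoly] at h5
  have h2 : HasSum (fun i => (P.window i m : ℂ) * f.coeff m) (1 * f.coeff m) :=
    HasSum.mul_right _ (by
      have := Complex.hasSum_ofReal.2 (P.hasSum_window m)
      rwa [Complex.ofReal_one] at this)
  rw [one_mul] at h2
  have h3 := (hasSum_geometric_of_lt_one hq hq1).mul_left A
  exact h2.norm_le_of_bounded h3 h1

end DyadicPartition
end TorusNoise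
end

/-! ### The zero mode and the Hölder estimate for the renormalized product -/

noncomputable section

namespace TorusNoise

/-- The error in `(1/k + 1/l) k l = k + l` caused by the zero frequency. -/
def zeroModeError (k l : ℤ) : ℝ := (((k : ℝ))⁻¹ + ((l : ℝ))⁻¹) * (freq k * freq l) - (k + l)

lemma zeroModeError_eq_zero {k l : ℤ} (hk : k ≠ 0) (hl : l ≠ 0) : zeroModeError k l = 0 := by
  have hk' : (k : ℝ) ≠ 0 := by exact_mod_cast hk
  have hl' : (l : ℝ) ≠ 0 := by exact_mod_cast hl
  simp only [zeroModeError, freq, hk, hl, if_false]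
  field_simp
  ring

lemma zeroModeError_comm (k l : ℤ) : zeroModeError k l = zeroModeError l k := by
  unfold zeroModeError; ring

lemma abs_zeroModeError_zero_le (l : ℤ) : |zeroModeError 0 l| ≤ 2 * bracket l := by
  rcases eq_or_ne l 0 with rfl | hl
  · simp [zeroModeError]
  · have hl' : (l : ℝ) ≠ 0 := by exact_mod_cast hl
    -- Here 0⁻¹ = 0 while `freq 0 = 1`, so the product term contributes 1 instead of l.
    have h : zeroModeError 0 l = 1 - l := by
      simp only [zeroModeError, freq, hl, if_false, if_true]
      push_cast
      field_simp
      simp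
    rw [h]
    have := abs_sub (1 : ℝ) l
    rw [abs_one] at this
    linarith [one_le_bracket l, abs_le_bracket l]

namespace DyadicPartition

variable (P : DyadicPartition)

/-- The contribution of the zero frequency to the renormalized product. -/
def zeroModeCorrection (f g : ℤ → ℂ) (m : ℤ) : ℂ :=
  ∑' k, (P.weight k (m - k) : ℂ) * (zeroModeError k (m - k) : ℂ) * (f k * g (m - k))

/-- The error requires one of the two frequencies to vanish. The weight then forces the other one,
which is m, to be bounded, so the correction is a trigonometric polynomial of fixed degree with at
most two summands per coefficient. -/
lemma norm_zeroModeCorrection_le {f g : ℤ → ℂ} {A B : ℝ} (hf : ∀ k, ‖f k‖ ≤ A)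
    (hg : ∀ k, ‖g k‖ ≤ B) (m : ℤ) :
    ‖P.zeroModeCorrection f g m‖ ≤
      if m ∈ Finset.Icc (-((2 * P.radius ^ 2 : ℕ) : ℤ)) (2 * P.radius ^ 2 : ℕ) then
        8 * P.radius ^ 2 * (A * B) else 0 := by
  have hA : 0 ≤ A := (norm_nonneg _).trans (hf 0)
  have hB : 0 ≤ B := (norm_nonneg _).trans (hg 0)
  have hw : ∀ k ∈ ({0, m} : Finset ℤ), P.weight k (m - k) ≠ 0 →
      bracket m ≤ 2 * P.radius ^ 2 ∧ |zeroModeError k (m - k)| ≤ 2 * bracket m := by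
    intro k hk h
    rw [Finset.mem_insert, Finset.mem_singleton] at hk
    rcases hk with rfl | rfl
    · rw [sub_zero] at *
      refine ⟨?_, abs_zeroModeError_zero_le m⟩
      simpa using (P.bracket_le_of_weight_ne_zero h).1
    · rw [sub_self] at *
      refine ⟨?_, ?_⟩
      · simpa using (P.bracket_le_of_weight_ne_zero h).2
      · rw [zeroModeError_comm]; exact abs_zeroModeError_zero_le k
  have hterm : ∀ k ∈ ({0, m} : Finset ℤ),
      ‖(P.weight k (m - k) : ℂ) * (zeroModeError k (m - k) : ℂ) * (f k * g (m - k))‖ ≤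
      if m ∈ Finset.Icc (-((2 * P.radius ^ 2 : ℕ) : ℤ)) (2 * P.radius ^ 2 : ℕ) then
        4 * P.radius ^ 2 * (A * B) else 0 := by
    intro k hk
    by_cases h0 : P.weight k (m - k) = 0
    · rw [h0, Complex.ofReal_zero, zero_mul, zero_mul, norm_zero]
      split_ifs <;> positivity
    · obtain ⟨h1, h2⟩ := hw k hk h0
      have hm : m ∈ Finset.Icc (-((2 * P.radius ^ 2 : ℕ) : ℤ)) (2 * P.radius ^ 2 : ℕ) := by
        rw [Finset.mem_Icc, ← abs_le]
        exact_mod_cast (abs_le_bracket m).trans h1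
      rw [if_pos hm, norm_mul, norm_mul, norm_mul, Complex.norm_real, Complex.norm_real,
        Real.norm_eq_abs, Real.norm_eq_abs, abs_of_nonneg (P.weight_nonneg _ _)]
      calc _ ≤ 1 * (2 * (2 * (P.radius : ℝ) ^ 2)) * (A * B) := by
            gcongr
            · exact P.weight_le_one _ _
            · linarith
            · exact hf k
            · exact hg _
        _ = _ := by ring
  rw [zeroModeCorrection, tsum_eq_sum (s := {0, m})]
  · refine (norm_sum_le_of_le _ hterm).trans ?_
    rw [Finset.sum_const, nsmul_eq_mul]
    have hcard : ((({0, m} : Finset ℤ).card : ℕ) : ℝ) ≤ 2 := by exact_mod_cast Finset.card_le_two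
    split_ifs
    · calc _ ≤ 2 * (4 * (P.radius : ℝ) ^ 2 * (A * B)) := by gcongr
        _ = _ := by ring
    · rw [mul_zero]
  · intro k hk
    rw [Finset.mem_insert, Finset.mem_singleton, not_or] at hk
    rw [zeroModeError_eq_zero hk.1 (by omega)]
    simp

/-- This is the identity ∇X·ξ = -½∇(|∇X|²) in Fourier variables: up to the zero mode, (1/k + 1/l)
û(k) v̂(l) is k + l times the product of û(k)/k and v̂(l)/l, and k + l = m comes out of the sum as a
derivative. -/
lemma symProduct_coeff {u v : PeriodicDistribution} (hu : IsRough u.coeff) (hv : IsRough v.coeff)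
    (m : ℤ) : (symProduct P hu hv).coeff m = Complex.I / (4 * Real.pi) *
      (m * (ofKernel _ (P.diagBounded_weight (diagBounded_of_summable_sq hu.summable_reduced
        hv.summable_reduced))).coeff m +
        P.zeroModeCorrection (reduced u).coeff (reduced v).coeff m) := by
  have hd := P.diagBounded_weight
    (diagBounded_of_summable_sq hu.summable_reduced hv.summable_reduced)
  have hs := (diagBounded_symKernel P hu hv)
  obtain ⟨_, _, h1⟩ := hd
  have h1 := ((h1 m).1.of_norm).mul_left (m : ℂ)
  have key : ∀ k, symKernel P u.coeff v.coeff k (m - k) = Complex.I / (4 * Real.pi) *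
      ((m : ℂ) * ((P.weight k (m - k) : ℂ) * ((reduced u).coeff k * (reduced v).coeff (m - k))) +
        (P.weight k (m - k) : ℂ) * (zeroModeError k (m - k) : ℂ) *
          ((reduced u).coeff k * (reduced v).coeff (m - k))) := by
    intro k
    have hu' : u.coeff k = freq k * (reduced u).coeff k := by
      rw [reduced_coeff, ← mul_assoc, ← Complex.ofReal_mul, mul_inv_cancel₀ (freq_ne_zero k),
        Complex.ofReal_one, one_mul]
    have hv' : v.coeff (m - k) = freq (m - k) * (reduced v).coeff (m - k) := by
      rw [reduced_coeff, ← mul_assoc, ← Complex.ofReal_mul, mul_inv_cancel₀ (freq_ne_zero _),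
        Complex.ofReal_one, one_mul]
    rw [symKernel, hu', hv', zeroModeError]
    push_cast
    ring
  have h2 : Summable fun k => (P.weight k (m - k) : ℂ) * (zeroModeError k (m - k) : ℂ) *
      ((reduced u).coeff k * (reduced v).coeff (m - k)) := by
    refine summable_of_ne_finset_zero (s := {0, m}) fun k hk => ?_
    rw [Finset.mem_insert, Finset.mem_singleton, not_or] at hk
    rw [zeroModeError_eq_zero hk.1 (by omega)]
    simp
  show ∑' k, symKernel P u.coeff v.coeff k (m - k) = _
  simp only [key]
  rw [tsum_mul_left, h1.tsum_add h2, tsum_mul_left]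
  rfl

/-- Up to the factor 2πi, testing against the kernel evaluates ∇Δ_j w at x. -/
lemma pairing_kernelTest (w : PeriodicDistribution) (j : ℕ) (x : UnitAddCircle) :
    w.pairing (P.kernelTest j x) =
      ∑ m ∈ P.box j, (P.window j m : ℂ) * (m * w.coeff m) * fourier m x := by
  rw [pairing, tsum_eq_sum (s := P.box j)]
  · refine Finset.sum_congr rfl fun m _ => ?_
    rw [fourierCoeff_kernelTest]
    ring
  · intro m hm
    rw [fourierCoeff_kernelTest]
    by_contra h
    refine hm (P.mem_box_of_window_ne_zero le_rfl (j := j) fun h0 => h ?_)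
    rw [h0]
    simp

/-- The Littlewood-Paley blocks of the renormalized product of two distributions of regularity
`-1/2-`. -/
lemma exists_norm_block_symProduct_le {q σ : ℝ} (hq : 0 < q) (hq1 : q < 1) (hσ : 1 ≤ σ)
    (hσ2 : σ ≤ 2) (hqσ : q ^ 2 * σ < 1) : ∃ C : ℝ, 0 ≤ C ∧ ∀ (u v : PeriodicDistribution)
      (hu : IsRough u.coeff) (hv : IsRough v.coeff) (A B : ℝ), 0 ≤ A → 0 ≤ B →
      (∀ i x, ‖P.block i (reduced u) x‖ ≤ A * q ^ i) →
      (∀ i x, ‖P.block i (reduced v) x‖ ≤ B * q ^ i) →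
      ∀ j x, ‖P.block j (symProduct P hu hv) x‖ ≤ C * (A * B) * (2 / σ) ^ j := by
  obtain ⟨C, hC, h⟩ := P.exists_norm_pairing_kernelTest_le hq hq1.le hσ hqσ
  set D := Finset.Icc (-((2 * P.radius ^ 2 : ℕ) : ℤ)) (2 * P.radius ^ 2 : ℕ) with hD
  have hq' : 0 < 1 - q := by linarith
  refine ⟨C + D.card * (8 * P.radius ^ 2 * ((1 - q)⁻¹ * (1 - q)⁻¹)), by positivity,
    fun u v hu hv A B hA hB hbu hbv j x => ?_⟩
  have hd := diagBounded_of_summable_sq hu.summable_reduced hv.summable_reduced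
  have h1 := h _ _ _ A B hA hB hbu hbv (P.isResonantProduct_of_diagBounded hd) j x
  have h2 : P.block j (symProduct P hu hv) x = Complex.I / (4 * Real.pi) *
      ((ofKernel _ (P.diagBounded_weight hd)).pairing (P.kernelTest j x) +
        ∑ m ∈ P.box j, (P.window j m : ℂ) *
          P.zeroModeCorrection (reduced u).coeff (reduced v).coeff m * fourier m x) := by
    rw [block_eq_blockPoly, blockPoly, trigPoly_apply, pairing_kernelTest,
      ← Finset.sum_add_distrib, Finset.mul_sum]
    refine Finset.sum_congr rfl fun m _ => ?_
    rw [P.symProduct_coeff hu hv m]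
    ring
  have h3 : ‖∑ m ∈ P.box j, (P.window j m : ℂ) *
      P.zeroModeCorrection (reduced u).coeff (reduced v).coeff m * fourier m x‖ ≤
      D.card * (8 * P.radius ^ 2 * ((1 - q)⁻¹ * (1 - q)⁻¹)) * (A * B) := by
    have h4 : ∀ m ∈ P.box j, ‖(P.window j m : ℂ) *
        P.zeroModeCorrection (reduced u).coeff (reduced v).coeff m * fourier m x‖ ≤
        if m ∈ D then 8 * P.radius ^ 2 * ((A * (1 - q)⁻¹) * (B * (1 - q)⁻¹)) else 0 := by
      intro m _
      rw [norm_mul, norm_mul, norm_fourier_apply, mul_one, Complex.norm_real, Real.norm_eq_abs,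
        abs_of_nonneg (P.window_nonneg _ _)]
      exact (mul_le_of_le_one_left (norm_nonneg _) (P.window_le_one _ _)).trans
        (P.norm_zeroModeCorrection_le (P.norm_coeff_le_of_block_le hq.le hq1 hbu)
          (P.norm_coeff_le_of_block_le hq.le hq1 hbv) m)
    refine (norm_sum_le_of_le _ h4).trans ?_
    rw [← Finset.sum_filter, Finset.sum_const, nsmul_eq_mul]
    have hcard : (((P.box j).filter (· ∈ D)).card : ℝ) ≤ D.card := by
      exact_mod_cast Finset.card_le_card fun m hm => (Finset.mem_filter.1 hm).2
    calc _ ≤ (D.card : ℝ) * (8 * P.radius ^ 2 * ((A * (1 - q)⁻¹) * (B * (1 - q)⁻¹))) := by gcongr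
      _ = _ := by ring
  -- Since σ ≤ 2, the bounded contribution of the zero mode is absorbed into the growing factor.
  have h5 : (1 : ℝ) ≤ (2 / σ) ^ j := one_le_pow₀ ((one_le_div (by linarith)).2 hσ2)
  rw [h2, norm_mul]
  calc _ ≤ 1 * (C * (A * B) * (2 / σ) ^ j +
        D.card * (8 * P.radius ^ 2 * ((1 - q)⁻¹ * (1 - q)⁻¹)) * (A * B)) := by
        gcongr
        · exact norm_I_div_four_pi_le
        · exact (norm_add_le _ _).trans (add_le_add h1 h3)
    _ ≤ 1 * (C * (A * B) * (2 / σ) ^ j +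
        D.card * (8 * P.radius ^ 2 * ((1 - q)⁻¹ * (1 - q)⁻¹)) * (A * B) * (2 / σ) ^ j) := by
        have h6 : 0 ≤ D.card * (8 * P.radius ^ 2 * ((1 - q)⁻¹ * (1 - q)⁻¹)) * (A * B) := by
          positivity
        linarith [le_mul_of_one_le_right h6 h5]
    _ = _ := by ring

lemma holderNorm_le {γ σ D : ℝ} (hσ : 0 < σ) (hγ : (2 : ℝ) ^ γ * (2 / σ) ≤ 1) (hD : 0 ≤ D)
    {w : PeriodicDistribution} (h : ∀ j x, ‖P.block j w x‖ ≤ D * (2 / σ) ^ j) :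
    P.holderNorm γ w ≤ ENNReal.ofReal ((2 : ℝ) ^ (-γ) * D) := by
  refine iSup_le fun j => ?_
  have h1 : ⨆ x : UnitAddCircle, ‖P.block j w x‖ₑ ≤ ENNReal.ofReal (D * (2 / σ) ^ j) := by
    refine iSup_le fun x => ?_
    rw [← ofReal_norm]
    exact ENNReal.ofReal_le_ofReal (h j x)
  calc _ ≤ ENNReal.ofReal ((2 : ℝ) ^ (((j : ℝ) - 1) * γ)) * ENNReal.ofReal (D * (2 / σ) ^ j) := by
        gcongr
    _ = ENNReal.ofReal ((2 : ℝ) ^ (((j : ℝ) - 1) * γ) * (D * (2 / σ) ^ j)) :=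
        (ENNReal.ofReal_mul (by positivity)).symm
    _ ≤ _ := by
        refine ENNReal.ofReal_le_ofReal ?_
        -- The constant 2^{-γ} comes from the shift of the block index by one.
        have h2 : (2 : ℝ) ^ (((j : ℝ) - 1) * γ) = 2 ^ (-γ) * (2 ^ γ) ^ j := by
          rw [← Real.rpow_natCast, ← Real.rpow_mul (by norm_num), ← Real.rpow_add (by norm_num)]
          congr 1
          ring
        calc _ = (2 : ℝ) ^ (-γ) * D * ((2 : ℝ) ^ γ * (2 / σ)) ^ j := by rw [h2, mul_pow]; ring
          _ ≤ (2 : ℝ) ^ (-γ) * D :=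
            mul_le_of_le_one_right (by positivity) (pow_le_one₀ (by positivity) hγ)

end DyadicPartition

lemma IsRough.sub {u v : PeriodicDistribution} (hu : IsRough u.coeff) (hv : IsRough v.coeff) :
    IsRough (u - v).coeff := by
  refine ((hu.add hv).mul_left 2).of_nonneg_of_le (fun k => by positivity) fun k => ?_
  have hb := bracket_pos k
  have h : ‖(u - v).coeff k‖ / bracket k ≤ ‖u.coeff k‖ / bracket k + ‖v.coeff k‖ / bracket k := by
    rw [← add_div]
    gcongr
    exact norm_sub_le _ _
  calc _ ≤ (‖u.coeff k‖ / bracket k + ‖v.coeff k‖ / bracket k) ^ 2 := by gcongr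
    _ ≤ _ := by nlinarith [sq_nonneg (‖u.coeff k‖ / bracket k - ‖v.coeff k‖ / bracket k)]

/-- Bilinearity, in the form B(u,u) - B(v,v) = B(u-v,u) + B(v,u-v). -/
lemma symProduct_sub_coeff (P : DyadicPartition) {u v : PeriodicDistribution}
    (hu : IsRough u.coeff) (hv : IsRough v.coeff) (m : ℤ) :
    (symProduct P hu hu - symProduct P hv hv).coeff m =
      (symProduct P (hu.sub hv) hu).coeff m + (symProduct P hv (hu.sub hv)).coeff m := by
  have hs : ∀ {b d : ℤ → ℂ} (hb : IsRough b) (hd : IsRough d),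
      Summable fun k => symKernel P b d k (m - k) := by
    intro b d hb hd
    obtain ⟨_, _, h⟩ := diagBounded_symKernel P hb hd
    exact (h m).1.of_norm
  show (∑' k, symKernel P u.coeff u.coeff k (m - k)) - ∑' k, symKernel P v.coeff v.coeff k (m - k) =
    (∑' k, symKernel P (u - v).coeff u.coeff k (m - k)) +
      ∑' k, symKernel P v.coeff (u - v).coeff k (m - k)
  rw [← (hs hu hu).tsum_sub (hs hv hv), ← (hs (hu.sub hv) hu).tsum_add (hs hv (hu.sub hv))]
  refine tsum_congr fun k => ?_
  have h : ∀ l, (u - v).coeff l = u.coeff l - v.coeff l := fun l => rfl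
  simp only [symKernel, h]
  ring

lemma block_symProduct_sub (P : DyadicPartition) {u v : PeriodicDistribution}
    (hu : IsRough u.coeff) (hv : IsRough v.coeff) (j : ℕ) (x : UnitAddCircle) :
    P.block j (symProduct P hu hu - symProduct P hv hv) x =
      P.block j (symProduct P (hu.sub hv) hu) x + P.block j (symProduct P hv (hu.sub hv)) x := by
  simp only [DyadicPartition.block_eq_blockPoly, DyadicPartition.blockPoly, trigPoly_apply,
    ← Finset.sum_add_distrib]
  refine Finset.sum_congr rfl fun k _ => ?_
  rw [symProduct_sub_coeff]
  ring

/-- The renormalized square is a bounded and locally Lipschitz map from (blocks of size `q^i`,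
`q² > 1/2`) to the Hölder space of any exponent `γ < 0`. -/
lemma exists_holderNorm_symProduct_le (P : DyadicPartition) {γ : ℝ} (hγ : γ < 0) :
    ∃ q C : ℝ, 0 < q ∧ q < 1 ∧ 1 < 2 * q ^ 2 ∧ 0 ≤ C ∧
      (∀ (u : PeriodicDistribution) (hu : IsRough u.coeff) (A : ℝ), 0 ≤ A →
        (∀ i x, ‖P.block i (reduced u) x‖ ≤ A * q ^ i) →
        P.holderNorm γ (symProduct P hu hu) ≤ ENNReal.ofReal (C * (A * A))) ∧
      ∀ (u v : PeriodicDistribution) (hu : IsRough u.coeff) (hv : IsRough v.coeff) (A B D : ℝ),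
        0 ≤ A → 0 ≤ B → 0 ≤ D →
        (∀ i x, ‖P.block i (reduced u) x‖ ≤ A * q ^ i) →
        (∀ i x, ‖P.block i (reduced v) x‖ ≤ B * q ^ i) →
        (∀ i x, ‖P.block i (reduced (u - v)) x‖ ≤ D * q ^ i) →
        P.holderNorm γ (symProduct P hu hu - symProduct P hv hv) ≤
          ENNReal.ofReal (C * (D * A + B * D)) := by
  -- The Hölder norm requires σ ≥ 2^{1+γ}, and the block estimate requires σ ≥ 1. Both are
  -- compatible with σ < 2 because γ < 0.
  set σ : ℝ := max 1 (2 ^ (1 + γ)) with hσ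
  have hσ1 : 1 ≤ σ := le_max_left _ _
  have hσ2 : σ < 2 := max_lt (by norm_num) (by
    calc (2 : ℝ) ^ (1 + γ) < 2 ^ (1 : ℝ) := Real.rpow_lt_rpow_of_exponent_lt (by norm_num) (by linarith)
      _ = 2 := Real.rpow_one 2)
  have hγσ : (2 : ℝ) ^ γ * (2 / σ) ≤ 1 := by
    rw [mul_div_assoc', div_le_one (by linarith)]
    refine le_trans (le_of_eq ?_) (le_max_right _ _)
    rw [Real.rpow_add (by norm_num), Real.rpow_one, mul_comm]
  have hσinv : (1 / 2 : ℝ) < σ⁻¹ := by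
    rw [one_div]; exact inv_strictAnti₀ (by linarith) hσ2
  have hσinv1 : σ⁻¹ ≤ 1 := inv_le_one_of_one_le₀ hσ1
  -- The square q² is the midpoint of 1/2 and 1/σ. Being above 1/2 admits the blocks of white noise,
  -- and being below 1/σ makes the geometric series converge.
  set q : ℝ := Real.sqrt ((1 / 2 + σ⁻¹) / 2) with hq
  have hq2 : q ^ 2 = (1 / 2 + σ⁻¹) / 2 := Real.sq_sqrt (by linarith)
  have hq0 : 0 < q := Real.sqrt_pos.2 (by linarith)
  have hq1 : q < 1 := by
    rw [hq, Real.sqrt_lt' one_pos]; linarith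
  have hqσ : q ^ 2 * σ < 1 := by
    have : σ⁻¹ * σ = 1 := inv_mul_cancel₀ (by linarith)
    rw [hq2]
    nlinarith
  obtain ⟨C, hC, h⟩ := P.exists_norm_block_symProduct_le hq0 hq1 hσ1 hσ2.le hqσ
  refine ⟨q, 2 ^ (-γ) * C, hq0, hq1, by rw [hq2]; linarith, by positivity,
    fun u hu A hA hbu => ?_, fun u v hu hv A B D hA hB hD hbu hbv hbd => ?_⟩
  · refine (P.holderNorm_le (by linarith) hγσ (D := C * (A * A)) (by positivity)
      (h u u hu hu A A hA hA hbu hbu)).trans (le_of_eq ?_)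
    rw [mul_assoc]
  · refine (P.holderNorm_le (by linarith) hγσ (D := C * (D * A + B * D)) (by positivity)
      fun j x => ?_).trans (le_of_eq ?_)
    · rw [block_symProduct_sub]
      refine (norm_add_le _ _).trans ((add_le_add (h _ u (hu.sub hv) hu D A hD hA hbd hbu j x)
        (h v _ hv (hu.sub hv) B D hB hD hbv hbd j x)).trans (le_of_eq ?_))
      ring
    · rw [mul_assoc]

end TorusNoise
end

noncomputable section

namespace TorusNoise

/-! ### Gaussian moments -/

/-- The moment of order `2n` of the standard Gaussian. -/
def gaussMoment (n : ℕ) : ℝ≥0∞ := ∫⁻ x, ‖x‖ₑ ^ (2 * n) ∂gaussianReal 0 1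

lemma gaussMoment_lt_top (n : ℕ) : gaussMoment n < ∞ := by
  rcases Nat.eq_zero_or_pos n with rfl | hn
  · simp [gaussMoment]
  · have h := (memLp_id_gaussianReal' (μ := 0) (v := 1) ((2 * n : ℕ) : ℝ≥0∞)
      (ENNReal.natCast_ne_top _)).2
    have h' := lintegral_rpow_enorm_lt_top_of_eLpNorm_lt_top (by
      exact_mod_cast (by positivity : 2 * n ≠ 0)) (ENNReal.natCast_ne_top _) h
    simpa only [gaussMoment, ENNReal.toReal_natCast, ENNReal.rpow_natCast, id] using h'

lemma lintegral_enorm_pow_gaussianReal (v : NNReal) (n : ℕ) :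
    ∫⁻ x, ‖x‖ₑ ^ (2 * n) ∂gaussianReal 0 v = (v : ℝ≥0∞) ^ n * gaussMoment n := by
  have h : gaussianReal 0 v = (gaussianReal 0 1).map (Real.sqrt v * ·) := by
    rw [gaussianReal_map_const_mul]
    congr 1
    · simp
    · ext
      simp
  rw [h, lintegral_map (by fun_prop) (by fun_prop), gaussMoment,
    ← lintegral_const_mul _ (by fun_prop)]
  refine lintegral_congr fun x => ?_
  rw [enorm_mul, mul_pow, pow_mul]
  congr 2
  rw [Real.enorm_eq_ofReal (Real.sqrt_nonneg _), ← ENNReal.ofReal_pow (Real.sqrt_nonneg _),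
    Real.sq_sqrt v.coe_nonneg, ENNReal.ofReal_coe_nnreal]

lemma PeriodicDistribution.pairing_sum_fourier {ι : Type*} (u : PeriodicDistribution)
    (s : Finset ι) (c : ι → ℂ) (n : ι → ℤ) :
    u.pairing (fun x => ∑ i ∈ s, c i * fourier (n i) x) = ∑ i ∈ s, c i * u.coeff (-n i) := by
  have h : ∀ k, fourierCoeff (fun x : UnitAddCircle => ∑ i ∈ s, c i * fourier (n i) x) (-k) =
      ∑ i ∈ s, c i * if k = -n i then 1 else 0 := by
    intro k
    simp only [fourierCoeff_eq_integral, neg_neg, Finset.mul_sum]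
    rw [integral_finsetSum _ fun i _ => integrable_of_continuous_unitAddCircle (by fun_prop)]
    refine Finset.sum_congr rfl fun i _ => ?_
    have h1 : ∀ x : UnitAddCircle, fourier k x * (c i * fourier (n i) x) =
        c i * fourier (k + n i) x := fun x => by rw [fourier_add]; ring
    simp only [h1]
    rw [integral_const_mul, integral_fourier]
    simp only [eq_neg_iff_add_eq_zero]
  have hs : ∀ i ∈ s, Summable fun k => u.coeff k * (c i * if k = -n i then (1 : ℂ) else 0) := by
    intro i _
    refine summable_of_ne_finset_zero (s := {-n i}) fun k hk => ?_
    rw [if_neg (by simpa using hk), mul_zero, mul_zero]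
  simp only [pairing, h, Finset.mul_sum]
  rw [Summable.tsum_finsetSum hs]
  refine Finset.sum_congr rfl fun i _ => ?_
  rw [tsum_eq_single (-n i) fun k hk => by rw [if_neg hk, mul_zero, mul_zero], if_pos rfl]
  ring

namespace IsWhiteNoise

variable {Ω : Type*} [MeasurableSpace Ω] {μ : Measure Ω} {ξ : Ω → PeriodicDistribution}

/-- The definition of white noise only speaks of real test functions. By the reality condition, the
real part of a linear combination of coefficients is the pairing with a real trigonometric
polynomial. -/
lemma hasLaw_re (hξ : IsWhiteNoise ξ μ) (F : Finset ℤ) (c : ℤ → ℂ) :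
    HasLaw (fun ω => (∑ k ∈ F, c k * (ξ ω).coeff k).re)
      (gaussianReal 0 (Real.toNNReal (∫ x : UnitAddCircle, (trigPoly F c x).re ^ 2))) μ := by
  have hf : ∀ x : UnitAddCircle, trigPoly F c (-x) = ∑ k ∈ F, c k * fourier (-k) x := fun x => by
    rw [trigPoly_apply]
    simp only [fourier_apply, smul_neg, neg_smul]
  -- The reflection is needed because pairing with e^{2πinx} reads off the coefficient at -n; it
  -- does not change the L² norm.
  set φ : UnitAddCircle → ℝ := fun x => (trigPoly F c (-x)).re with hφ
  have hre : ∀ z : ℂ, ((z.re : ℝ) : ℂ) = z / 2 + starRingEnd ℂ z / 2 := fun z => by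
    rw [← add_div, Complex.add_conj]; push_cast; ring
  have hsum : (fun x => (φ x : ℂ)) = fun x => ∑ p ∈ (Finset.univ : Finset Bool) ×ˢ F,
      (if p.1 then c p.2 / 2 else starRingEnd ℂ (c p.2) / 2) *
        fourier (if p.1 then -p.2 else p.2) x := by
    funext x
    rw [Finset.sum_product, Fintype.sum_bool, hφ]
    simp only [if_true, if_false, Bool.false_eq_true]
    rw [hre, hf, map_sum, Finset.sum_div, Finset.sum_div]
    congr 1
    · exact Finset.sum_congr rfl fun k _ => by ring
    · refine Finset.sum_congr rfl fun k _ => ?_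
      rw [map_mul, fourier_neg, Complex.conj_conj]
      ring
  have htest : IsTestFunction fun x => (φ x : ℂ) := by
    rw [hsum]
    unfold IsTestFunction
    exact ContDiff.sum fun p _ => contDiff_const.mul (isTestFunction_fourier _)
  have h := hξ.law φ htest
  have hint : ∫ x : UnitAddCircle, φ x ^ 2 = ∫ x : UnitAddCircle, (trigPoly F c x).re ^ 2 :=
    integral_neg_eq_self (fun x : UnitAddCircle => (trigPoly F c x).re ^ 2) _
  rw [hint] at h
  convert h using 2 with ω
  rw [hsum, pairing_sum_fourier, Finset.sum_product, Fintype.sum_bool]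
  simp only [if_true, if_false, Bool.false_eq_true, neg_neg, hξ.real]
  have h2 : ∀ k, starRingEnd ℂ (c k) / 2 * starRingEnd ℂ ((ξ ω).coeff k) =
      starRingEnd ℂ (c k * (ξ ω).coeff k) / 2 := fun k => by rw [map_mul]; ring
  have h3 : ∀ k, c k / 2 * (ξ ω).coeff k = c k * (ξ ω).coeff k / 2 := fun k => by ring
  simp only [h2, h3]
  rw [← Finset.sum_div, ← Finset.sum_div, ← map_sum, ← hre, Complex.ofReal_re]

lemma hasLaw_im (hξ : IsWhiteNoise ξ μ) (F : Finset ℤ) (c : ℤ → ℂ) :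
    HasLaw (fun ω => (∑ k ∈ F, c k * (ξ ω).coeff k).im)
      (gaussianReal 0 (Real.toNNReal (∫ x : UnitAddCircle, (trigPoly F c x).im ^ 2))) μ := by
  have h := hξ.hasLaw_re F fun k => -Complex.I * c k
  have h1 : ∀ z : ℂ, (-Complex.I * z).re = z.im := fun z => by simp
  simpa only [trigPoly_apply, mul_assoc, ← Finset.mul_sum, h1] using h

lemma aemeasurable_sum (hξ : IsWhiteNoise ξ μ) (F : Finset ℤ) (c : ℤ → ℂ) :
    AEMeasurable (fun ω => ∑ k ∈ F, c k * (ξ ω).coeff k) μ := by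
  have h : (fun ω => ∑ k ∈ F, c k * (ξ ω).coeff k) = fun ω =>
      (((∑ k ∈ F, c k * (ξ ω).coeff k).re : ℝ) : ℂ) +
        (((∑ k ∈ F, c k * (ξ ω).coeff k).im : ℝ) : ℂ) * Complex.I := by
    funext ω
    rw [Complex.re_add_im]
  rw [h]
  exact (Complex.measurable_ofReal.comp_aemeasurable (hξ.hasLaw_re F c).aemeasurable).add
    ((Complex.measurable_ofReal.comp_aemeasurable (hξ.hasLaw_im F c).aemeasurable).mul_const _)

lemma aemeasurable_coeff (hξ : IsWhiteNoise ξ μ) (k : ℤ) :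
    AEMeasurable (fun ω => (ξ ω).coeff k) μ := by
  simpa using hξ.aemeasurable_sum {k} 1

lemma integral_re_sq_le (F : Finset ℤ) (c : ℤ → ℂ) :
    ∫ x : UnitAddCircle, (trigPoly F c x).re ^ 2 ≤ ∑ k ∈ F, ‖c k‖ ^ 2 := by
  rw [← integral_norm_sq_trigPoly]
  refine integral_mono (integrable_of_continuous_unitAddCircle (by fun_prop))
    (integrable_of_continuous_unitAddCircle (by fun_prop)) fun x => ?_
  show (trigPoly F c x).re ^ 2 ≤ ‖trigPoly F c x‖ ^ 2
  rw [← sq_abs]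
  gcongr
  exact Complex.abs_re_le_norm _

lemma integral_im_sq_le (F : Finset ℤ) (c : ℤ → ℂ) :
    ∫ x : UnitAddCircle, (trigPoly F c x).im ^ 2 ≤ ∑ k ∈ F, ‖c k‖ ^ 2 := by
  rw [← integral_norm_sq_trigPoly]
  refine integral_mono (integrable_of_continuous_unitAddCircle (by fun_prop))
    (integrable_of_continuous_unitAddCircle (by fun_prop)) fun x => ?_
  show (trigPoly F c x).im ^ 2 ≤ ‖trigPoly F c x‖ ^ 2
  rw [← sq_abs]
  gcongr
  exact Complex.abs_im_le_norm _

/-- Moments of the first chaos. -/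
lemma lintegral_enorm_pow_le (hξ : IsWhiteNoise ξ μ) (F : Finset ℤ) (c : ℤ → ℂ) (n : ℕ) :
    ∫⁻ ω, ‖∑ k ∈ F, c k * (ξ ω).coeff k‖ₑ ^ (2 * n) ∂μ ≤
      2 ^ (2 * n + 1) * gaussMoment n * ENNReal.ofReal (∑ k ∈ F, ‖c k‖ ^ 2) ^ n := by
  have hre := hξ.hasLaw_re F c
  have him := hξ.hasLaw_im F c
  have h1 : ∀ z : ℂ, ‖z‖ₑ ^ (2 * n) ≤ 2 ^ (2 * n) * (‖z.re‖ₑ ^ (2 * n) + ‖z.im‖ₑ ^ (2 * n)) := by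
    intro z
    have h2 : ‖z‖ₑ ≤ 2 * max ‖z.re‖ₑ ‖z.im‖ₑ := by
      calc ‖z‖ₑ = ‖(z.re : ℂ) + z.im * Complex.I‖ₑ := by rw [Complex.re_add_im]
        _ ≤ ‖(z.re : ℂ)‖ₑ + ‖(z.im : ℂ) * Complex.I‖ₑ := enorm_add_le _ _
        _ = ‖z.re‖ₑ + ‖z.im‖ₑ := by simp [← ofReal_norm]
        _ ≤ max ‖z.re‖ₑ ‖z.im‖ₑ + max ‖z.re‖ₑ ‖z.im‖ₑ :=
            add_le_add (le_max_left _ _) (le_max_right _ _)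
        _ = _ := (two_mul _).symm
    refine (pow_le_pow_left' h2 _).trans ?_
    rw [mul_pow]
    gcongr
    rcases max_choice ‖z.re‖ₑ ‖z.im‖ₑ with h | h <;> rw [h]
    · exact le_self_add
    · exact le_add_self
  have h3 : ∫⁻ ω, ‖(∑ k ∈ F, c k * (ξ ω).coeff k).re‖ₑ ^ (2 * n) ∂μ ≤
      ENNReal.ofReal (∑ k ∈ F, ‖c k‖ ^ 2) ^ n * gaussMoment n := by
    rw [hre.lintegral_comp (f := fun x : ℝ => ‖x‖ₑ ^ (2 * n)) (by fun_prop),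
      lintegral_enorm_pow_gaussianReal]
    gcongr
    exact ENNReal.ofReal_le_ofReal (integral_re_sq_le F c)
  have h4 : ∫⁻ ω, ‖(∑ k ∈ F, c k * (ξ ω).coeff k).im‖ₑ ^ (2 * n) ∂μ ≤
      ENNReal.ofReal (∑ k ∈ F, ‖c k‖ ^ 2) ^ n * gaussMoment n := by
    rw [him.lintegral_comp (f := fun x : ℝ => ‖x‖ₑ ^ (2 * n)) (by fun_prop),
      lintegral_enorm_pow_gaussianReal]
    gcongr
    exact ENNReal.ofReal_le_ofReal (integral_im_sq_le F c)
  calc _ ≤ ∫⁻ ω, 2 ^ (2 * n) * (‖(∑ k ∈ F, c k * (ξ ω).coeff k).re‖ₑ ^ (2 * n) +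
        ‖(∑ k ∈ F, c k * (ξ ω).coeff k).im‖ₑ ^ (2 * n)) ∂μ := lintegral_mono fun ω => h1 _
    _ = 2 ^ (2 * n) * (∫⁻ ω, ‖(∑ k ∈ F, c k * (ξ ω).coeff k).re‖ₑ ^ (2 * n) ∂μ +
        ∫⁻ ω, ‖(∑ k ∈ F, c k * (ξ ω).coeff k).im‖ₑ ^ (2 * n) ∂μ) := by
        rw [lintegral_const_mul' _ _ (by finiteness),
          lintegral_add_left' (hre.aemeasurable.enorm.pow_const _)]
    _ ≤ 2 ^ (2 * n) * (ENNReal.ofReal (∑ k ∈ F, ‖c k‖ ^ 2) ^ n * gaussMoment n +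
        ENNReal.ofReal (∑ k ∈ F, ‖c k‖ ^ 2) ^ n * gaussMoment n) := by gcongr
    _ = _ := by rw [← two_mul, pow_succ]; ring

lemma integral_sq_gaussianReal (v : NNReal) : ∫ x, x ^ 2 ∂gaussianReal 0 v = v := by
  have h := variance_id_gaussianReal (μ := 0) (v := v)
  rw [variance_eq_sub (memLp_id_gaussianReal' 2 (by simp))] at h
  simpa using h

lemma memLp_sum (hξ : IsWhiteNoise ξ μ) (F : Finset ℤ) (c : ℤ → ℂ) :
    MemLp (fun ω => ∑ k ∈ F, c k * (ξ ω).coeff k) 2 μ := by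
  refine ⟨(hξ.aemeasurable_sum F c).aestronglyMeasurable, ?_⟩
  rw [eLpNorm_lt_top_iff_lintegral_rpow_enorm_lt_top (by norm_num) (by norm_num)]
  have h := hξ.lintegral_enorm_pow_le F c 1
  have h2 := gaussMoment_lt_top 1
  simp only [mul_one, pow_one] at h
  refine lt_of_le_of_lt (le_of_eq ?_) (h.trans_lt (by finiteness))
  simp

lemma memLp_coeff (hξ : IsWhiteNoise ξ μ) (k : ℤ) : MemLp (fun ω => (ξ ω).coeff k) 2 μ := by
  simpa using hξ.memLp_sum {k} 1

/-- The isometry property of white noise. -/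
lemma integral_norm_sq_sum (hξ : IsWhiteNoise ξ μ) (F : Finset ℤ) (c : ℤ → ℂ) :
    ∫ ω, ‖∑ k ∈ F, c k * (ξ ω).coeff k‖ ^ 2 ∂μ = ∑ k ∈ F, ‖c k‖ ^ 2 := by
  have hre := hξ.hasLaw_re F c
  have him := hξ.hasLaw_im F c
  have hsq : ∀ z : ℂ, ‖z‖ ^ 2 = z.re ^ 2 + z.im ^ 2 := fun z => by
    rw [← Complex.normSq_eq_norm_sq, Complex.normSq_apply]; ring
  have hm := hξ.memLp_sum F c
  have h1 : ∫ ω, (∑ k ∈ F, c k * (ξ ω).coeff k).re ^ 2 ∂μ =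
      ∫ x : UnitAddCircle, (trigPoly F c x).re ^ 2 := by
    have := hre.integral_comp (f := fun x : ℝ => x ^ 2) (by fun_prop)
    rw [integral_sq_gaussianReal, Real.coe_toNNReal _ (integral_nonneg fun _ => sq_nonneg _)] at this
    exact this
  have h2 : ∫ ω, (∑ k ∈ F, c k * (ξ ω).coeff k).im ^ 2 ∂μ =
      ∫ x : UnitAddCircle, (trigPoly F c x).im ^ 2 := by
    have := him.integral_comp (f := fun x : ℝ => x ^ 2) (by fun_prop)
    rw [integral_sq_gaussianReal, Real.coe_toNNReal _ (integral_nonneg fun _ => sq_nonneg _)] at this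
    exact this
  rw [← integral_norm_sq_trigPoly]
  simp only [hsq]
  have hr : Integrable (fun ω => (∑ k ∈ F, c k * (ξ ω).coeff k).re ^ 2) μ := hm.re.integrable_sq
  have hi : Integrable (fun ω => (∑ k ∈ F, c k * (ξ ω).coeff k).im ^ 2) μ := hm.im.integrable_sq
  rw [integral_add hr hi,
    integral_add (integrable_of_continuous_unitAddCircle (by fun_prop))
      (integrable_of_continuous_unitAddCircle (by fun_prop)), ← h1, ← h2]

lemma integral_norm_sq_coeff (hξ : IsWhiteNoise ξ μ) (k : ℤ) :
    ∫ ω, ‖(ξ ω).coeff k‖ ^ 2 ∂μ = 1 := by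
  simpa using hξ.integral_norm_sq_sum {k} 1

lemma integrable_coeff_mul (hξ : IsWhiteNoise ξ μ) (k l : ℤ) :
    Integrable (fun ω => (ξ ω).coeff k * (ξ ω).coeff l) μ :=
  (hξ.memLp_coeff k).integrable_mul (hξ.memLp_coeff l)

lemma integral_norm_coeff_mul_le (hξ : IsWhiteNoise ξ μ) (k l : ℤ) :
    ∫ ω, ‖(ξ ω).coeff k * (ξ ω).coeff l‖ ∂μ ≤ 1 := by
  have hk := (hξ.memLp_coeff k).norm.integrable_sq
  have hl := (hξ.memLp_coeff l).norm.integrable_sq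
  calc ∫ ω, ‖(ξ ω).coeff k * (ξ ω).coeff l‖ ∂μ
      ≤ ∫ ω, (1 / 2 * ‖(ξ ω).coeff k‖ ^ 2 + 1 / 2 * ‖(ξ ω).coeff l‖ ^ 2) ∂μ := by
        refine integral_mono (hξ.integrable_coeff_mul k l).norm
          ((hk.const_mul _).add (hl.const_mul _)) fun ω => ?_
        show ‖(ξ ω).coeff k * (ξ ω).coeff l‖ ≤ _
        rw [norm_mul]
        nlinarith [sq_nonneg (‖(ξ ω).coeff k‖ - ‖(ξ ω).coeff l‖)]
    _ = 1 := by
        rw [integral_add (hk.const_mul _) (hl.const_mul _), integral_const_mul, integral_const_mul,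
          hξ.integral_norm_sq_coeff, hξ.integral_norm_sq_coeff]
        norm_num

/-- Polarization of the isometry: E|ξ̂(k) + z ξ̂(l)|² = 2 for |z| = 1. The choices z = 1 and z = i
annihilate the real and the imaginary part of the covariance. -/
lemma integral_coeff_mul_conj (hξ : IsWhiteNoise ξ μ) {k l : ℤ} (hkl : k ≠ l) :
    ∫ ω, (ξ ω).coeff k * starRingEnd ℂ ((ξ ω).coeff l) ∂μ = 0 := by
  have hint : Integrable (fun ω => (ξ ω).coeff k * starRingEnd ℂ ((ξ ω).coeff l)) μ := by
    simpa only [hξ.real] using hξ.integrable_coeff_mul k (-l)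
  have hk := (hξ.memLp_coeff k).norm.integrable_sq
  have hl := (hξ.memLp_coeff l).norm.integrable_sq
  have key : ∀ z : ℂ, ‖z‖ = 1 →
      (starRingEnd ℂ z * ∫ ω, (ξ ω).coeff k * starRingEnd ℂ ((ξ ω).coeff l) ∂μ).re = 0 := by
    intro z hz
    have h1 := hξ.integral_norm_sq_sum {k, l} fun q => if q = k then 1 else z
    rw [Finset.sum_pair hkl, if_pos rfl, if_neg hkl.symm, norm_one, hz] at h1
    simp only [Finset.sum_pair hkl, if_pos, if_neg hkl.symm, one_mul] at h1
    have h2 : ∀ ω, ‖(ξ ω).coeff k + z * (ξ ω).coeff l‖ ^ 2 = ‖(ξ ω).coeff k‖ ^ 2 +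
        ‖(ξ ω).coeff l‖ ^ 2 +
        2 * (starRingEnd ℂ z * ((ξ ω).coeff k * starRingEnd ℂ ((ξ ω).coeff l))).re := by
      intro ω
      rw [← Complex.normSq_eq_norm_sq, Complex.normSq_add, Complex.normSq_mul,
        Complex.normSq_eq_norm_sq, Complex.normSq_eq_norm_sq, Complex.normSq_eq_norm_sq, hz,
        map_mul]
      ring_nf
    simp only [h2] at h1
    have hint2 := hint.const_mul (starRingEnd ℂ z)
    have hre : Integrable (fun ω => 2 *
        (starRingEnd ℂ z * ((ξ ω).coeff k * starRingEnd ℂ ((ξ ω).coeff l))).re) μ :=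
      hint2.re.const_mul 2
    have hadd : Integrable (fun ω => ‖(ξ ω).coeff k‖ ^ 2 + ‖(ξ ω).coeff l‖ ^ 2) μ := hk.add hl
    rw [integral_add hadd hre, integral_add hk hl, hξ.integral_norm_sq_coeff, hξ.integral_norm_sq_coeff, integral_const_mul] at h1
    have h3 := integral_re hint2
    rw [integral_const_mul] at h3
    have h4 : ∫ ω, (starRingEnd ℂ z * ((ξ ω).coeff k * starRingEnd ℂ ((ξ ω).coeff l))).re ∂μ =
      (starRingEnd ℂ z * ∫ ω, (ξ ω).coeff k * starRingEnd ℂ ((ξ ω).coeff l) ∂μ).re := h3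
    rw [← h4]
    linarith
  apply Complex.ext
  · simpa using key 1 (by simp)
  · simpa using key Complex.I (by simp)

/-- The covariance of white noise. -/
lemma integral_coeff_mul (hξ : IsWhiteNoise ξ μ) (k l : ℤ) :
    ∫ ω, (ξ ω).coeff k * (ξ ω).coeff l ∂μ = if k + l = 0 then 1 else 0 := by
  have h1 : ∀ ω, (ξ ω).coeff l = starRingEnd ℂ ((ξ ω).coeff (-l)) := fun ω => by
    rw [← hξ.real, neg_neg]
  simp only [h1]
  split_ifs with h
  · have hk : k = -l := by omega
    subst hk
    simp only [Complex.mul_conj']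
    have h2 := hξ.integral_norm_sq_coeff (-l)
    rw [← Complex.ofReal_one, ← h2, ← integral_complex_ofReal]
    push_cast
    rfl
  · exact hξ.integral_coeff_mul_conj (by omega)

end IsWhiteNoise

end TorusNoise
end

/-! ### Means in the second chaos, almost sure roughness, and measurability -/

noncomputable section

namespace TorusNoise

lemma isRough_of_bounded {b : ℤ → ℂ} {H : ℝ} (hb : ∀ k, ‖b k‖ ≤ H) : IsRough b := by
  refine Summable.of_nonneg_of_le (fun k => sq_nonneg _) (fun k => ?_)
    (summable_bracket_inv_sq.mul_left (H ^ 2))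
  have hk := bracket_pos k
  rw [div_pow, div_eq_mul_inv]
  gcongr
  exact hb k

/-- The only frequencies seen by the expectation cancel exactly; this is why no counterterm appears.
-/
lemma symKernel_neg_right (P : DyadicPartition) (b d : ℤ → ℂ) (k : ℤ) :
    symKernel P b d k (-k) = 0 := by
  simp [symKernel, inv_neg]

namespace IsWhiteNoise

variable {Ω : Type*} [MeasurableSpace Ω] {μ : Measure Ω} {ξ : Ω → PeriodicDistribution}

/-- Absolutely convergent series in the second chaos. -/
lemma integral_tsum_coeff_mul (hξ : IsWhiteNoise ξ μ) {κ : ℤ × ℤ → ℂ}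
    (hκ : Summable fun p => ‖κ p‖) :
    (∀ᵐ ω ∂μ, Summable fun p : ℤ × ℤ => ‖κ p * ((ξ ω).coeff p.1 * (ξ ω).coeff p.2)‖) ∧
      Integrable (fun ω => ∑' p : ℤ × ℤ, κ p * ((ξ ω).coeff p.1 * (ξ ω).coeff p.2)) μ ∧
      ((∀ k, κ (k, -k) + κ (-k, k) = 0) →
        ∫ ω, ∑' p : ℤ × ℤ, κ p * ((ξ ω).coeff p.1 * (ξ ω).coeff p.2) ∂μ = 0) := by
  have hF : ∀ p : ℤ × ℤ, Integrable (fun ω => κ p * ((ξ ω).coeff p.1 * (ξ ω).coeff p.2)) μ :=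
    fun p => (hξ.integrable_coeff_mul p.1 p.2).const_mul _
  have hs : Summable fun p : ℤ × ℤ =>
      ∫ ω, ‖κ p * ((ξ ω).coeff p.1 * (ξ ω).coeff p.2)‖ ∂μ := by
    refine Summable.of_nonneg_of_le (fun p => integral_nonneg fun _ => norm_nonneg _)
      (fun p => ?_) hκ
    simp only [norm_mul (κ p)]
    rw [integral_const_mul]
    exact mul_le_of_le_one_right (norm_nonneg _) (hξ.integral_norm_coeff_mul_le p.1 p.2)
  obtain ⟨h1, h2⟩ := integrable_tsum_of_summable_integral_norm hF hs
  refine ⟨h1, h2, fun hanti => ?_⟩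
  rw [← integral_tsum_of_summable_integral_norm hF hs]
  simp only [integral_const_mul, hξ.integral_coeff_mul]
  -- After taking expectations only k + l = 0 remains. There the swap changes the sign of the
  -- summand, so the sum equals its own negative.
  have h3 := (Equiv.prodComm ℤ ℤ).tsum_eq fun p : ℤ × ℤ =>
    κ p * if p.1 + p.2 = 0 then (1 : ℂ) else 0
  have h4 : ∀ p : ℤ × ℤ, (κ (Equiv.prodComm ℤ ℤ p) *
      if (Equiv.prodComm ℤ ℤ p).1 + (Equiv.prodComm ℤ ℤ p).2 = 0 then (1 : ℂ) else 0) =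
      -(κ p * if p.1 + p.2 = 0 then (1 : ℂ) else 0) := by
    rintro ⟨k, l⟩
    show (κ (l, k) * if l + k = 0 then (1 : ℂ) else 0) = -(κ (k, l) * if k + l = 0 then 1 else 0)
    rw [add_comm l k]
    split_ifs with h
    · obtain rfl : l = -k := by omega
      rw [mul_one, mul_one]
      exact eq_neg_of_add_eq_zero_right (hanti k)
    · simp
  simp only [h4, tsum_neg] at h3
  exact self_eq_neg.1 h3.symm

variable {η : Ω → PeriodicDistribution} {h : ℤ → ℂ} {H : ℝ}

/-- Almost surely, a filtered white noise is (barely) rougher than `H^{-1/2}`. -/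
lemma ae_isRough (hξ : IsWhiteNoise ξ μ) (hη : ∀ ω k, (η ω).coeff k = h k * (ξ ω).coeff k)
    (hH : ∀ k, ‖h k‖ ≤ H) : ∀ᵐ ω ∂μ, IsRough (η ω).coeff := by
  have hF : ∀ k : ℤ, Integrable (fun ω => (((‖(ξ ω).coeff k‖ / bracket k) ^ 2 : ℝ) : ℂ)) μ := by
    intro k
    simp only [div_pow]
    exact ((hξ.memLp_coeff k).norm.integrable_sq.div_const _).ofReal
  have hs : Summable fun k : ℤ => ∫ ω, ‖(((‖(ξ ω).coeff k‖ / bracket k) ^ 2 : ℝ) : ℂ)‖ ∂μ := by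
    refine summable_bracket_inv_sq.congr fun k => ?_
    have h1 : ∀ ω, ‖(((‖(ξ ω).coeff k‖ / bracket k) ^ 2 : ℝ) : ℂ)‖ =
        (bracket k ^ 2)⁻¹ * ‖(ξ ω).coeff k‖ ^ 2 := fun ω => by
      rw [Complex.norm_real, Real.norm_eq_abs, abs_of_nonneg (sq_nonneg _), div_pow]
      ring
    simp only [h1]
    rw [integral_const_mul, hξ.integral_norm_sq_coeff, mul_one]
  filter_upwards [(integrable_tsum_of_summable_integral_norm hF hs).1] with ω hω
  refine Summable.of_nonneg_of_le (fun k => sq_nonneg _) (fun k => ?_) (hω.mul_left (H ^ 2))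
  have hk := bracket_pos k
  rw [Complex.norm_real, Real.norm_eq_abs, abs_of_nonneg (sq_nonneg _), hη, norm_mul, mul_div_assoc,
    mul_pow]
  gcongr
  exact hH k

/-- The renormalized square of a filtered white noise has mean zero. -/
lemma integral_pairing_symProduct (P : DyadicPartition) (hξ : IsWhiteNoise ξ μ)
    (hη : ∀ ω k, (η ω).coeff k = h k * (ξ ω).coeff k) (hH : ∀ k, ‖h k‖ ≤ H)
    {w : Ω → PeriodicDistribution}
    (hw : ∀ᵐ ω ∂μ, ∃ hr : IsRough (η ω).coeff, w ω = symProduct P hr hr)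
    {φ : UnitAddCircle → ℂ} (hφ : IsTestFunction φ) :
    Integrable (fun ω => (w ω).pairing φ) μ ∧ ∫ ω, (w ω).pairing φ ∂μ = 0 := by
  -- The deterministic symbol is itself a rough sequence, so its symmetrized kernel tested against
  -- `φ` is absolutely summable.
  have hh := isRough_of_bounded hH
  obtain ⟨-, h1, h2⟩ := hξ.integral_tsum_coeff_mul
    (κ := fun p => symKernel P h h p.1 p.2 * fourierCoeff φ (-(p.1 + p.2)))
    (((diagBounded_symKernel P hh hh).summable hφ).congr fun p => (norm_mul _ _).symm)
  have h3 : (fun ω => (w ω).pairing φ) =ᵐ[μ] fun ω => ∑' p : ℤ × ℤ,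
      symKernel P h h p.1 p.2 * fourierCoeff φ (-(p.1 + p.2)) *
        ((ξ ω).coeff p.1 * (ξ ω).coeff p.2) := by
    filter_upwards [hw] with ω ⟨hr, hω⟩
    rw [hω, symProduct, ofKernel_pairing _ hφ]
    refine tsum_congr fun p => ?_
    simp only [symKernel, hη]
    ring
  refine ⟨h1.congr h3.symm, ?_⟩
  rw [integral_congr_ae h3]
  refine h2 fun k => ?_
  have h4 := symKernel_neg_right P h h (-k)
  rw [neg_neg] at h4
  simp only [symKernel_neg_right, h4, zero_mul, add_zero]

/-- A coefficient is the pairing with a character, so its measurability is part of the integrability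
of pairings. -/
lemma aemeasurable_coeff_symProduct (P : DyadicPartition) (hξ : IsWhiteNoise ξ μ)
    (hη : ∀ ω k, (η ω).coeff k = h k * (ξ ω).coeff k) (hH : ∀ k, ‖h k‖ ≤ H)
    {w : Ω → PeriodicDistribution}
    (hw : ∀ᵐ ω ∂μ, ∃ hr : IsRough (η ω).coeff, w ω = symProduct P hr hr) (k : ℤ) :
    AEMeasurable (fun ω => (w ω).coeff k) μ := by
  have := (hξ.integral_pairing_symProduct P hη hH hw (isTestFunction_fourier (-k))).1.aemeasurable
  simpa only [pairing_fourier, neg_neg] using this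

end IsWhiteNoise

/-! ### Measurability of the Hölder norm -/

lemma iSup_enorm_eq_iSup_denseSeq {f : UnitAddCircle → ℂ} (hf : Continuous f) :
    ⨆ x, ‖f x‖ₑ = ⨆ n, ‖f (TopologicalSpace.denseSeq UnitAddCircle n)‖ₑ := by
  refine le_antisymm (iSup_le fun x => ?_) (iSup_le fun n => le_iSup (fun x => ‖f x‖ₑ) _)
  have hc : IsClosed {x | ‖f x‖ₑ ≤ ⨆ n, ‖f (TopologicalSpace.denseSeq UnitAddCircle n)‖ₑ} :=
    isClosed_le hf.enorm continuous_const
  have hd := (TopologicalSpace.denseRange_denseSeq UnitAddCircle) x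
  refine closure_minimal ?_ hc hd
  rintro _ ⟨n, rfl⟩
  exact le_iSup (fun n => ‖f (TopologicalSpace.denseSeq UnitAddCircle n)‖ₑ) n

/-- Blocks are trigonometric polynomials, so their suprema may be taken over a countable dense set
of points. -/
lemma aemeasurable_holderNorm {Ω : Type*} [MeasurableSpace Ω] {μ : Measure Ω}
    (P : DyadicPartition) (γ : ℝ) {w : Ω → PeriodicDistribution}
    (hw : ∀ k, AEMeasurable (fun ω => (w ω).coeff k) μ) :
    AEMeasurable (fun ω => P.holderNorm γ (w ω)) μ := by
  unfold DyadicPartition.holderNorm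
  refine AEMeasurable.iSup fun j => AEMeasurable.const_mul ?_ _
  have h1 : ∀ ω, ⨆ x, ‖P.block j (w ω) x‖ₑ =
      ⨆ n, ‖P.block j (w ω) (TopologicalSpace.denseSeq UnitAddCircle n)‖ₑ := fun ω =>
    iSup_enorm_eq_iSup_denseSeq (f := P.block j (w ω)) (by
      rw [show P.block j (w ω) = P.blockPoly j (w ω).coeff from funext (P.block_eq_blockPoly j _)]
      exact map_continuous _)
  simp only [h1]
  refine AEMeasurable.iSup fun n => AEMeasurable.enorm ?_
  simp only [P.block_eq_blockPoly, DyadicPartition.blockPoly, trigPoly_apply]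
  exact Finset.aemeasurable_fun_sum _ fun k _ => ((hw k).const_mul _).mul_const _

end TorusNoise
end

noncomputable section

namespace TorusNoise

/-! ### Moments of the Littlewood-Paley blocks of white noise -/

namespace DyadicPartition

variable (P : DyadicPartition)

/-- The weight of the `i`-th block in `blockMoment`: the factor `q^{-2ni}` times the constant of
Nikolskii's inequality. -/
def blockConst (q : ℝ) (n i : ℕ) : ℝ := (q ^ (2 * n * i))⁻¹ * (2 * (n * (P.radius * 2 ^ i) : ℕ) + 1)

lemma blockConst_pos {q : ℝ} (hq : 0 < q) (n i : ℕ) : 0 < P.blockConst q n i := by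
  unfold blockConst
  positivity

/-- A weighted `ℓ^{2n} L^{2n}` norm of the Littlewood-Paley blocks of `reduced u`. -/
def blockMoment (q : ℝ) (n : ℕ) (u : PeriodicDistribution) : ℝ≥0∞ :=
  ∑' i : ℕ, ENNReal.ofReal (P.blockConst q n i) *
    ∫⁻ x : UnitAddCircle, ‖P.block i (reduced u) x‖ₑ ^ (2 * n)

/-- Nikolskii's inequality on each block. The weights of `blockMoment` already contain its constant
and the factor q^{-2ni}, so a single term of the series bounds the sup norm. -/
lemma norm_block_reduced_le {q : ℝ} (hq : 0 < q) {n : ℕ} (hn : n ≠ 0) {u : PeriodicDistribution}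
    (hu : P.blockMoment q n u ≠ ∞) (i : ℕ) (x : UnitAddCircle) :
    ‖P.block i (reduced u) x‖ ≤
      (P.blockMoment q n u).toReal ^ ((2 * n : ℕ) : ℝ)⁻¹ * q ^ i := by
  have hcont : Continuous fun x => ‖P.blockPoly i (reduced u).coeff x‖ ^ (2 * n) := by fun_prop
  have h1 : ENNReal.ofReal (P.blockConst q n i *
      ∫ x : UnitAddCircle, ‖P.blockPoly i (reduced u).coeff x‖ ^ (2 * n)) ≤ P.blockMoment q n u := by
    refine le_trans (le_of_eq ?_) (ENNReal.le_tsum i)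
    rw [ENNReal.ofReal_mul (P.blockConst_pos hq n i).le, ofReal_integral_eq_lintegral_ofReal
      (integrable_of_continuous_unitAddCircle hcont)
      (Eventually.of_forall fun x => by positivity)]
    congr 1
    refine lintegral_congr fun x => ?_
    rw [block_eq_blockPoly, ENNReal.ofReal_pow (norm_nonneg _), ofReal_norm]
  have h2 := (ENNReal.ofReal_le_iff_le_toReal hu).1 h1
  have hN : 0 ≤ (P.blockMoment q n u).toReal := ENNReal.toReal_nonneg
  have h3 : ‖P.block i (reduced u) x‖ ^ (2 * n) ≤
      (P.blockMoment q n u).toReal * (q ^ i) ^ (2 * n) := by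
    rw [block_eq_blockPoly]
    refine (norm_pow_trigPoly_le (P.radius * 2 ^ i) _ n x).trans ?_
    have h4 := mul_le_mul_of_nonneg_right h2 (by positivity : 0 ≤ (q ^ i) ^ (2 * n))
    refine le_trans (le_of_eq ?_) h4
    have hqi : (q ^ i) ^ (2 * n) = q ^ (2 * n * i) := by rw [← pow_mul, mul_comm]
    have hq0 : q ^ (2 * n * i) ≠ 0 := by positivity
    have hcancel : ∀ Q a b : ℝ, Q ≠ 0 → a * b = Q⁻¹ * a * b * Q := fun Q a b hQ => by field_simp
    rw [hqi]
    exact hcancel _ _ _ hq0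
  refine (pow_le_pow_iff_left₀ (norm_nonneg _) (by positivity) (by omega : 2 * n ≠ 0)).1 ?_
  rw [mul_pow, Real.rpow_inv_natCast_pow hN (by omega)]
  exact h3

/-- The variance of the `i`-th block of the reduction of a filtered white noise. -/
def blockVariance (h : ℤ → ℂ) (i : ℕ) : ℝ :=
  ∑ k ∈ P.box i, (P.window i k / bracket k) ^ 2 * ‖h k‖ ^ 2

lemma blockVariance_nonneg (h : ℤ → ℂ) (i : ℕ) : 0 ≤ P.blockVariance h i :=
  Finset.sum_nonneg fun k _ => by positivity

/-- Of order 2^i frequencies contribute, each with a weight of order 2^{-2i}. -/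
lemma blockVariance_le {h : ℤ → ℂ} {H : ℝ} (hH : ∀ k, ‖h k‖ ≤ H) (i : ℕ) :
    P.blockVariance h i ≤ 3 * P.radius ^ 3 * H ^ 2 * (1 / 2) ^ i := by
  have hR := P.one_le_radius'
  have hterm : ∀ k ∈ P.box i, (P.window i k / bracket k) ^ 2 * ‖h k‖ ^ 2 ≤
      (P.radius / 2 ^ i) ^ 2 * H ^ 2 := by
    intro k _
    have hk := bracket_pos k
    have h1 : P.window i k / bracket k ≤ P.radius / 2 ^ i := by
      by_cases hw : P.window i k = 0
      · rw [hw, zero_div]; positivity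
      · rw [div_le_div_iff₀ hk (by positivity)]
        calc P.window i k * 2 ^ i ≤ 1 * 2 ^ i := by
              gcongr; exact P.window_le_one i k
          _ ≤ _ := by rw [one_mul]; exact P.two_pow_le_of_window_ne_zero hw
    have h0 : 0 ≤ P.window i k / bracket k := div_nonneg (P.window_nonneg i k) hk.le
    gcongr
    exact hH k
  have hcard : ((P.box i).card : ℝ) ≤ 3 * P.radius * 2 ^ i := by
    have h1 : (P.box i).card = 2 * (P.radius * 2 ^ i) + 1 := by
      rw [box, Int.card_Icc]; omega
    rw [h1]
    push_cast
    have : (1 : ℝ) ≤ P.radius * 2 ^ i := one_le_mul_of_one_le_of_one_le hR (one_le_pow₀ (by norm_num))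
    linarith
  calc P.blockVariance h i ≤ (P.box i).card • ((P.radius / 2 ^ i) ^ 2 * H ^ 2) :=
        Finset.sum_le_card_nsmul _ _ _ hterm
    _ ≤ 3 * P.radius * 2 ^ i * ((P.radius / 2 ^ i) ^ 2 * H ^ 2) := by
        rw [nsmul_eq_mul]; gcongr
    _ = _ := by
        rw [one_div, inv_pow]
        field_simp

/-- The summand is of order (2(2q²)^{-n})^i. The factor 2^i lost in Nikolskii's inequality is
harmless once n is large, because 2q² > 1. Taking n ≥ p lets p-th moments of the product be
controlled by first moments of `blockMoment`. -/
lemma exists_summable_blockConst_mul_pow {q : ℝ} (hq : 0 < q) (hq2 : 1 < 2 * q ^ 2) (p : ℝ) :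
    ∃ n : ℕ, n ≠ 0 ∧ p ≤ n ∧
      ∀ K : ℝ, 0 ≤ K → Summable fun i => P.blockConst q n i * (K * (1 / 2) ^ i) ^ n := by
  have hr0 : 0 ≤ 1 / (2 * q ^ 2) := by positivity
  have hr1 : 1 / (2 * q ^ 2) < 1 := (div_lt_one (by positivity)).2 hq2
  have h1 : ∀ᶠ n : ℕ in atTop, (1 / (2 * q ^ 2)) ^ n < 1 / 2 :=
    (tendsto_pow_atTop_nhds_zero_of_lt_one hr0 hr1).eventually_lt_const (by norm_num)
  have h2 : ∀ᶠ n : ℕ in atTop, p ≤ n := tendsto_natCast_atTop_atTop.eventually_ge_atTop p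
  obtain ⟨n, h1, h2, h3⟩ := (h1.and (h2.and (eventually_ne_atTop 0))).exists
  refine ⟨n, h3, h2, fun K hK => ?_⟩
  set r : ℝ := 2 * (1 / (2 * q ^ 2)) ^ n with hr
  refine Summable.of_nonneg_of_le (fun i => mul_nonneg (P.blockConst_pos hq n i).le (by positivity))
    (fun i => ?_) ((summable_geometric_of_lt_one (by positivity) (by linarith : r < 1)).mul_left
      ((2 * (n * P.radius) + 1) * K ^ n))
  have h4 : (2 * ((n * (P.radius * 2 ^ i) : ℕ) : ℝ) + 1) ≤ (2 * (n * P.radius) + 1) * 2 ^ i := by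
    push_cast
    have : (1 : ℝ) ≤ 2 ^ i := one_le_pow₀ (by norm_num)
    nlinarith
  calc P.blockConst q n i * (K * (1 / 2) ^ i) ^ n
      ≤ (q ^ (2 * n * i))⁻¹ * ((2 * (n * P.radius) + 1) * 2 ^ i) * (K * (1 / 2) ^ i) ^ n := by
        unfold blockConst
        gcongr
    _ = (2 * (n * P.radius) + 1) * K ^ n * r ^ i := by
        have h5 : r ^ i = 2 ^ i * ((1 / 2) ^ i) ^ n * (q ^ (2 * n * i))⁻¹ := by
          rw [hr, mul_pow, div_pow, mul_pow, one_pow, one_div, inv_pow, mul_pow, mul_inv, one_div,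
            inv_pow, inv_pow, ← pow_mul, ← pow_mul, ← pow_mul, ← pow_mul, mul_comm i n, mul_assoc,
            mul_assoc 2 n i]
        rw [h5, mul_pow]
        ring

end DyadicPartition

namespace IsWhiteNoise

lemma block_reduced_eq_sum {Ω : Type*} {ξ η : Ω → PeriodicDistribution} {h : ℤ → ℂ}
    (P : DyadicPartition)
    (hη : ∀ ω k, (η ω).coeff k = h k * (ξ ω).coeff k) (i : ℕ) (ω : Ω) (x : UnitAddCircle) :
    P.block i (reduced (η ω)) x = ∑ k ∈ P.box i,
      ((P.window i k : ℂ) * (((freq k)⁻¹ : ℝ) : ℂ) * h k * fourier k x) * (ξ ω).coeff k := by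
  rw [P.block_eq_blockPoly, DyadicPartition.blockPoly, trigPoly_apply]
  refine Finset.sum_congr rfl fun k _ => ?_
  rw [reduced_coeff, hη]
  ring

variable {Ω : Type*} [MeasurableSpace Ω] {μ : Measure Ω} {ξ η : Ω → PeriodicDistribution}
  {h : ℤ → ℂ}

lemma aemeasurable_block_reduced (P : DyadicPartition) (hξ : IsWhiteNoise ξ μ)
    (hη : ∀ ω k, (η ω).coeff k = h k * (ξ ω).coeff k) (i n : ℕ) :
    AEMeasurable (fun p : Ω × UnitAddCircle => ‖P.block i (reduced (η p.1)) p.2‖ₑ ^ (2 * n))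
      (μ.prod volume) := by
  simp only [block_reduced_eq_sum P hη]
  refine (AEMeasurable.enorm (Finset.aemeasurable_fun_sum _ fun k _ => ?_)).pow_const _
  refine AEMeasurable.mul ?_ ((hξ.aemeasurable_coeff k).comp_fst)
  exact ((map_continuous (fourier k)).measurable.comp measurable_snd).aemeasurable.const_mul _

lemma aemeasurable_blockMoment (P : DyadicPartition) (hξ : IsWhiteNoise ξ μ)
    (hη : ∀ ω k, (η ω).coeff k = h k * (ξ ω).coeff k) (q : ℝ) (n : ℕ) :
    AEMeasurable (fun ω => P.blockMoment q n (η ω)) μ :=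
  AEMeasurable.tsum fun i =>
    (hξ.aemeasurable_block_reduced P hη i n).lintegral_prod_right'.const_mul _

/-- By Tonelli the moments may be computed at a fixed point x, where a block is a linear functional
of ξ of variance at most `blockVariance`; since |e^{2πikx}| = 1 the bound does not depend on x. -/
lemma lintegral_blockMoment_le [SFinite μ] (P : DyadicPartition) (hξ : IsWhiteNoise ξ μ)
    (hη : ∀ ω k, (η ω).coeff k = h k * (ξ ω).coeff k) {q : ℝ} (hq : 0 < q) (n : ℕ)
    (hs : Summable fun i => P.blockConst q n i * P.blockVariance h i ^ n) :
    ∫⁻ ω, P.blockMoment q n (η ω) ∂μ ≤ 2 ^ (2 * n + 1) * gaussMoment n *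
      ENNReal.ofReal (∑' i, P.blockConst q n i * P.blockVariance h i ^ n) := by
  unfold DyadicPartition.blockMoment
  rw [lintegral_tsum fun i =>
    (hξ.aemeasurable_block_reduced P hη i n).lintegral_prod_right'.const_mul _,
    ENNReal.ofReal_tsum_of_nonneg (fun i => mul_nonneg (P.blockConst_pos hq n i).le
      (pow_nonneg (P.blockVariance_nonneg h i) n)) hs, ← ENNReal.tsum_mul_left]
  refine ENNReal.tsum_le_tsum fun i => ?_
  rw [lintegral_const_mul' _ _ ENNReal.ofReal_ne_top,
    lintegral_lintegral_swap (hξ.aemeasurable_block_reduced P hη i n)]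
  have h1 : ∀ x : UnitAddCircle, ∫⁻ ω, ‖P.block i (reduced (η ω)) x‖ₑ ^ (2 * n) ∂μ ≤
      2 ^ (2 * n + 1) * gaussMoment n * ENNReal.ofReal (P.blockVariance h i) ^ n := by
    intro x
    simp only [block_reduced_eq_sum P hη]
    refine (hξ.lintegral_enorm_pow_le _ _ n).trans (le_of_eq ?_)
    congr 3
    refine Finset.sum_congr rfl fun k _ => ?_
    rw [norm_mul, norm_mul, norm_mul, norm_fourier_apply, Complex.norm_real, Complex.norm_real,
      mul_one, norm_inv, Real.norm_eq_abs, Real.norm_eq_abs, abs_freq, mul_pow, mul_pow, sq_abs,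
      div_pow, div_eq_mul_inv, inv_pow]
  calc _ ≤ ENNReal.ofReal (P.blockConst q n i) * ∫⁻ _ : UnitAddCircle,
        2 ^ (2 * n + 1) * gaussMoment n * ENNReal.ofReal (P.blockVariance h i) ^ n := by
        gcongr with x
        exact h1 x
    _ = _ := by
        rw [lintegral_const, volume_unitAddCircle, measure_univ, mul_one, ENNReal.ofReal_mul (P.blockConst_pos hq n i).le,
          ENNReal.ofReal_pow (P.blockVariance_nonneg h i)]
        ring

end IsWhiteNoise

end TorusNoise
end

/-! ### Moment bounds, vanishing block variances, and Fourier transforms of mollifiers -/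

noncomputable section

namespace TorusNoise

/-- Cauchy-Schwarz separates the factors, and Jensen's inequality applies because the remaining
exponent 2s is at most 1. -/
lemma lintegral_rpow_mul_rpow_le {Ω : Type*} [MeasurableSpace Ω] {μ : Measure Ω}
    [IsProbabilityMeasure μ] {X Y : Ω → ℝ≥0∞} (hX : AEMeasurable X μ) (hY : AEMeasurable Y μ)
    {s : ℝ} (hs : 0 ≤ s) (hs2 : s ≤ 1 / 2) :
    ∫⁻ ω, X ω ^ s * Y ω ^ s ∂μ ≤ (∫⁻ ω, X ω ∂μ) ^ s * (∫⁻ ω, Y ω ∂μ) ^ s := by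
  have jensen : ∀ {Z : Ω → ℝ≥0∞}, AEMeasurable Z μ →
      (∫⁻ ω, Z ω ^ (2 * s) ∂μ) ^ (1 / 2 : ℝ) ≤ (∫⁻ ω, Z ω ∂μ) ^ s := by
    intro Z hZ
    have h := ENNReal.lintegral_mul_norm_pow_le hZ (aemeasurable_const (b := (1 : ℝ≥0∞)))
      (by linarith : 0 ≤ 2 * s) (by linarith : 0 ≤ 1 - 2 * s) (by ring)
    simp only [ENNReal.one_rpow, mul_one, lintegral_one, measure_univ] at h
    refine (ENNReal.rpow_le_rpow h (by norm_num)).trans (le_of_eq ?_)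
    rw [← ENNReal.rpow_mul]
    congr 1
    ring
  calc ∫⁻ ω, X ω ^ s * Y ω ^ s ∂μ
      = ∫⁻ ω, (X ω ^ (2 * s)) ^ (1 / 2 : ℝ) * (Y ω ^ (2 * s)) ^ (1 / 2 : ℝ) ∂μ := by
        refine lintegral_congr fun ω => ?_
        rw [← ENNReal.rpow_mul, ← ENNReal.rpow_mul]
        congr 2 <;> ring
    _ ≤ (∫⁻ ω, X ω ^ (2 * s) ∂μ) ^ (1 / 2 : ℝ) * (∫⁻ ω, Y ω ^ (2 * s) ∂μ) ^ (1 / 2 : ℝ) :=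
        ENNReal.lintegral_mul_norm_pow_le (hX.pow_const _) (hY.pow_const _) (by norm_num)
          (by norm_num) (by norm_num)
    _ ≤ _ := mul_le_mul' (jensen hX) (jensen hY)

lemma ofReal_mul_rpow_toReal {C s : ℝ} (hC : 0 ≤ C) {p : ℝ} (hp : 0 ≤ p) {n : ℕ}
    (hs : (((2 * n : ℕ) : ℝ)⁻¹) * p = s) {X Y : ℝ≥0∞} (hX : X ≠ ∞) (hY : Y ≠ ∞) :
    ENNReal.ofReal (C * (X.toReal ^ ((2 * n : ℕ) : ℝ)⁻¹ * Y.toReal ^ ((2 * n : ℕ) : ℝ)⁻¹)) ^ p =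
      ENNReal.ofReal C ^ p * (X ^ s * Y ^ s) := by
  have hn : (0 : ℝ) ≤ ((2 * n : ℕ) : ℝ)⁻¹ := by positivity
  have hr : ∀ {Z : ℝ≥0∞}, Z ≠ ∞ → ENNReal.ofReal (Z.toReal ^ ((2 * n : ℕ) : ℝ)⁻¹) =
      Z ^ ((2 * n : ℕ) : ℝ)⁻¹ := fun {Z} hZ => by
    rw [← ENNReal.ofReal_rpow_of_nonneg ENNReal.toReal_nonneg hn, ENNReal.ofReal_toReal hZ]
  rw [ENNReal.ofReal_mul hC, ENNReal.ofReal_mul (by positivity), hr hX, hr hY,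
    ENNReal.mul_rpow_of_nonneg _ _ hp, ENNReal.mul_rpow_of_nonneg _ _ hp, ← ENNReal.rpow_mul,
    ← ENNReal.rpow_mul, hs]

namespace IsWhiteNoise

variable {Ω : Type*} [MeasurableSpace Ω] {μ : Measure Ω} {ξ : Ω → PeriodicDistribution}

/-- Moment bounds for the renormalized square of white noise, and for its difference with the
renormalized square of a filtered white noise. -/
lemma exists_lintegral_holderNorm_le [IsProbabilityMeasure μ] (P : DyadicPartition)
    (hξ : IsWhiteNoise ξ μ) {γ p : ℝ} (hγ : γ < 0) (hp : 1 ≤ p) (H : ℝ) :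
    ∃ (q : ℝ) (n : ℕ) (K : ℝ≥0∞) (s : ℝ), 0 < q ∧ n ≠ 0 ∧ K ≠ ∞ ∧ 0 < s ∧
      (∀ L : ℝ, 0 ≤ L → Summable fun i => P.blockConst q n i * (L * (1 / 2) ^ i) ^ n) ∧
      (∀ w : Ω → PeriodicDistribution,
        (∀ᵐ ω ∂μ, ∃ hr : IsRough (ξ ω).coeff, w ω = symProduct P hr hr) →
        ∫⁻ ω, P.holderNorm γ (w ω) ^ p ∂μ < ∞) ∧
      ∀ (h : ℤ → ℂ) (η w v : Ω → PeriodicDistribution), (∀ k, ‖h k‖ ≤ H) →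
        (∀ ω k, (η ω).coeff k = h k * (ξ ω).coeff k) →
        (∀ᵐ ω ∂μ, ∃ hr : IsRough (ξ ω).coeff, w ω = symProduct P hr hr) →
        (∀ᵐ ω ∂μ, ∃ hr : IsRough (η ω).coeff, v ω = symProduct P hr hr) →
        ∫⁻ ω, P.holderNorm γ (w ω - v ω) ^ p ∂μ ≤ K *
          ENNReal.ofReal (∑' i, P.blockConst q n i *
            P.blockVariance (fun k => 1 - h k) i ^ n) ^ s := by
  obtain ⟨q, C, hq, -, hq2, hC, hb1, hb2⟩ := exists_holderNorm_symProduct_le P hγ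
  obtain ⟨n, hn, hpn, hsum⟩ := P.exists_summable_blockConst_mul_pow hq hq2 p
  have hn0 : (0 : ℝ) < n := by positivity
  -- The block amplitude is the power 1/(2n) of `blockMoment`, so its p-th power has exponent
  -- p/(2n), which is at most 1/2 as p ≤ n.
  set s : ℝ := (((2 * n : ℕ) : ℝ)⁻¹) * p with hs
  have hs0 : 0 < s := by positivity
  have hs2 : s ≤ 1 / 2 := by
    rw [hs]
    push_cast
    rw [inv_mul_le_iff₀ (by positivity)]
    linarith
  have hp0 : 0 ≤ p := by linarith
  have hg := gaussMoment_lt_top n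
  set G : ℝ≥0∞ := 2 ^ (2 * n + 1) * gaussMoment n with hG
  have hGtop : G ≠ ∞ := by finiteness
  -- The bound 1 + |H| serves the three symbols 1, h and 1 - h simultaneously.
  set R : ℝ := 3 * P.radius ^ 3 * (1 + |H|) ^ 2 with hR
  have hR0 : 0 ≤ R := by positivity
  set M : ℝ≥0∞ := G * ENNReal.ofReal (∑' i, P.blockConst q n i * (R * (1 / 2) ^ i) ^ n) with hM
  have hMtop : M ≠ ∞ := by finiteness
  have hle : ∀ {g : ℤ → ℂ}, (∀ k, ‖g k‖ ≤ 1 + |H|) → ∀ i,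
      P.blockConst q n i * P.blockVariance g i ^ n ≤
        P.blockConst q n i * (R * (1 / 2) ^ i) ^ n := by
    intro g hgH i
    have h1 := P.blockConst_pos hq n i
    have h2 := P.blockVariance_nonneg g i
    gcongr
    exact P.blockVariance_le hgH i
  have hsm : ∀ {g : ℤ → ℂ}, (∀ k, ‖g k‖ ≤ 1 + |H|) →
      Summable fun i => P.blockConst q n i * P.blockVariance g i ^ n := fun {g} hgH =>
    Summable.of_nonneg_of_le (fun i => mul_nonneg (P.blockConst_pos hq n i).le
      (pow_nonneg (P.blockVariance_nonneg g i) n)) (hle hgH) (hsum R hR0)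
  have hE : ∀ {g : ℤ → ℂ} {ζ : Ω → PeriodicDistribution}, (∀ k, ‖g k‖ ≤ 1 + |H|) →
      (∀ ω k, (ζ ω).coeff k = g k * (ξ ω).coeff k) →
      ∫⁻ ω, P.blockMoment q n (ζ ω) ∂μ ≤
        G * ENNReal.ofReal (∑' i, P.blockConst q n i * P.blockVariance g i ^ n) :=
    fun {g ζ} hgH hζ => hξ.lintegral_blockMoment_le P hζ hq n (hsm hgH)
  have hEM : ∀ {g : ℤ → ℂ} {ζ : Ω → PeriodicDistribution}, (∀ k, ‖g k‖ ≤ 1 + |H|) →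
      (∀ ω k, (ζ ω).coeff k = g k * (ξ ω).coeff k) →
      ∫⁻ ω, P.blockMoment q n (ζ ω) ∂μ ≤ M := fun {g ζ} hgH hζ => by
    refine (hE hgH hζ).trans ?_
    exact mul_le_mul_right (ENNReal.ofReal_le_ofReal
      ((hsm hgH).tsum_le_tsum (hle hgH) (hsum R hR0))) _
  have hfin : ∀ {g : ℤ → ℂ} {ζ : Ω → PeriodicDistribution}, (∀ k, ‖g k‖ ≤ 1 + |H|) →
      (∀ ω k, (ζ ω).coeff k = g k * (ξ ω).coeff k) →
      ∀ᵐ ω ∂μ, P.blockMoment q n (ζ ω) ≠ ∞ := fun {g ζ} hgH hζ =>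
    (ae_lt_top' (hξ.aemeasurable_blockMoment P hζ q n)
      ((hEM hgH hζ).trans_lt hMtop.lt_top).ne).mono fun ω hω => hω.ne
  have h1H : ∀ k : ℤ, ‖(fun _ => 1 : ℤ → ℂ) k‖ ≤ 1 + |H| := fun k => by
    simp [abs_nonneg H]
  have h1ξ : ∀ ω k, (ξ ω).coeff k = (fun _ => 1 : ℤ → ℂ) k * (ξ ω).coeff k := fun ω k =>
    (one_mul _).symm
  have hmξ := hξ.aemeasurable_blockMoment P h1ξ q n
  refine ⟨q, n, ENNReal.ofReal C ^ p * 2 ^ (p - 1) * (G ^ s * (M ^ s + M ^ s)), s, hq, hn,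
    ?_, hs0, hsum, fun w hw => ?_, fun h η w v hhH hη hw hv => ?_⟩
  · have h2 : (2 : ℝ≥0∞) ^ (p - 1) ≠ ∞ := ENNReal.rpow_ne_top_of_nonneg (by linarith) (by norm_num)
    have h3 : M ^ s ≠ ∞ := ENNReal.rpow_ne_top_of_nonneg hs0.le hMtop
    have h4 : G ^ s ≠ ∞ := ENNReal.rpow_ne_top_of_nonneg hs0.le hGtop
    have h5 : ENNReal.ofReal C ^ p ≠ ∞ := ENNReal.rpow_ne_top_of_nonneg hp0 ENNReal.ofReal_ne_top
    finiteness
  · have hpt : ∀ᵐ ω ∂μ, P.holderNorm γ (w ω) ^ p ≤ ENNReal.ofReal C ^ p *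
        (P.blockMoment q n (ξ ω) ^ s * P.blockMoment q n (ξ ω) ^ s) := by
      filter_upwards [hw, hfin h1H h1ξ] with ω ⟨hr, hω⟩ hN
      rw [hω, ← ofReal_mul_rpow_toReal hC hp0 hs.symm hN hN]
      exact ENNReal.rpow_le_rpow (hb1 (ξ ω) hr _ (by positivity)
        (P.norm_block_reduced_le hq hn hN)) hp0
    calc _ ≤ ∫⁻ ω, ENNReal.ofReal C ^ p *
          (P.blockMoment q n (ξ ω) ^ s * P.blockMoment q n (ξ ω) ^ s) ∂μ := lintegral_mono_ae hpt
      _ = ENNReal.ofReal C ^ p *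
          ∫⁻ ω, P.blockMoment q n (ξ ω) ^ s * P.blockMoment q n (ξ ω) ^ s ∂μ :=
          lintegral_const_mul' _ _ (ENNReal.rpow_ne_top_of_nonneg hp0 ENNReal.ofReal_ne_top)
      _ ≤ ENNReal.ofReal C ^ p * (M ^ s * M ^ s) := by
          have := hEM h1H h1ξ
          refine mul_le_mul_right ((lintegral_rpow_mul_rpow_le hmξ hmξ hs0.le hs2).trans ?_) _
          gcongr
      _ < ∞ := by
          have h3 : M ^ s ≠ ∞ := ENNReal.rpow_ne_top_of_nonneg hs0.le hMtop
          have h5 : ENNReal.ofReal C ^ p ≠ ∞ :=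
            ENNReal.rpow_ne_top_of_nonneg hp0 ENNReal.ofReal_ne_top
          finiteness
  · have hhH' : ∀ k, ‖h k‖ ≤ 1 + |H| := fun k => by linarith [hhH k, le_abs_self H]
    have hdH : ∀ k, ‖(fun k => 1 - h k) k‖ ≤ 1 + |H| := fun k => by
      refine (norm_sub_le _ _).trans ?_
      rw [norm_one]
      linarith [hhH k, le_abs_self H]
    have hdη : ∀ ω k, (ξ ω - η ω).coeff k = (fun k => 1 - h k) k * (ξ ω).coeff k := fun ω k => by
      show (ξ ω).coeff k - (η ω).coeff k = (1 - h k) * (ξ ω).coeff k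
      rw [hη]
      ring
    have hmη := hξ.aemeasurable_blockMoment P hη q n
    have hmd := hξ.aemeasurable_blockMoment P hdη q n
    set NA : Ω → ℝ≥0∞ := fun ω => P.blockMoment q n (ξ ω) with hNA
    set NB : Ω → ℝ≥0∞ := fun ω => P.blockMoment q n (η ω) with hNB
    set ND : Ω → ℝ≥0∞ := fun ω => P.blockMoment q n (ξ ω - η ω) with hND
    have hmDA : AEMeasurable (fun ω => ND ω ^ s * NA ω ^ s) μ :=
      (hmd.pow_const s).mul (hmξ.pow_const s)
    -- The Lipschitz estimate leaves one factor `ND` of the difference in every term; its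
    -- expectation carries the smallness.
    have hpt : ∀ᵐ ω ∂μ, P.holderNorm γ (w ω - v ω) ^ p ≤ ENNReal.ofReal C ^ p * 2 ^ (p - 1) *
        (ND ω ^ s * NA ω ^ s + ND ω ^ s * NB ω ^ s) := by
      filter_upwards [hw, hv, hfin h1H h1ξ, hfin hhH' hη, hfin hdH hdη] with ω ⟨hr, hω⟩ ⟨hr', hω'⟩
        hA hB hD
      rw [hω, hω']
      refine (ENNReal.rpow_le_rpow (hb2 (ξ ω) (η ω) hr hr' _ _ _ (by positivity) (by positivity)
        (by positivity) (P.norm_block_reduced_le hq hn hA) (P.norm_block_reduced_le hq hn hB)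
        (P.norm_block_reduced_le hq hn hD)) hp0).trans ?_
      rw [mul_add, ENNReal.ofReal_add (by positivity) (by positivity)]
      refine (ENNReal.rpow_add_le_mul_rpow_add_rpow _ _ hp).trans (le_of_eq ?_)
      rw [ofReal_mul_rpow_toReal hC hp0 hs.symm hD hA, ofReal_mul_rpow_toReal hC hp0 hs.symm hB hD]
      ring
    calc _ ≤ ∫⁻ ω, ENNReal.ofReal C ^ p * 2 ^ (p - 1) *
          (ND ω ^ s * NA ω ^ s + ND ω ^ s * NB ω ^ s) ∂μ := lintegral_mono_ae hpt
      _ = ENNReal.ofReal C ^ p * 2 ^ (p - 1) *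
          (∫⁻ ω, ND ω ^ s * NA ω ^ s ∂μ + ∫⁻ ω, ND ω ^ s * NB ω ^ s ∂μ) := by
          rw [lintegral_const_mul' _ _ (ENNReal.mul_ne_top
            (ENNReal.rpow_ne_top_of_nonneg hp0 ENNReal.ofReal_ne_top)
            (ENNReal.rpow_ne_top_of_nonneg (by linarith) (by norm_num))),
            lintegral_add_left' hmDA]
      _ ≤ ENNReal.ofReal C ^ p * 2 ^ (p - 1) *
          ((G * ENNReal.ofReal (∑' i, P.blockConst q n i *
            P.blockVariance (fun k => 1 - h k) i ^ n)) ^ s * M ^ s +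
          (G * ENNReal.ofReal (∑' i, P.blockConst q n i *
            P.blockVariance (fun k => 1 - h k) i ^ n)) ^ s * M ^ s) := by
          have h1 := hEM h1H h1ξ
          have h2 := hEM hhH' hη
          have h3 := hE hdH hdη
          refine mul_le_mul_right (add_le_add
            ((lintegral_rpow_mul_rpow_le hmd hmξ hs0.le hs2).trans ?_)
            ((lintegral_rpow_mul_rpow_le hmd hmη hs0.le hs2).trans ?_)) _ <;> gcongr
      _ = _ := by
          rw [ENNReal.mul_rpow_of_nonneg _ _ hs0.le]
          ring

end IsWhiteNoise

/-- Each block variance is a finite sum that tends to 0, and the uniform bound on the symbols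
dominates the series. -/
lemma DyadicPartition.tendsto_tsum_blockVariance (P : DyadicPartition) {q : ℝ} (hq : 0 < q) {n : ℕ}
    (hn : n ≠ 0)
    (hs : ∀ L : ℝ, 0 ≤ L → Summable fun i => P.blockConst q n i * (L * (1 / 2) ^ i) ^ n)
    {ι : Type*} {l : Filter ι} {g : ι → ℤ → ℂ} {H : ℝ} (hH : ∀ᶠ e in l, ∀ k, ‖g e k‖ ≤ H)
    (hg : ∀ k, Tendsto (fun e => g e k) l (𝓝 0)) :
    Tendsto (fun e => ∑' i, P.blockConst q n i * P.blockVariance (g e) i ^ n) l (𝓝 0) := by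
  have h1 : ∀ i, Tendsto (fun e => P.blockConst q n i * P.blockVariance (g e) i ^ n) l (𝓝 0) := by
    intro i
    have h2 : Tendsto (fun e => P.blockVariance (g e) i) l (𝓝 0) := by
      have := tendsto_finsetSum (P.box i) fun k _ =>
        (((hg k).norm.pow 2).const_mul ((P.window i k / bracket k) ^ 2))
      simpa [DyadicPartition.blockVariance] using this
    simpa [hn] using (h2.pow n).const_mul (P.blockConst q n i)
  have h3 := tendsto_tsum_of_dominated_convergence (hs (3 * P.radius ^ 3 * H ^ 2) (by positivity))
    h1 (hH.mono fun e he i => by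
      have h4 := P.blockConst_pos hq n i
      have h5 := P.blockVariance_nonneg (g e) i
      rw [Real.norm_eq_abs, abs_of_nonneg (by positivity)]
      gcongr
      exact P.blockVariance_le he i)
  simpa using h3

/-! ### Fourier transforms on the line -/

section LineFourier

variable {ψ : ℝ → ℝ}

lemma norm_lineFourier_le (ψ : ℝ → ℝ) (y : ℝ) : ‖lineFourier ψ y‖ ≤ ∫ x, ‖ψ x‖ := by
  refine (norm_integral_le_integral_norm _).trans (le_of_eq ?_)
  refine integral_congr_ae (Eventually.of_forall fun x => ?_)
  simp only [norm_mul, Complex.norm_exp_ofReal_mul_I, one_mul, Complex.norm_real]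

lemma lineFourier_neg (ψ : ℝ → ℝ) (y : ℝ) :
    lineFourier ψ (-y) = starRingEnd ℂ (lineFourier ψ y) := by
  unfold lineFourier
  rw [← integral_conj]
  refine integral_congr_ae (Eventually.of_forall fun x => ?_)
  simp only [map_mul, Complex.conj_ofReal, ← Complex.exp_conj, Complex.conj_I]
  congr 2
  push_cast
  ring

lemma lineFourier_rescale (ψ : ℝ → ℝ) {ε : ℝ} (hε : 0 < ε) (y : ℝ) :
    lineFourier (rescale ψ ε) y = lineFourier ψ (ε * y) := by
  unfold lineFourier
  have h := Measure.integral_comp_div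
    (fun x : ℝ => Complex.exp ((-2 * Real.pi * (ε * y) * x : ℝ) * Complex.I) * (ψ x : ℂ)) ε
  have h1 : ∀ x : ℝ, Complex.exp ((-2 * Real.pi * y * x : ℝ) * Complex.I) *
      (rescale ψ ε x : ℂ) = ((ε⁻¹ : ℝ) : ℂ) *
        (Complex.exp ((-2 * Real.pi * (ε * y) * (x / ε) : ℝ) * Complex.I) * (ψ (x / ε) : ℂ)) := by
    intro x
    have h2 : -2 * Real.pi * (ε * y) * (x / ε) = -2 * Real.pi * y * x := by
      field_simp
    rw [h2, rescale, one_div]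
    push_cast
    ring
  simp only [h1]
  rw [integral_const_mul, h, abs_of_pos hε, Complex.real_smul, ← mul_assoc, ← Complex.ofReal_mul,
    inv_mul_cancel₀ hε.ne', Complex.ofReal_one, one_mul]

lemma continuous_lineFourier (hψ : Integrable ψ) : Continuous (lineFourier ψ) := by
  unfold lineFourier
  refine continuous_of_dominated (bound := fun x => ‖ψ x‖) (fun y => ?_)
    (fun y => Eventually.of_forall fun x => ?_) hψ.norm (Eventually.of_forall fun x => by fun_prop)
  · exact (by fun_prop : Continuous fun x : ℝ =>
      Complex.exp ((-2 * Real.pi * y * x : ℝ) * Complex.I)).aestronglyMeasurable.mul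
      hψ.ofReal.aestronglyMeasurable
  · simp only [norm_mul, Complex.norm_exp_ofReal_mul_I, one_mul, Complex.norm_real, le_refl]

lemma lineFourier_zero (ψ : ℝ → ℝ) : lineFourier ψ 0 = ((∫ x, ψ x : ℝ) : ℂ) := by
  simp [lineFourier, integral_complex_ofReal]

lemma IsMollifier.tendsto_lineFourier (hψ : IsMollifier ψ) (k : ℝ) :
    Tendsto (fun ε : ℝ => lineFourier ψ (ε * k)) (𝓝[>] 0) (𝓝 1) := by
  have h : Continuous fun ε : ℝ => lineFourier ψ (ε * k) :=
    (continuous_lineFourier hψ.integrable).comp (by fun_prop)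
  have h1 := h.tendsto 0
  rw [zero_mul, lineFourier_zero, hψ.integral_eq_one, Complex.ofReal_one] at h1
  exact h1.mono_left nhdsWithin_le_nhds

end LineFourier

end TorusNoise
end

noncomputable section

namespace TorusNoise

/-! ### The renormalization constant -/

/-- The summand `a_k / (4π²k²) · 2πik` of the renormalization constant. -/
lemma renormTerm_eq (a : ℝ) (k : ℤ) :
    ((a / (4 * Real.pi ^ 2 * (k : ℝ) ^ 2) : ℝ) : ℂ) * (2 * Real.pi * Complex.I * k) =
      Complex.I / (2 * Real.pi) * (((k : ℝ)⁻¹ : ℝ) : ℂ) * a := by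
  have hpi : (Real.pi : ℂ) ≠ 0 := by exact_mod_cast Real.pi_ne_zero
  rcases eq_or_ne k 0 with rfl | hk
  · simp
  · have hk' : (k : ℂ) ≠ 0 := by exact_mod_cast hk
    push_cast
    field_simp
    ring

lemma sum_renormTerm_eq_zero {a : ℤ → ℝ} (ha : ∀ k, a (-k) = a k) (N : ℕ) :
    ∑ k ∈ (Finset.Icc (-(N : ℤ)) N).erase 0,
      ((a k / (4 * Real.pi ^ 2 * (k : ℝ) ^ 2) : ℝ) : ℂ) * (2 * Real.pi * Complex.I * k) = 0 := by
  have h : ∑ k ∈ (Finset.Icc (-(N : ℤ)) N).erase 0,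
      ((a k / (4 * Real.pi ^ 2 * (k : ℝ) ^ 2) : ℝ) : ℂ) * (2 * Real.pi * Complex.I * k) =
      ∑ k ∈ (Finset.Icc (-(N : ℤ)) N).erase 0,
      -(((a k / (4 * Real.pi ^ 2 * (k : ℝ) ^ 2) : ℝ) : ℂ) * (2 * Real.pi * Complex.I * k)) := by
    refine Finset.sum_equiv (Equiv.neg ℤ) (fun k => ?_) fun k _ => ?_
    · simp only [Finset.mem_erase, Finset.mem_Icc, Equiv.neg_apply]
      omega
    · rw [Equiv.neg_apply, ha, renormTerm_eq, renormTerm_eq]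
      push_cast
      rw [inv_neg]
      ring
  rw [Finset.sum_neg_distrib] at h
  exact self_eq_neg.1 h

/-- Absolute convergence comes from summability of `a`; the summand is odd, so the sum vanishes. -/
lemma hasSum_renormTerm {a : ℤ → ℝ} (ha : ∀ k, a (-k) = a k) (h0 : ∀ k, 0 ≤ a k)
    (hs : Summable a) :
    HasSum (fun k : {k : ℤ // k ≠ 0} =>
      ((a (k : ℤ) / (4 * Real.pi ^ 2 * ((k : ℤ) : ℝ) ^ 2) : ℝ) : ℂ) *
        (2 * Real.pi * Complex.I * ((k : ℤ) : ℂ))) 0 := by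
  have hsum : Summable fun k : ℤ =>
      ((a k / (4 * Real.pi ^ 2 * (k : ℝ) ^ 2) : ℝ) : ℂ) * (2 * Real.pi * Complex.I * k) := by
    refine Summable.of_norm_bounded hs fun k => ?_
    rw [renormTerm_eq, norm_mul, norm_mul, Complex.norm_real, Complex.norm_real, Real.norm_eq_abs,
      Real.norm_eq_abs, abs_of_nonneg (h0 k)]
    have h1 : ‖Complex.I / (2 * (Real.pi : ℂ))‖ ≤ 1 := by
      rw [norm_div, Complex.norm_I, norm_mul, Complex.norm_real, Real.norm_eq_abs,
        abs_of_pos Real.pi_pos, Complex.norm_two, div_le_one (by positivity)]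
      linarith [Real.pi_gt_three]
    have h2 : |((k : ℝ))⁻¹| ≤ 1 :=
      inv_abs_le_bracket_inv.trans (inv_le_one_of_one_le₀ (one_le_bracket k))
    exact mul_le_of_le_one_left (h0 k) (mul_le_one₀ h1 (abs_nonneg _) h2)
  have hS := (hsum.subtype {k : ℤ | k ≠ 0}).hasSum
  have hz : ∀ k : ℤ, k ∉ {k : ℤ | k ≠ 0} →
      ((a k / (4 * Real.pi ^ 2 * (k : ℝ) ^ 2) : ℝ) : ℂ) * (2 * Real.pi * Complex.I * k) = 0 := by
    intro k hk
    obtain rfl : k = 0 := by simpa using hk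
    simp
  have htsum : ∑' k : ℤ,
      ((a k / (4 * Real.pi ^ 2 * (k : ℝ) ^ 2) : ℝ) : ℂ) * (2 * Real.pi * Complex.I * k) = 0 := by
    have h3 := (Equiv.neg ℤ).tsum_eq fun k : ℤ =>
      ((a k / (4 * Real.pi ^ 2 * (k : ℝ) ^ 2) : ℝ) : ℂ) * (2 * Real.pi * Complex.I * k)
    have h4 : ∀ k : ℤ, ((a (Equiv.neg ℤ k) / (4 * Real.pi ^ 2 * ((Equiv.neg ℤ k : ℤ) : ℝ) ^ 2) : ℝ) :
        ℂ) * (2 * Real.pi * Complex.I * (Equiv.neg ℤ k : ℤ)) =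
        -(((a k / (4 * Real.pi ^ 2 * (k : ℝ) ^ 2) : ℝ) : ℂ) * (2 * Real.pi * Complex.I * k)) := by
      intro k
      rw [Equiv.neg_apply, ha, renormTerm_eq, renormTerm_eq]
      push_cast
      rw [inv_neg]
      ring
    simp only [h4, tsum_neg] at h3
    exact self_eq_neg.1 h3.symm
  have h5 := (hasSum_subtype_iff_of_support_subset (s := {k : ℤ | k ≠ 0}) (by
    intro k hk
    by_contra hk'
    exact hk (hz k hk'))).2 (htsum ▸ hsum.hasSum)
  exact h5

/-! ### Pointwise resonant products -/

namespace DyadicPartition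

variable (P : DyadicPartition)

/-- The resonant weights are nonnegative, so summing the norms over i gives exactly `weight`. The
hypothesis is thus absolute convergence over all triples, and the order of summation may be changed.
-/
lemma hasSum_resonantTerm {f g : PeriodicDistribution}
    (hs : Summable fun p : ℤ × ℤ => P.weight p.1 p.2 * (‖f.coeff p.1‖ * ‖g.coeff p.2‖))
    (x : UnitAddCircle) :
    HasSum (fun i => P.resonantTerm f g i x)
      (∑' p : ℤ × ℤ, (P.weight p.1 p.2 : ℂ) * (f.coeff p.1 * g.coeff p.2) *
        fourier (p.1 + p.2) x) := by
  set F : (ℤ × ℤ) × ℕ → ℂ := fun q => (P.resWeight q.2 q.1.1 q.1.2 : ℂ) *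
    (f.coeff q.1.1 * g.coeff q.1.2) * fourier (q.1.1 + q.1.2) x with hF
  have hnorm : ∀ q, ‖F q‖ = P.resWeight q.2 q.1.1 q.1.2 *
      (‖f.coeff q.1.1‖ * ‖g.coeff q.1.2‖) := fun q => by
    rw [hF]
    simp only [norm_mul, norm_fourier_apply, mul_one, Complex.norm_real, Real.norm_eq_abs]
    rw [abs_of_nonneg (P.resWeight_nonneg _ _ _)]
  have h1 : ∀ p : ℤ × ℤ, HasSum (fun i => ‖F (p, i)‖)
      (P.weight p.1 p.2 * (‖f.coeff p.1‖ * ‖g.coeff p.2‖)) := fun p => by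
    simp only [hnorm]
    exact (P.hasSum_resWeight p.1 p.2).mul_right _
  have hsumF : Summable F := by
    have hs' : Summable fun p : ℤ × ℤ => ∑' i, ‖F (p, i)‖ := by
      simpa only [(h1 _).tsum_eq] using hs
    exact Summable.of_norm ((summable_prod_of_nonneg fun q => norm_nonneg _).2
      ⟨fun p => (h1 p).summable, hs'⟩)
  have h2 : ∀ p : ℤ × ℤ, HasSum (fun i => F (p, i))
      ((P.weight p.1 p.2 : ℂ) * (f.coeff p.1 * g.coeff p.2) * fourier (p.1 + p.2) x) := fun p => by
    simp only [hF]
    exact ((Complex.hasSum_ofReal.2 (P.hasSum_resWeight p.1 p.2)).mul_right _).mul_right _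
  have h3 : ∀ i : ℕ, HasSum (fun p : ℤ × ℤ => F (p, i)) (P.resonantTerm f g i x) := fun i => by
    rw [P.resonantTerm_eq_sum (Nat.lt_succ_self i)]
    refine hasSum_sum_of_ne_finset_zero fun p hp => ?_
    rw [hF]
    simp only [P.resWeight_eq_zero (Nat.lt_succ_self i) hp, Complex.ofReal_zero, zero_mul]
  rw [(hsumF.hasSum.prod_fiberwise h2).tsum_eq]
  have h4 : HasSum (fun q : ℕ × (ℤ × ℤ) => F (q.2, q.1)) (∑' q, F q) :=
    (Equiv.prodComm ℕ (ℤ × ℤ)).hasSum_iff.2 hsumF.hasSum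
  exact h4.prod_fiberwise h3

/-- The weight only couples comparable frequencies, so the polynomial growth of `g` at l can be
charged to the rapid decay of `f` at k. -/
lemma summable_weight_mul_of_rapid {f g : ℤ → ℂ} (hf : ∀ n : ℕ, Summable fun k => bracket k ^ n * ‖f k‖)
    {C : ℝ} {n : ℕ} (hC : 0 ≤ C) (hg : ∀ k, ‖g k‖ ≤ C * bracket k ^ n) :
    Summable fun p : ℤ × ℤ => P.weight p.1 p.2 * (‖f p.1‖ * ‖g p.2‖) := by
  have hs := ((hf (n + 2)).mul_left (C * (2 * (P.radius : ℝ) ^ 2) ^ (n + 2))).mul_of_nonneg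
    summable_bracket_inv_sq (fun k => by have := bracket_pos k; positivity)
    (fun k => by have := bracket_pos k; positivity)
  refine Summable.of_nonneg_of_le (fun p => mul_nonneg (P.weight_nonneg _ _) (by positivity))
    (fun p => ?_) hs
  have h1 := bracket_pos p.1
  have h2 := bracket_pos p.2
  by_cases hw : P.weight p.1 p.2 = 0
  · rw [hw, zero_mul]; positivity
  · have h3 := (P.bracket_le_of_weight_ne_zero hw).1
    calc P.weight p.1 p.2 * (‖f p.1‖ * ‖g p.2‖) ≤ 1 * (‖f p.1‖ * (C * bracket p.2 ^ n)) := by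
          gcongr
          · exact P.weight_le_one _ _
          · exact hg _
      _ = ‖f p.1‖ * C * (bracket p.2 ^ (n + 2) * (bracket p.2 ^ 2)⁻¹) := by
          rw [pow_add]; field_simp
      _ ≤ ‖f p.1‖ * C * ((2 * (P.radius : ℝ) ^ 2 * bracket p.1) ^ (n + 2) * (bracket p.2 ^ 2)⁻¹) := by
          gcongr
      _ = _ := by rw [mul_pow]; ring

end DyadicPartition

namespace IsWhiteNoise

variable {Ω : Type*} [MeasurableSpace Ω] {μ : Measure Ω} {ξ : Ω → PeriodicDistribution}
  {η ζ : Ω → PeriodicDistribution} {h m : ℤ → ℂ}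

/-- The pointwise resonant product of two filtered white noises, one of them with an odd symbol
relative to the other, is centred. -/
lemma integral_resonantAt (P : DyadicPartition) (hξ : IsWhiteNoise ξ μ)
    (hη : ∀ ω k, (η ω).coeff k = h k * (ξ ω).coeff k)
    (hζ : ∀ ω k, (ζ ω).coeff k = m k * (η ω).coeff k) (hm : ∀ k, m (-k) = -m k)
    (hs : Summable fun p : ℤ × ℤ => P.weight p.1 p.2 * (‖m p.1 * h p.1‖ * ‖h p.2‖))
    (x : UnitAddCircle) :
    (∀ᵐ ω ∂μ, Summable fun i => P.resonantTerm (ζ ω) (η ω) i x) ∧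
      Integrable (fun ω => P.resonantAt (ζ ω) (η ω) x) μ ∧
      ∫ ω, P.resonantAt (ζ ω) (η ω) x ∂μ = 0 := by
  obtain ⟨h1, h2, h3⟩ := hξ.integral_tsum_coeff_mul
    (κ := fun p => (P.weight p.1 p.2 : ℂ) * (m p.1 * h p.1 * h p.2) * fourier (p.1 + p.2) x)
    (hs.congr fun p => by
      rw [norm_mul _ (fourier (p.1 + p.2) x), norm_mul (P.weight p.1 p.2 : ℂ), norm_mul (m p.1 * h p.1) (h p.2), norm_fourier_apply, mul_one,
        Complex.norm_real, Real.norm_eq_abs, abs_of_nonneg (P.weight_nonneg _ _)])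
  have h4 : ∀ᵐ ω ∂μ, HasSum (fun i => P.resonantTerm (ζ ω) (η ω) i x)
      (∑' p : ℤ × ℤ, (P.weight p.1 p.2 : ℂ) * (m p.1 * h p.1 * h p.2) * fourier (p.1 + p.2) x *
        ((ξ ω).coeff p.1 * (ξ ω).coeff p.2)) := by
    filter_upwards [h1] with ω hω
    have h5 := P.hasSum_resonantTerm (f := ζ ω) (g := η ω) (hω.congr fun p => by
      simp only [hζ, hη, norm_mul, norm_fourier_apply, mul_one, Complex.norm_real,
        Real.norm_eq_abs, abs_of_nonneg (P.weight_nonneg _ _)]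
      ring) x
    convert h5 using 1
    refine tsum_congr fun p => ?_
    rw [hζ, hη, hη]
    ring
  have h6 : (fun ω => P.resonantAt (ζ ω) (η ω) x) =ᵐ[μ] fun ω =>
      ∑' p : ℤ × ℤ, (P.weight p.1 p.2 : ℂ) * (m p.1 * h p.1 * h p.2) * fourier (p.1 + p.2) x *
        ((ξ ω).coeff p.1 * (ξ ω).coeff p.2) := h4.mono fun ω hω => hω.tsum_eq
  refine ⟨h4.mono fun ω hω => hω.summable, h2.congr h6.symm, ?_⟩
  rw [integral_congr_ae h6]
  refine h3 fun k => ?_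
  simp only [P.weight_comm (-k) k, hm, add_neg_cancel, neg_add_cancel]
  ring

/-- The renormalization constant with a frequency cut-off. -/
lemma integral_partialSum_mul (hξ : IsWhiteNoise ξ μ)
    (hη : ∀ ω k, (η ω).coeff k = h k * (ξ ω).coeff k)
    (hh : ∀ k, h k * h (-k) = ((‖h k‖ ^ 2 : ℝ) : ℂ)) (x : UnitAddCircle) (N : ℕ) :
    Integrable (fun ω => (gradPotential (η ω)).partialSum N x * (η ω).partialSum N x) μ ∧
      ∫ ω, (gradPotential (η ω)).partialSum N x * (η ω).partialSum N x ∂μ =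
        ∑ k ∈ (Finset.Icc (-(N : ℤ)) N).erase 0,
          ((‖h k‖ ^ 2 / (4 * Real.pi ^ 2 * (k : ℝ) ^ 2) : ℝ) : ℂ) *
            (2 * Real.pi * Complex.I * k) := by
  have hexp : ∀ ω, (gradPotential (η ω)).partialSum N x * (η ω).partialSum N x =
      ∑ k ∈ Finset.Icc (-(N : ℤ)) N, ∑ l ∈ Finset.Icc (-(N : ℤ)) N,
        (Complex.I / (2 * Real.pi) * (((k : ℝ)⁻¹ : ℝ) : ℂ) * (h k * h l) * fourier (k + l) x) *
          ((ξ ω).coeff k * (ξ ω).coeff l) := by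
    intro ω
    rw [partialSum, partialSum, Finset.sum_mul_sum]
    refine Finset.sum_congr rfl fun k _ => Finset.sum_congr rfl fun l _ => ?_
    rw [gradPotential_coeff, hη, hη, fourier_add]
    ring
  have hint : ∀ k l : ℤ, Integrable (fun ω =>
      (Complex.I / (2 * Real.pi) * (((k : ℝ)⁻¹ : ℝ) : ℂ) * (h k * h l) * fourier (k + l) x) *
          ((ξ ω).coeff k * (ξ ω).coeff l)) μ := fun k l =>
    (hξ.integrable_coeff_mul k l).const_mul _
  simp only [hexp]
  refine ⟨integrable_finsetSum _ fun k _ => integrable_finsetSum _ fun l _ => hint k l, ?_⟩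
  rw [integral_finsetSum _ fun k _ => integrable_finsetSum _ fun l _ => hint k l,
    Finset.sum_erase _ (by simp)]
  refine Finset.sum_congr rfl fun k hk => ?_
  rw [integral_finsetSum _ fun l _ => hint k l, Finset.sum_eq_single (-k)]
  · rw [integral_const_mul, hξ.integral_coeff_mul, add_neg_cancel, if_pos rfl, fourier_zero, hh,
      renormTerm_eq]
    push_cast
    ring
  · intro l _ hl
    rw [integral_const_mul, hξ.integral_coeff_mul, if_neg (by omega), mul_zero]
  · intro hk'
    simp only [Finset.mem_Icc] at hk hk'
    omega

end IsWhiteNoise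

end TorusNoise
end

noncomputable section

namespace TorusNoise

/-! ### Square integrable mollifiers -/

/-- If the support fits into a period T, the numbers ψ̂(k/T) are, up to the factor T, Fourier
coefficients of an L² function on an interval of length T. A period T that is an integer multiple M
of 1/ε places εk at the index kM, and Parseval bounds this subfamily. -/
lemma summable_norm_sq_lineFourier {ψ : ℝ → ℝ} (hψ : MemLp ψ 2 volume) (hc : HasCompactSupport ψ)
    {ε : ℝ} (hε : 0 < ε) : Summable fun k : ℤ => ‖lineFourier ψ (ε * k)‖ ^ 2 := by
  obtain ⟨r, hr⟩ := hc.isCompact.isBounded.subset_closedBall 0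
  -- This size of M makes half the period T = M/ε exceed the radius of the support.
  obtain ⟨M, hM⟩ := exists_nat_gt (2 * ε * (|r| + 1))
  have hM0 : (0 : ℝ) < M := lt_trans (by positivity) hM
  have hM1 : M ≠ 0 := by
    rintro rfl
    simp at hM0
  set T : ℝ := M / ε with hT
  have hT0 : 0 < T := by positivity
  have hTr : |r| < T / 2 := by
    rw [hT, lt_div_iff₀ (by norm_num), lt_div_iff₀ hε]
    nlinarith
  have hab : -(T / 2) < T / 2 := by linarith
  have hsupp : ∀ x, x ∉ Set.Ioc (-(T / 2)) (T / 2) → ψ x = 0 := by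
    intro x hx
    by_contra hne
    have h1 := hr (subset_tsupport ψ hne)
    rw [mem_closedBall_zero_iff, Real.norm_eq_abs] at h1
    have h2 := abs_lt.1 ((h1.trans (le_abs_self r)).trans_lt hTr)
    exact hx ⟨h2.1, h2.2.le⟩
  have hcoef : ∀ k : ℤ, lineFourier ψ (ε * k) =
      T * fourierCoeffOn hab (fun x => (ψ x : ℂ)) (k * M) := by
    intro k
    rw [fourierCoeffOn_eq_integral, intervalIntegral.integral_of_le hab.le, Complex.real_smul,
      setIntegral_eq_integral_of_forall_compl_eq_zero fun x hx => by rw [hsupp x hx]; simp,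
      ← mul_assoc]
    have h1 : (T : ℂ) * ((1 / (T / 2 - -(T / 2)) : ℝ) : ℂ) = 1 := by
      rw [← Complex.ofReal_mul, ← Complex.ofReal_one]
      congr 1
      field_simp
      ring
    rw [h1, one_mul, lineFourier]
    refine integral_congr_ae (Eventually.of_forall fun x => ?_)
    simp only [smul_eq_mul, fourier_coe_apply]
    congr 2
    push_cast
    rw [hT]
    push_cast
    have hεc : (ε : ℂ) ≠ 0 := by exact_mod_cast hε.ne'
    have hMc : (M : ℂ) ≠ 0 := by exact_mod_cast hM1
    field_simp
    ring
  have hL : MemLp (fun x => (ψ x : ℂ)) 2 (volume.restrict (Set.Ioc (-(T / 2)) (T / 2))) :=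
    (hψ.ofReal).restrict _
  have hinj : Function.Injective fun k : ℤ => k * (M : ℤ) := fun a b hab' =>
    mul_right_cancel₀ (by exact_mod_cast hM1) hab'
  have hs := ((hasSum_sq_fourierCoeffOn hab hL).summable.comp_injective hinj).mul_left (T ^ 2)
  refine hs.congr fun k => ?_
  rw [hcoef, norm_mul, mul_pow, Complex.norm_real, Real.norm_eq_abs, sq_abs]
  rfl

namespace DyadicPartition

variable (P : DyadicPartition)

/-- For fixed k the weight vanishes unless |l| is at most of order ⟨k⟩, and the number of such l is
compensated by 1/⟨k⟩. -/
lemma summable_weight_mul_inv {a : ℤ → ℝ} (ha : ∀ k, 0 ≤ a k) (hs : Summable a) :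
    Summable fun p : ℤ × ℤ => P.weight p.1 p.2 * ((bracket p.1)⁻¹ * a p.1) := by
  have hnn : ∀ p : ℤ × ℤ, 0 ≤ P.weight p.1 p.2 * ((bracket p.1)⁻¹ * a p.1) := fun p =>
    mul_nonneg (P.weight_nonneg _ _) (mul_nonneg (inv_nonneg.2 (bracket_pos _).le) (ha _))
  have hR := P.one_le_radius'
  have hzero : ∀ k l : ℤ, l ∉ Finset.Icc (-(⌊2 * (P.radius : ℝ) ^ 2 * bracket k⌋₊ : ℤ))
      ⌊2 * (P.radius : ℝ) ^ 2 * bracket k⌋₊ → P.weight k l = 0 := by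
    intro k l hl
    by_contra hw
    have h1 := ((abs_le_bracket l).trans (P.bracket_le_of_weight_ne_zero hw).1)
    have h2 : ((l.natAbs : ℕ) : ℝ) = |(l : ℝ)| := by
      rw [Nat.cast_natAbs, Int.cast_abs]
    rw [← h2] at h1
    have h3 := Nat.le_floor h1
    refine hl (Finset.mem_Icc.2 ?_)
    omega
  refine (summable_prod_of_nonneg hnn).2 ⟨fun k => ?_, ?_⟩
  · refine summable_of_ne_finset_zero
      (s := Finset.Icc (-(⌊2 * (P.radius : ℝ) ^ 2 * bracket k⌋₊ : ℤ))
        ⌊2 * (P.radius : ℝ) ^ 2 * bracket k⌋₊) fun l hl => ?_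
    simp only [hzero k l hl, zero_mul]
  · refine Summable.of_nonneg_of_le (fun k => tsum_nonneg fun l => hnn (k, l)) (fun k => ?_)
      (hs.mul_left (5 * (P.radius : ℝ) ^ 2))
    have hk := bracket_pos k
    have hk1 := one_le_bracket k
    rw [tsum_eq_sum (s := Finset.Icc (-(⌊2 * (P.radius : ℝ) ^ 2 * bracket k⌋₊ : ℤ))
        ⌊2 * (P.radius : ℝ) ^ 2 * bracket k⌋₊) fun l hl => by simp only [hzero k l hl, zero_mul]]
    have hfl := Nat.floor_le (by positivity : 0 ≤ 2 * (P.radius : ℝ) ^ 2 * bracket k)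
    have hb : 0 ≤ (bracket k)⁻¹ * a k := mul_nonneg (inv_nonneg.2 hk.le) (ha k)
    refine (Finset.sum_le_card_nsmul _ _ ((bracket k)⁻¹ * a k) fun l _ =>
      mul_le_of_le_one_left hb (P.weight_le_one k l)).trans ?_
    have hcard : ((Finset.Icc (-(⌊2 * (P.radius : ℝ) ^ 2 * bracket k⌋₊ : ℤ))
        ⌊2 * (P.radius : ℝ) ^ 2 * bracket k⌋₊).card : ℝ) ≤ 5 * (P.radius : ℝ) ^ 2 * bracket k := by
      have h1 : (Finset.Icc (-(⌊2 * (P.radius : ℝ) ^ 2 * bracket k⌋₊ : ℤ))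
          ⌊2 * (P.radius : ℝ) ^ 2 * bracket k⌋₊).card =
          2 * ⌊2 * (P.radius : ℝ) ^ 2 * bracket k⌋₊ + 1 := by
        rw [Int.card_Icc]; omega
      rw [h1]
      push_cast
      have : (1 : ℝ) ≤ (P.radius : ℝ) ^ 2 * bracket k :=
        one_le_mul_of_one_le_of_one_le (one_le_pow₀ hR) hk1
      linarith
    rw [nsmul_eq_mul]
    calc _ ≤ 5 * (P.radius : ℝ) ^ 2 * bracket k * ((bracket k)⁻¹ * a k) := by gcongr
      _ = _ := by field_simp

/-- The Schur test for the kernel of `Π(∇X, u)`. -/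
lemma summable_weight_mul_of_sq {h m : ℤ → ℂ} (hs : Summable fun k => ‖h k‖ ^ 2)
    (hm : ∀ k, ‖m k‖ ≤ (bracket k)⁻¹) :
    Summable fun p : ℤ × ℤ => P.weight p.1 p.2 * (‖m p.1 * h p.1‖ * ‖h p.2‖) := by
  have h1 := P.summable_weight_mul_inv (fun k => sq_nonneg ‖h k‖) hs
  have h2 := ((Equiv.prodComm ℤ ℤ).summable_iff.2 h1).mul_left (2 * (P.radius : ℝ) ^ 2)
  refine Summable.of_nonneg_of_le (fun p => mul_nonneg (P.weight_nonneg _ _) (by positivity))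
    (fun p => ?_) (h1.add h2)
  show _ ≤ P.weight p.1 p.2 * ((bracket p.1)⁻¹ * ‖h p.1‖ ^ 2) +
    2 * (P.radius : ℝ) ^ 2 * (P.weight p.2 p.1 * ((bracket p.2)⁻¹ * ‖h p.2‖ ^ 2))
  have hp1 := bracket_pos p.1
  have hp2 := bracket_pos p.2
  rw [P.weight_comm p.2 p.1]
  by_cases hw : P.weight p.1 p.2 = 0
  · simp [hw]
  · have h3 := (P.bracket_le_of_weight_ne_zero hw).1
    have h4 : (bracket p.1)⁻¹ ≤ 2 * (P.radius : ℝ) ^ 2 * (bracket p.2)⁻¹ := by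
      rw [← div_eq_mul_inv, le_div_iff₀ hp2, inv_mul_le_iff₀ hp1, mul_comm (bracket p.1)]
      exact h3
    have h5 := P.weight_nonneg p.1 p.2
    calc P.weight p.1 p.2 * (‖m p.1 * h p.1‖ * ‖h p.2‖)
        ≤ P.weight p.1 p.2 * ((bracket p.1)⁻¹ * ‖h p.1‖ * ‖h p.2‖) := by
          rw [norm_mul]
          gcongr
          exact hm _
      _ ≤ P.weight p.1 p.2 * ((bracket p.1)⁻¹ * (‖h p.1‖ ^ 2 + ‖h p.2‖ ^ 2)) := by
          rw [mul_assoc]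
          gcongr
          nlinarith [sq_nonneg (‖h p.1‖ - ‖h p.2‖), sq_nonneg ‖h p.1‖, sq_nonneg ‖h p.2‖]
      _ = P.weight p.1 p.2 * ((bracket p.1)⁻¹ * ‖h p.1‖ ^ 2) +
          P.weight p.1 p.2 * ((bracket p.1)⁻¹ * ‖h p.2‖ ^ 2) := by ring
      _ ≤ P.weight p.1 p.2 * ((bracket p.1)⁻¹ * ‖h p.1‖ ^ 2) + P.weight p.1 p.2 *
          (2 * (P.radius : ℝ) ^ 2 * (bracket p.2)⁻¹ * ‖h p.2‖ ^ 2) := by gcongr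
      _ = _ := by ring

end DyadicPartition

/-! ### Point values -/

/-- The difference of products is (Y_N - Y')Z_N + Y'(Z_N - Z'), which tends to 0 in L¹ by Hölder's
inequality. -/
lemma tendsto_integral_mul_of_tendsto_eLpNorm {Ω : Type*} [MeasurableSpace Ω] {μ : Measure Ω}
    {Y Z : ℕ → Ω → ℂ} {Y' Z' : Ω → ℂ} (hY : ∀ N, MemLp (Y N) 2 μ) (hZ : ∀ N, MemLp (Z N) 2 μ)
    (hY' : MemLp Y' 2 μ) (hZ' : MemLp Z' 2 μ)
    (hYl : Tendsto (fun N => eLpNorm (fun ω => Y N ω - Y' ω) 2 μ) atTop (𝓝 0))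
    (hZl : Tendsto (fun N => eLpNorm (fun ω => Z N ω - Z' ω) 2 μ) atTop (𝓝 0)) :
    Tendsto (fun N => ∫ ω, Y N ω * Z N ω ∂μ) atTop (𝓝 (∫ ω, Y' ω * Z' ω ∂μ)) := by
  refine tendsto_integral_of_L1' _ (hY'.aestronglyMeasurable.mul hZ'.aestronglyMeasurable)
    (Eventually.of_forall fun N => (hY N).integrable_mul (hZ N)) ?_
  have hbound : ∀ N, eLpNorm ((fun ω => Y N ω * Z N ω) - fun ω => Y' ω * Z' ω) 1 μ ≤
      eLpNorm (fun ω => Y N ω - Y' ω) 2 μ * (eLpNorm (fun ω => Z N ω - Z' ω) 2 μ + eLpNorm Z' 2 μ) +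
        eLpNorm Y' 2 μ * eLpNorm (fun ω => Z N ω - Z' ω) 2 μ := by
    intro N
    have hdY : MemLp (fun ω => Y N ω - Y' ω) 2 μ := (hY N).sub hY'
    have hdZ : MemLp (fun ω => Z N ω - Z' ω) 2 μ := (hZ N).sub hZ'
    have h1 : ((fun ω => Y N ω * Z N ω) - fun ω => Y' ω * Z' ω) =
        ((fun ω => Y N ω - Y' ω) • Z N) + (Y' • fun ω => Z N ω - Z' ω) := by
      funext ω
      show Y N ω * Z N ω - Y' ω * Z' ω = (Y N ω - Y' ω) * Z N ω + Y' ω * (Z N ω - Z' ω)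
      ring
    have h2 : Z N = (fun ω => Z N ω - Z' ω) + Z' := by
      funext ω
      simp
    rw [h1]
    refine (eLpNorm_add_le (hdY.aestronglyMeasurable.smul (hZ N).aestronglyMeasurable)
      (hY'.aestronglyMeasurable.smul hdZ.aestronglyMeasurable) le_rfl).trans (add_le_add ?_ ?_)
    · refine (eLpNorm_smul_le_mul_eLpNorm (p := 2) (q := 2) (hZ N).aestronglyMeasurable
        hdY.aestronglyMeasurable).trans ?_
      gcongr
      nth_rw 1 [h2]
      exact eLpNorm_add_le hdZ.aestronglyMeasurable hZ'.aestronglyMeasurable (by norm_num)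
    · exact eLpNorm_smul_le_mul_eLpNorm (p := 2) (q := 2) hdZ.aestronglyMeasurable
        hY'.aestronglyMeasurable
  have hlim : Tendsto (fun N => eLpNorm (fun ω => Y N ω - Y' ω) 2 μ *
      (eLpNorm (fun ω => Z N ω - Z' ω) 2 μ + eLpNorm Z' 2 μ) +
        eLpNorm Y' 2 μ * eLpNorm (fun ω => Z N ω - Z' ω) 2 μ) atTop (𝓝 0) := by
    have h1 := ENNReal.Tendsto.mul hYl (Or.inr (by simpa using hZ'.2.ne))
      (hZl.add_const (eLpNorm Z' 2 μ)) (Or.inr ENNReal.zero_ne_top)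
    have h2 := ENNReal.Tendsto.const_mul hZl (Or.inr hY'.2.ne)
    simpa using h1.add h2
  exact tendsto_of_tendsto_of_tendsto_of_le_of_le tendsto_const_nhds hlim (fun _ => zero_le) hbound

namespace IsWhiteNoise

variable {Ω : Type*} [MeasurableSpace Ω] {μ : Measure Ω} {ξ : Ω → PeriodicDistribution}
  {η : Ω → PeriodicDistribution} {h : ℤ → ℂ}

/-- This is the covariance identity combined with the reality condition. It reduces the convergence
of the Fourier series in L²(Ω) to square summability of the symbol. -/
lemma orthonormal_coeff (hξ : IsWhiteNoise ξ μ) :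
    Orthonormal ℂ fun k : ℤ => (hξ.memLp_coeff k).toLp _ := by
  rw [orthonormal_iff_ite]
  intro k l
  rw [L2.inner_def]
  have h1 : (fun ω => inner ℂ ((hξ.memLp_coeff k).toLp _ ω) ((hξ.memLp_coeff l).toLp _ ω)) =ᵐ[μ]
      fun ω => (ξ ω).coeff l * (ξ ω).coeff (-k) := by
    filter_upwards [(hξ.memLp_coeff k).coeFn_toLp, (hξ.memLp_coeff l).coeFn_toLp] with ω hk hl
    rw [hk, hl, hξ.real, RCLike.inner_apply]
  rw [integral_congr_ae h1, hξ.integral_coeff_mul]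
  congr 1
  rw [eq_iff_iff]
  omega

lemma memLp_partialSum (hξ : IsWhiteNoise ξ μ) (hη : ∀ ω k, (η ω).coeff k = h k * (ξ ω).coeff k)
    (N : ℕ) (x : UnitAddCircle) : MemLp (fun ω => (η ω).partialSum N x) 2 μ := by
  have h1 : ∀ ω, (η ω).partialSum N x =
      ∑ k ∈ Finset.Icc (-(N : ℤ)) N, (h k * fourier k x) * (ξ ω).coeff k := fun ω =>
    Finset.sum_congr rfl fun k _ => by rw [hη]; ring
  simp only [h1]
  exact hξ.memLp_sum _ _

/-- A filtered white noise with a square summable symbol has point values. -/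
lemma exists_isPointValue (hξ : IsWhiteNoise ξ μ)
    (hη : ∀ ω k, (η ω).coeff k = h k * (ξ ω).coeff k) (hs : Summable fun k => ‖h k‖ ^ 2)
    (x : UnitAddCircle) : ∃ Y : Ω → ℂ, IsPointValue μ η x Y := by
  have h1 := hξ.orthonormal_coeff.orthogonalFamily.summable_iff_norm_sq_summable
    fun k => h k * fourier k x
  simp only [norm_mul, norm_fourier_apply, mul_one] at h1
  obtain ⟨Y, hY⟩ := h1.2 hs
  refine ⟨Y, Lp.memLp Y, ?_⟩
  have h2 : Tendsto (fun N : ℕ => (hξ.memLp_partialSum hη N x).toLp _) atTop (𝓝 Y) := by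
    have h3 := hY.comp (Finset.tendsto_Icc_neg (R := ℤ))
    refine h3.congr fun N => ?_
    refine Lp.ext ?_
    have h4 : ∀ F : Finset ℤ, ((∑ k ∈ F, (h k * fourier k x) • (hξ.memLp_coeff k).toLp _ : Lp ℂ 2 μ) :
        Ω → ℂ) =ᵐ[μ] fun ω => ∑ k ∈ F, (h k * fourier k x) * (ξ ω).coeff k := by
      intro F
      induction F using Finset.induction_on with
      | empty =>
        simp only [Finset.sum_empty]
        exact Lp.coeFn_zero ℂ 2 μ
      | insert k F hk ih =>
        rw [Finset.sum_insert hk]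
        filter_upwards [Lp.coeFn_add ((h k * fourier k x) • (hξ.memLp_coeff k).toLp _)
          (∑ k ∈ F, (h k * fourier k x) • (hξ.memLp_coeff k).toLp _ : Lp ℂ 2 μ), ih,
          Lp.coeFn_smul (h k * fourier k x) ((hξ.memLp_coeff k).toLp _),
          (hξ.memLp_coeff k).coeFn_toLp] with ω ha hb hc hd
        rw [ha, Pi.add_apply, hb, hc, Pi.smul_apply, hd, Finset.sum_insert hk, smul_eq_mul]
    refine (h4 (Finset.Icc (-(N : ℤ)) N)).trans ?_
    filter_upwards [(hξ.memLp_partialSum hη N x).coeFn_toLp] with ω hω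
    rw [hω, partialSum]
    exact Finset.sum_congr rfl fun k _ => by rw [hη]; ring
  rw [← Lp.toLp_coeFn Y (Lp.memLp Y)] at h2
  exact (Lp.tendsto_Lp_iff_tendsto_eLpNorm'' _ _ _ _).1 h2

end IsWhiteNoise

end TorusNoise
end

/-! ### Almost sure identification of the products, pointwise means, and the theorem -/

noncomputable section

namespace TorusNoise

lemma norm_gradPotential_symbol_le (k : ℤ) :
    ‖Complex.I / (2 * Real.pi) * (((k : ℝ)⁻¹ : ℝ) : ℂ)‖ ≤ (bracket k)⁻¹ := by
  have h1 : ‖Complex.I / (2 * (Real.pi : ℂ))‖ ≤ 1 := by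
    rw [norm_div, Complex.norm_I, norm_mul, Complex.norm_real, Real.norm_eq_abs,
      abs_of_pos Real.pi_pos, Complex.norm_two, div_le_one (by positivity)]
    linarith [Real.pi_gt_three]
  rw [norm_mul, Complex.norm_real, Real.norm_eq_abs]
  exact (mul_le_of_le_one_left (abs_nonneg _) h1).trans inv_abs_le_bracket_inv

namespace IsWhiteNoise

variable {Ω : Type*} [MeasurableSpace Ω] {μ : Measure Ω} {ξ : Ω → PeriodicDistribution}

lemma ae_diamond_eq (P : DyadicPartition) (hξ : IsWhiteNoise ξ μ) :
    ∀ᵐ ω ∂μ, ∃ hr : IsRough (ξ ω).coeff, P.diamond (ξ ω) = symProduct P hr hr := by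
  filter_upwards [hξ.ae_isRough (h := fun _ => 1) (H := 1) (fun ω k => (one_mul _).symm)
    (fun k => by simp)] with ω hr
  exact ⟨hr, DyadicPartition.diamond_eq (isWeakIntegral_resonantFlow P hr)⟩

variable {η : Ω → PeriodicDistribution} {h : ℤ → ℂ} {H : ℝ}

lemma ae_resonant_gradPotential_eq (P : DyadicPartition) (hξ : IsWhiteNoise ξ μ)
    (hη : ∀ ω k, (η ω).coeff k = h k * (ξ ω).coeff k) (hH : ∀ k, ‖h k‖ ≤ H) :
    ∀ᵐ ω ∂μ, ∃ hr : IsRough (η ω).coeff,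
      P.resonant (gradPotential (η ω)) (η ω) = symProduct P hr hr := by
  filter_upwards [hξ.ae_isRough hη hH] with ω hr
  exact ⟨hr, (isResonantProduct_gradPotential P hr).resonant_eq⟩

/-- The resonant product of the heat flow of a filtered white noise is centred at every point. -/
lemma integral_resonantAt_heat (P : DyadicPartition) (hξ : IsWhiteNoise ξ μ)
    (hη : ∀ ω k, (η ω).coeff k = h k * (ξ ω).coeff k) (hH : ∀ k, ‖h k‖ ≤ H)
    (x : UnitAddCircle) {t : ℝ} (ht : 0 < t) :
    (∀ ω, Summable fun i => P.resonantTerm (grad (heat t (meanFree (η ω)))) (η ω) i x) ∧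
      Integrable (fun ω => P.resonantAt (grad (heat t (meanFree (η ω)))) (η ω) x) μ ∧
      ∫ ω, P.resonantAt (grad (heat t (meanFree (η ω)))) (η ω) x ∂μ = 0 := by
  refine ⟨fun ω => ?_, ?_⟩
  · obtain ⟨C, n, hC, hb⟩ := (η ω).exists_bound
    exact (P.hasSum_resonantTerm (P.summable_weight_mul_of_rapid
      (summable_bracket_pow_mul_grad_heat (η ω) ht) hC hb) x).summable
  · have hH0 : 0 ≤ H := (norm_nonneg _).trans (hH 0)
    -- The bounded symbol is regarded as a distribution, so that the decay estimate for the heat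
    -- flow applies to it.
    let u : PeriodicDistribution := ⟨h, H, 0, fun k => by rw [pow_zero, mul_one]; exact hH k⟩
    have hs := P.summable_weight_mul_of_rapid (summable_bracket_pow_mul_grad_heat u ht)
      (g := h) (n := 0) hH0 (fun k => by rw [pow_zero, mul_one]; exact hH k)
    simp only [grad_heat_coeff u ht] at hs
    exact (hξ.integral_resonantAt (ζ := fun ω => grad (heat t (meanFree (η ω))))
      (m := fun k => 2 * Real.pi * Complex.I * heatMode t k) P hη (fun ω k => grad_heat_coeff (η ω) ht k)
      (fun k => by rw [heatMode_neg]; push_cast; ring) hs x).2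

lemma integral_resonantAt_gradPotential (P : DyadicPartition) (hξ : IsWhiteNoise ξ μ)
    (hη : ∀ ω k, (η ω).coeff k = h k * (ξ ω).coeff k) (hs : Summable fun k => ‖h k‖ ^ 2)
    (x : UnitAddCircle) :
    (∀ᵐ ω ∂μ, Summable fun i => P.resonantTerm (gradPotential (η ω)) (η ω) i x) ∧
      Integrable (fun ω => P.resonantAt (gradPotential (η ω)) (η ω) x) μ ∧
      ∫ ω, P.resonantAt (gradPotential (η ω)) (η ω) x ∂μ = 0 := by
  have hm : ∀ k : ℤ, Complex.I / (2 * (Real.pi : ℂ)) * ((((-k : ℤ) : ℝ)⁻¹ : ℝ) : ℂ) =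
      -(Complex.I / (2 * Real.pi) * (((k : ℝ)⁻¹ : ℝ) : ℂ)) := fun k => by
    push_cast
    rw [inv_neg]
    ring
  have hsum := P.summable_weight_mul_of_sq hs norm_gradPotential_symbol_le
  have hc : ∀ ω k, (gradPotential (η ω)).coeff k =
      Complex.I / (2 * Real.pi) * (((k : ℝ)⁻¹ : ℝ) : ℂ) * (η ω).coeff k :=
    fun ω k => gradPotential_coeff (η ω) k
  exact hξ.integral_resonantAt P hη hc hm hsum x

/-- The expectation of the product of the limits is the limit of the expectations with cut-off, and
each of these vanishes by oddness. -/
lemma exists_isPointValue_gradPotential (hξ : IsWhiteNoise ξ μ)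
    (hη : ∀ ω k, (η ω).coeff k = h k * (ξ ω).coeff k)
    (hh : ∀ k, h k * h (-k) = ((‖h k‖ ^ 2 : ℝ) : ℂ)) (hn : ∀ k, ‖h (-k)‖ = ‖h k‖)
    (hs : Summable fun k => ‖h k‖ ^ 2) (x : UnitAddCircle) :
    ∃ Y Z : Ω → ℂ, IsPointValue μ (fun ω => gradPotential (η ω)) x Y ∧ IsPointValue μ η x Z ∧
      Integrable (fun ω => Y ω * Z ω) μ ∧ ∫ ω, Y ω * Z ω ∂μ = 0 := by
  have hη' : ∀ ω k, (gradPotential (η ω)).coeff k =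
      (Complex.I / (2 * Real.pi) * (((k : ℝ)⁻¹ : ℝ) : ℂ) * h k) * (ξ ω).coeff k := fun ω k => by
    rw [gradPotential_coeff, hη]; ring
  have hs' : Summable fun k : ℤ =>
      ‖Complex.I / (2 * Real.pi) * (((k : ℝ)⁻¹ : ℝ) : ℂ) * h k‖ ^ 2 := by
    refine Summable.of_nonneg_of_le (fun k => sq_nonneg _) (fun k => ?_) hs
    rw [norm_mul]
    gcongr
    exact mul_le_of_le_one_left (norm_nonneg _)
      ((norm_gradPotential_symbol_le k).trans (inv_le_one_of_one_le₀ (one_le_bracket k)))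
  obtain ⟨Y, hY⟩ := hξ.exists_isPointValue hη' hs' x
  obtain ⟨Z, hZ⟩ := hξ.exists_isPointValue hη hs x
  refine ⟨Y, Z, hY, hZ, hY.1.integrable_mul hZ.1, ?_⟩
  have hlim := tendsto_integral_mul_of_tendsto_eLpNorm
    (fun N => hξ.memLp_partialSum hη' N x) (fun N => hξ.memLp_partialSum hη N x) hY.1 hZ.1 hY.2 hZ.2
  have hzero : ∀ N : ℕ,
      ∫ ω, (gradPotential (η ω)).partialSum N x * (η ω).partialSum N x ∂μ = 0 := fun N => by
    rw [(hξ.integral_partialSum_mul hη hh x N).2]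
    exact sum_renormTerm_eq_zero (a := fun k => ‖h k‖ ^ 2) (fun k => by rw [hn]) N
  simp only [hzero] at hlim
  exact (tendsto_nhds_unique hlim tendsto_const_nhds)

end IsWhiteNoise

end TorusNoise
end

theorem mainTheorem3 {Ω : Type*} [MeasurableSpace Ω] (μ : Measure Ω) [IsProbabilityMeasure μ]
    (P : DyadicPartition) (ξ : Ω → PeriodicDistribution) (hξ : IsWhiteNoise ξ μ) :
    -- the resonant products `Π(∇P_t Q ξ, ξ)`, `t > 0`, and their integral `∇X ⋄ ξ` exist
    (∀ ω, ∀ t : ℝ, 0 < t →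
      P.IsResonantProduct (grad (heat t (meanFree (ξ ω)))) (ξ ω) (P.resonantFlow (ξ ω) t)) ∧
    (∀ᵐ ω ∂μ, IsWeakIntegral (P.resonantFlow (ξ ω)) (P.diamond (ξ ω))) ∧
    -- moments
    (∀ α : ℝ, α < 3 / 2 → ∀ p : ℝ, 1 ≤ p →
      AEMeasurable (fun ω => P.holderNorm (2 * α - 3) (P.diamond (ξ ω))) μ ∧
      ∫⁻ ω, P.holderNorm (2 * α - 3) (P.diamond (ξ ω)) ^ p ∂μ < ∞) ∧
    ∀ ψ : ℝ → ℝ, IsMollifier ψ → ∀ ξε : ℝ → Ω → PeriodicDistribution,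
      (∀ ε ω, ξε ε ω = convolve (rescale ψ ε) (ξ ω)) →
      -- `∇X^ε = ∫₀^∞ ∇P_t Q ξ^ε dt`, and `Π(∇X^ε, ξ^ε)` exists
      (∀ ε : ℝ, 0 < ε → ∀ ω,
        IsWeakIntegral (fun t => grad (heat t (meanFree (ξε ε ω)))) (gradPotential (ξε ε ω))) ∧
      (∀ ε : ℝ, 0 < ε → ∀ᵐ ω ∂μ,
        P.IsResonantProduct (gradPotential (ξε ε ω)) (ξε ε ω)
          (P.resonant (gradPotential (ξε ε ω)) (ξε ε ω))) ∧
      -- convergence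
      (∀ α : ℝ, α < 3 / 2 → ∀ p : ℝ, 1 ≤ p →
        (∀ ε : ℝ, 0 < ε → AEMeasurable (fun ω => P.holderNorm (2 * α - 3)
          (P.diamond (ξ ω) - P.resonant (gradPotential (ξε ε ω)) (ξε ε ω))) μ) ∧
        Tendsto (fun ε : ℝ => ∫⁻ ω, P.holderNorm (2 * α - 3)
          (P.diamond (ξ ω) - P.resonant (gradPotential (ξε ε ω)) (ξε ε ω)) ^ p ∂μ)
          (𝓝[>] 0) (𝓝 0)) ∧
      -- vanishing of the renormalization constant
      ∀ ε : ℝ, 0 < ε →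
        -- `E[∇X^ε(x) ξ^ε(x)]`, with the two factors cut off at frequency `N`
        (∀ (x : UnitAddCircle) (N : ℕ),
          Integrable (fun ω =>
            (gradPotential (ξε ε ω)).partialSum N x * (ξε ε ω).partialSum N x) μ ∧
          ∫ ω, (gradPotential (ξε ε ω)).partialSum N x * (ξε ε ω).partialSum N x ∂μ =
            ∑ k ∈ (Finset.Icc (-(N : ℤ)) N).erase 0,
              ((‖lineFourier ψ (ε * k)‖ ^ 2 / (4 * Real.pi ^ 2 * (k : ℝ) ^ 2) : ℝ) : ℂ) *
                (2 * Real.pi * Complex.I * k) ∧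
          ∑ k ∈ (Finset.Icc (-(N : ℤ)) N).erase 0,
              ((‖lineFourier ψ (ε * k)‖ ^ 2 / (4 * Real.pi ^ 2 * (k : ℝ) ^ 2) : ℝ) : ℂ) *
                (2 * Real.pi * Complex.I * k) = 0) ∧
        -- `E[Π(∇X^ε, ξ^ε)]` as a distribution
        (∀ φ : UnitAddCircle → ℂ, IsTestFunction φ →
          Integrable (fun ω =>
            (P.resonant (gradPotential (ξε ε ω)) (ξε ε ω)).pairing φ) μ ∧
          ∫ ω, (P.resonant (gradPotential (ξε ε ω)) (ξε ε ω)).pairing φ ∂μ = 0) ∧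
        -- `∫₀^∞ E[Π(∇P_t Q ξ^ε, ξ^ε)(x)] dt`
        (∀ x : UnitAddCircle,
          (∀ t : ℝ, 0 < t →
            (∀ ω, Summable (fun i =>
              P.resonantTerm (grad (heat t (meanFree (ξε ε ω)))) (ξε ε ω) i x)) ∧
            Integrable (fun ω =>
              P.resonantAt (grad (heat t (meanFree (ξε ε ω)))) (ξε ε ω) x) μ ∧
            ∫ ω, P.resonantAt (grad (heat t (meanFree (ξε ε ω)))) (ξε ε ω) x ∂μ = 0) ∧
          IntegrableOn (fun t : ℝ =>
            ∫ ω, P.resonantAt (grad (heat t (meanFree (ξε ε ω)))) (ξε ε ω) x ∂μ)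
            (Set.Ioi 0) volume ∧
          ∫ t in Set.Ioi (0 : ℝ),
            ∫ ω, P.resonantAt (grad (heat t (meanFree (ξε ε ω)))) (ξε ε ω) x ∂μ = 0) ∧
        -- if `ψ ∈ L²`, so that `ξ^ε(x)` is a random variable, all expressions make sense pointwise
        (MemLp ψ 2 volume →
          (∀ x : UnitAddCircle,
            (∃ Y Z : Ω → ℂ,
              IsPointValue μ (fun ω => gradPotential (ξε ε ω)) x Y ∧
              IsPointValue μ (ξε ε) x Z ∧
              Integrable (fun ω => Y ω * Z ω) μ ∧ ∫ ω, Y ω * Z ω ∂μ = 0) ∧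
            (∀ᵐ ω ∂μ, Summable (fun i =>
              P.resonantTerm (gradPotential (ξε ε ω)) (ξε ε ω) i x)) ∧
            Integrable (fun ω => P.resonantAt (gradPotential (ξε ε ω)) (ξε ε ω) x) μ ∧
            ∫ ω, P.resonantAt (gradPotential (ξε ε ω)) (ξε ε ω) x ∂μ = 0) ∧
          HasSum (fun k : {k : ℤ // k ≠ 0} =>
            ((‖lineFourier ψ (ε * (k : ℤ))‖ ^ 2 /
                (4 * Real.pi ^ 2 * ((k : ℤ) : ℝ) ^ 2) : ℝ) : ℂ) *
              (2 * Real.pi * Complex.I * ((k : ℤ) : ℂ))) 0) := by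
  refine ⟨fun ω t ht => isResonantProduct_resonantFlow P (ξ ω) ht, ?_, fun α hα p hp => ?_, ?_⟩
  · filter_upwards [hξ.ae_diamond_eq P] with ω ⟨hr, hω⟩
    rw [hω]
    exact isWeakIntegral_resonantFlow P hr
  -- Only the moment bound for white noise itself is used here, so the value 1 for the bound on the
  -- symbol is arbitrary.
  · obtain ⟨-, -, -, -, -, -, -, -, -, hw, -⟩ :=
      hξ.exists_lintegral_holderNorm_le P (by linarith : 2 * α - 3 < 0) hp 1
    exact ⟨aemeasurable_holderNorm P _ (hξ.aemeasurable_coeff_symProduct P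
      (h := fun _ => 1) (H := 1) (fun ω k => (one_mul _).symm) (fun k => by simp)
      (hξ.ae_diamond_eq P)), hw _ (hξ.ae_diamond_eq P)⟩
  intro ψ hψ ξε hdef
  have hcoef : ∀ ε : ℝ, 0 < ε → ∀ ω k,
      (ξε ε ω).coeff k = lineFourier ψ (ε * k) * (ξ ω).coeff k := fun ε hε ω k => by
    rw [hdef, ← lineFourier_rescale ψ hε]
    rfl
  set H : ℝ := ∫ x, ‖ψ x‖ with hH
  have hbound : ∀ (ε : ℝ) (k : ℤ), ‖lineFourier ψ (ε * k)‖ ≤ H := fun ε k =>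
    norm_lineFourier_le ψ _
  have hres : ∀ ε : ℝ, 0 < ε → ∀ᵐ ω ∂μ, ∃ hr : IsRough (ξε ε ω).coeff,
      P.resonant (gradPotential (ξε ε ω)) (ξε ε ω) = symProduct P hr hr := fun ε hε =>
    hξ.ae_resonant_gradPotential_eq P (hcoef ε hε) (hbound ε)
  have hconj : ∀ (ε : ℝ) (k : ℤ), lineFourier ψ (ε * (-k : ℤ)) =
      starRingEnd ℂ (lineFourier ψ (ε * k)) := fun ε k => by
    rw [← lineFourier_neg]
    push_cast
    rw [mul_neg]
  have hsq : ∀ (ε : ℝ) (k : ℤ), lineFourier ψ (ε * k) * lineFourier ψ (ε * (-k : ℤ)) =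
      ((‖lineFourier ψ (ε * k)‖ ^ 2 : ℝ) : ℂ) := fun ε k => by
    rw [hconj, Complex.mul_conj']
    push_cast
    rfl
  have hnorm : ∀ (ε : ℝ) (k : ℤ), ‖lineFourier ψ (ε * (-k : ℤ))‖ = ‖lineFourier ψ (ε * k)‖ :=
    fun ε k => by rw [hconj, RCLike.norm_conj]
  refine ⟨fun ε hε ω => isWeakIntegral_grad_heat _, fun ε hε => ?_, fun α hα p hp => ⟨fun ε hε => ?_, ?_⟩,
    fun ε hε => ⟨fun x N => ?_, fun φ hφ => ?_, fun x => ?_, fun hL2 => ⟨fun x => ?_, ?_⟩⟩⟩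
  · filter_upwards [hres ε hε] with ω ⟨hr, hω⟩
    rw [hω]
    exact isResonantProduct_gradPotential P hr
  · refine aemeasurable_holderNorm P _ fun k => ?_
    exact (hξ.aemeasurable_coeff_symProduct P (h := fun _ => 1) (H := 1)
      (fun ω k => (one_mul _).symm) (fun k => by simp) (hξ.ae_diamond_eq P) k).sub
      (hξ.aemeasurable_coeff_symProduct P (hcoef ε hε) (hbound ε) (hres ε hε) k)
  · obtain ⟨q, n, K, s, hq, hn, hK, hs, hsum, -, hle⟩ :=
      hξ.exists_lintegral_holderNorm_le P (by linarith : 2 * α - 3 < 0) hp H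
    -- The symbol 1 - ψ̂(εk) of ξ - ξ^ε is bounded by 1 + ‖ψ‖_{L¹} and tends to 0 for each k,
    -- because ψ̂ is continuous with ψ̂(0) = 1.
    have hlim := P.tendsto_tsum_blockVariance hq hn hsum (l := 𝓝[>] (0 : ℝ)) (H := 1 + H)
      (g := fun ε k => 1 - lineFourier ψ (ε * k))
      (Eventually.of_forall fun ε k => (norm_sub_le _ _).trans (by
        rw [norm_one]
        exact add_le_add_right (hbound ε k) 1))
      (fun k => by simpa using (hψ.tendsto_lineFourier k).const_sub 1)
    have hlim2 := ENNReal.Tendsto.const_mul (a := K)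
      ((ENNReal.tendsto_ofReal hlim).ennrpow_const s) (Or.inr hK)
    rw [ENNReal.ofReal_zero, ENNReal.zero_rpow_of_pos hs, mul_zero] at hlim2
    refine tendsto_of_tendsto_of_tendsto_of_le_of_le' tendsto_const_nhds hlim2
      (Eventually.of_forall fun _ => zero_le) ?_
    filter_upwards [self_mem_nhdsWithin] with ε hε
    exact hle _ (ξε ε) _ _ (hbound ε) (hcoef ε hε) (hξ.ae_diamond_eq P) (hres ε hε)
  · obtain ⟨h1, h2⟩ := hξ.integral_partialSum_mul (hcoef ε hε) (hsq ε) x N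
    exact ⟨h1, h2, sum_renormTerm_eq_zero (a := fun k => ‖lineFourier ψ (ε * k)‖ ^ 2)
      (fun k => by rw [hnorm]) N⟩
  · exact hξ.integral_pairing_symProduct P (hcoef ε hε) (hbound ε) (hres ε hε) hφ
  · have h1 := fun (t : ℝ) (ht : 0 < t) =>
      hξ.integral_resonantAt_heat P (hcoef ε hε) (hbound ε) x ht
    have h2 : Set.EqOn (fun t : ℝ =>
        ∫ ω, P.resonantAt (grad (heat t (meanFree (ξε ε ω)))) (ξε ε ω) x ∂μ) (fun _ => 0)
        (Set.Ioi 0) := fun t ht => (h1 t ht).2.2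
    refine ⟨h1, integrableOn_zero.congr_fun h2.symm measurableSet_Ioi, ?_⟩
    rw [setIntegral_congr_fun measurableSet_Ioi h2, integral_zero]
  · have hs := summable_norm_sq_lineFourier hL2 hψ.hasCompactSupport hε
    exact ⟨hξ.exists_isPointValue_gradPotential (hcoef ε hε) (hsq ε) (hnorm ε) hs x,
      hξ.integral_resonantAt_gradPotential P (hcoef ε hε) hs x⟩
  · exact hasSum_renormTerm (a := fun k => ‖lineFourier ψ (ε * k)‖ ^ 2)
      (fun k => by rw [hnorm]) (fun k => sq_nonneg _)
      (summable_norm_sq_lineFourier hL2 hψ.hasCompactSupport hε)
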